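/- **Model.** Fix the number of modalities $M$ and the numbers of factors $K_1,\dots,K_M$. For each sample size $n$ there are dimensions $p_1,\dots,p_M$ (which may depend on $n$), $p=\sum_m p_m$, and $n$ i.i.d. copies $(f_i,u_i,\epsilon_i)$, $i\in[n]$, where $f_i=(f_{i,1}',\dots,f_{i,M}')'$, $f_{i,m}\in\mathbb R^{K_m}$, $u_i=(u_{i,1}',\dots,u_{i,M}')'$, $u_{i,m}\in\mathbb R^{p_m}$, and $\epsilon_i\in\mathbb R$. The covariates $x_i=(x_{i,1}',\dots,x_{i,M}')'\in\mathbb R^p$ satisfy the factor decomposition $x_{i,m}=\Lambda_m f_{i,m}+u_{i,m}$ with $\Lambda_m\in\mathbb R^{p_m\times K_m}$, $\operatorname{var}(f_{i,m})=I_{K_m}$, $\Lambda_m'\Lambda_m$ diagonal, and $f_i$ uncorrelated with $u_i$. The response is $y_i=x_i'\beta^*+\epsilon_i$, where $\beta^*\in\mathbb R^p$, $\mathbb E\epsilon_i=0$, $\operatorname{var}(\epsilon_i)=\sigma_\epsilon^2$, and $\epsilon_i$ is uncorrelated with $f_i$ and $u_i$. All laws, $\Lambda_m$, $\beta^*$ and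 $\sigma^2_\epsilon$ may depend on $n$. **Assumptions.** There are constants $c>0$ and $C<\infty$, not depending on $n$, such that, for all $m\in[M]$ and $i,j\in[n]$: 1. (Sub-Gaussian components.) $\mathbb E f_{i,m}=0$, $\mathbb E u_{i,m}=0$, and for all real $t$ and all vectors $\alpha$ of the right length, $\mathbb E e^{t\alpha' f_{i,m}}\le e^{C\|\alpha\|_2^2t^2/2}$, $\mathbb E e^{t\alpha' u_{i,m}}\le e^{C\|\alpha\|_2^2t^2/2}$ and $\mathbb E e^{t\epsilon_i}\le e^{Ct^2/2}$. Moreover $\mathbb E e^{t x_{i,-m}'w^*_k}\le e^{Ct^2/2}$ for all $k\in[K_m]$, where $x_{i,-m}$ collects the covariates of the modalities other than $m$ and $w^*_k$ is the $k$th column of $\{\mathbb E(x_{i,-m}x_{i,-m}')\}^{-1}\mathbb E(x_{i,-m}f_{i,m}')$. 2. (Loadings and idiosyncratic components.) $\mathbb E[p_m^{-1/2}\{u_{i,m}'u_{j,m}-\mathbb E(u_{i,m}'u_{j,m})\}]^4\le C$; $\mathbb E\|p_m^{-1/2}\Lambda_m'u_{i,m}\|_2^4\le C$; the entries of $\Lambda_m$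 are at most $C$ in absolute value; the smallest eigenvalue of $\Sigma_u=\operatorname{var}(u_i)$ is at least $c$; the maximal absolute column sum of $\operatorname{var}(u_{i,m})$ is at most $C$; and $\operatorname{var}(u_{i,m_s}u_{i,m_t})\ge c$ for all $s,t\in[p_m]$. 3. (Sparsity.) $s^*(\log p)/n\to0$ as $n\to\infty$, where $s^*=|\operatorname{supp}(\beta^*)|$. **Claim.** There is a constant $C_0>0$, depending only on $M$, $K_1,\dots,K_M$, $c$ and $C$, such that the following holds for every constant $C_\lambda\ge C_0$. Let $\lambda_\epsilon=C_\lambda\sqrt{(\log p)/n}$, let $$\tilde\beta\in\operatorname*{arg\,min}_{\beta\in\mathbb R^p}\ \frac1{2n}\sum_{i=1}^n(y_i-x_i'\beta)^2+\lambda_\epsilon\|\beta\|_1$$ be any Lasso estimator, and let $\hat\sigma_\epsilon^2=n^{-1}\sum_{i=1}^n(y_i-x_i'\tilde\beta)^2$. Then $\hat\sigma_\epsilon^2-\sigma_\epsilon^2\to0$ in probability as $n\to\infty$. -/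

import Mathlib

open MeasureTheory ProbabilityTheory Filter Topology
open scoped NNReal Matrix

namespace FactorRegression

/-- Index set of a vector that stacks `M` blocks, the `m`-th of length `d m`. -/
abbrev Coord {M : ℕ} (d : Fin M → ℕ) : Type := (m : Fin M) × Fin (d m)

/-- The ingredients of the factor regression model with `M` modalities of `p m` variables and
`K m` latent factors, observed on `n` subjects. The random elements live on `Ω`. -/
structure Model {M : ℕ} (p K : Fin M → ℕ) (n : ℕ) (Ω : Type*) where
  /-- latent factors of subject `i`, all modalities stacked -/
  f : Fin n → Ω → Coord K → ℝ
  /-- idiosyncratic components of subject `i`, all modalities stacked -/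
  u : Fin n → Ω → Coord p → ℝ
  /-- regression error of subject `i` -/
  ε : Fin n → Ω → ℝ
  /-- loading matrices -/
  Λ : (m : Fin M) → Matrix (Fin (p m)) (Fin (K m)) ℝ
  /-- true regression coefficients -/
  β : Coord p → ℝ

namespace Model

variable {M n : ℕ} {p K : Fin M → ℕ} {Ω : Type*}

/-- Covariates: in each modality, `x_m = Λ_m f_m + u_m`. -/
def x (D : Model p K n Ω) (i : Fin n) (ω : Ω) : Coord p → ℝ :=
  fun j => ∑ k : Fin (K j.1), D.Λ j.1 j.2 k * D.f i ω ⟨j.1, k⟩ + D.u i ω j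

/-- Responses: `y = x' β + ε`. -/
def y (D : Model p K n Ω) (i : Fin n) (ω : Ω) : ℝ :=
  D.x i ω ⬝ᵥ D.β + D.ε i ω

/-- The vector of all the primitive random variables of subject `i`. -/
def row (D : Model p K n Ω) (i : Fin n) (ω : Ω) : (Coord K → ℝ) × (Coord p → ℝ) × ℝ :=
  (D.f i ω, D.u i ω, D.ε i ω)

/-- The size of the support of the true coefficient vector. -/
noncomputable def sparsity (D : Model p K n Ω) : ℕ :=
  (Finset.univ.filter fun j => D.β j ≠ 0).card

variable [MeasurableSpace Ω]

/-- Covariance matrix of the stacked idiosyncratic vector `u` of subject `i`. -/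
noncomputable def covU (D : Model p K n Ω) (P : Measure Ω) (i : Fin n) :
    Matrix (Coord p) (Coord p) ℝ :=
  Matrix.of fun a b => cov[fun ω => D.u i ω a, fun ω => D.u i ω b; P]

/-- `E (x_{-m} x_{-m}')`, the second moment matrix of the covariates outside modality `m`. -/
noncomputable def momentXX (D : Model p K n Ω) (P : Measure Ω) (i : Fin n) (m : Fin M) :
    Matrix {a : Coord p // a.1 ≠ m} {a : Coord p // a.1 ≠ m} ℝ :=
  Matrix.of fun a b => ∫ ω, D.x i ω a * D.x i ω b ∂P

/-- `E (x_{-m} f_m')`. -/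
noncomputable def momentXF (D : Model p K n Ω) (P : Measure Ω) (i : Fin n) (m : Fin M) :
    Matrix {a : Coord p // a.1 ≠ m} (Fin (K m)) ℝ :=
  Matrix.of fun a k => ∫ ω, D.x i ω a * D.f i ω ⟨m, k⟩ ∂P

/-- `W* = E (x_{-m} x_{-m}')⁻¹ E (x_{-m} f_m')`, the coefficients of the linear projection of
the factors of modality `m` on the covariates of the other modalities. -/
noncomputable def wStar (D : Model p K n Ω) (P : Measure Ω) (i : Fin n) (m : Fin M) :
    Matrix {a : Coord p // a.1 ≠ m} (Fin (K m)) ℝ :=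
  (D.momentXX P i m)⁻¹ * D.momentXF P i m

/-- Standing assumptions of the factor regression model with error variance `σ2`. -/
structure IsFactorRegression (D : Model p K n Ω) (P : Measure Ω) (σ2 : ℝ) : Prop where
  measurable_f : ∀ i, Measurable (D.f i)
  measurable_u : ∀ i, Measurable (D.u i)
  measurable_ε : ∀ i, Measurable (D.ε i)
  /-- the `n` subjects are independent ... -/
  indep : iIndepFun D.row P
  /-- ... and identically distributed -/
  ident : ∀ i i', IdentDistrib (D.row i) (D.row i') P P
  /-- `var (f_m) = I` -/
  var_f : ∀ i m (k l : Fin (K m)),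
    cov[fun ω => D.f i ω ⟨m, k⟩, fun ω => D.f i ω ⟨m, l⟩; P] = if k = l then 1 else 0
  /-- `Λ_m' Λ_m` is diagonal -/
  loadings_diag : ∀ m, ((D.Λ m)ᵀ * D.Λ m).IsDiag
  /-- the stacked vectors `f` and `u` are uncorrelated -/
  uncorr_f_u : ∀ i a b, cov[fun ω => D.f i ω a, fun ω => D.u i ω b; P] = 0
  /-- the error is centred, with variance `σ2`, and uncorrelated with `f` and `u` -/
  mean_ε : ∀ i, ∫ ω, D.ε i ω ∂P = 0
  var_ε : ∀ i, Var[D.ε i; P] = σ2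
  uncorr_ε_f : ∀ i a, cov[D.ε i, fun ω => D.f i ω a; P] = 0
  uncorr_ε_u : ∀ i a, cov[D.ε i, fun ω => D.u i ω a; P] = 0

/-- Sub-Gaussian condition with constant `C`. Here `HasSubgaussianMGF X v P` says that
`exp (t X)` is integrable with `E exp (t X) ≤ exp (v t ^ 2 / 2)`, for all real `t`. -/
structure SubGaussianCondition (D : Model p K n Ω) (P : Measure Ω) (C : ℝ≥0) : Prop where
  mean_f : ∀ i a, ∫ ω, D.f i ω a ∂P = 0
  mean_u : ∀ i a, ∫ ω, D.u i ω a ∂P = 0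
  subG_f : ∀ i m (α : Fin (K m) → ℝ),
    HasSubgaussianMGF (fun ω => ∑ k, α k * D.f i ω ⟨m, k⟩) (C * ∑ k, ‖α k‖₊ ^ 2) P
  subG_u : ∀ i m (α : Fin (p m) → ℝ),
    HasSubgaussianMGF (fun ω => ∑ j, α j * D.u i ω ⟨m, j⟩) (C * ∑ j, ‖α j‖₊ ^ 2) P
  subG_proj : ∀ i m (k : Fin (K m)),
    HasSubgaussianMGF (fun ω => ∑ a, D.x i ω a.1 * D.wStar P i m a k) C P
  subG_ε : ∀ i, HasSubgaussianMGF (D.ε i) C P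

/-- Moment and covariance conditions on the loadings and on the idiosyncratic components,
with constants `c` and `C`. -/
structure LoadingCondition (D : Model p K n Ω) (P : Measure Ω) (c : ℝ) (C : ℝ≥0) : Prop where
  /-- `E [p_m^(-1/2) (u_{i,m}' u_{i',m} - E (u_{i,m}' u_{i',m}))] ^ 4 ≤ C` -/
  fourth_moment : ∀ i i' m,
    ∫ ω, ((√(p m : ℝ))⁻¹ * (∑ j, D.u i ω ⟨m, j⟩ * D.u i' ω ⟨m, j⟩
      - ∫ ω', ∑ j, D.u i ω' ⟨m, j⟩ * D.u i' ω' ⟨m, j⟩ ∂P)) ^ 4 ∂P ≤ C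
  /-- `E ‖p_m^(-1/2) Λ_m' u_{i,m}‖₂ ^ 4 ≤ C` -/
  fourth_moment_loading : ∀ i m,
    ∫ ω, (∑ k, ((√(p m : ℝ))⁻¹ * ∑ j, D.Λ m j k * D.u i ω ⟨m, j⟩) ^ 2) ^ 2 ∂P ≤ C
  loading_le : ∀ m j k, |D.Λ m j k| ≤ C
  /-- the smallest eigenvalue of the covariance matrix of the whole vector `u` is at least `c`
  (hence so is that of each of its diagonal blocks, the covariance matrices of the `u_m`) -/
  minEigenvalue : ∀ i (v : Coord p → ℝ), c * (v ⬝ᵥ v) ≤ v ⬝ᵥ (D.covU P i *ᵥ v)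
  /-- the maximal absolute column sum of `var (u_m)` is at most `C` -/
  colSum_le : ∀ i m (t : Fin (p m)), ∑ s, |D.covU P i ⟨m, s⟩ ⟨m, t⟩| ≤ C
  var_mul_ge : ∀ i m (s t : Fin (p m)), c ≤ Var[fun ω => D.u i ω ⟨m, s⟩ * D.u i ω ⟨m, t⟩; P]

end Model

/-- The Lasso objective `(2n)⁻¹ ∑ (y_i - x_i' b)² + lam ‖b‖₁`. -/
noncomputable def lassoObjective {n : ℕ} {ι : Type*} [Fintype ι] (x : Fin n → ι → ℝ)
    (y : Fin n → ℝ) (lam : ℝ) (b : ι → ℝ) : ℝ :=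
  (2 * (n : ℝ))⁻¹ * ∑ i, (y i - x i ⬝ᵥ b) ^ 2 + lam * ∑ j, |b j|

/-- `b` is a Lasso estimate: a global minimizer of the Lasso objective. -/
def IsLasso {n : ℕ} {ι : Type*} [Fintype ι] (x : Fin n → ι → ℝ)
    (y : Fin n → ℝ) (lam : ℝ) (b : ι → ℝ) : Prop :=
  ∀ b' : ι → ℝ, lassoObjective x y lam b ≤ lassoObjective x y lam b'

/-- The residual variance `n⁻¹ ∑ (y_i - x_i' b)²`. -/
noncomputable def residualVariance {n : ℕ} {ι : Type*} [Fintype ι] (x : Fin n → ι → ℝ)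
    (y : Fin n → ℝ) (b : ι → ℝ) : ℝ :=
  (n : ℝ)⁻¹ * ∑ i, (y i - x i ⬝ᵥ b) ^ 2

end FactorRegression

/-!
The residual variance minus the average squared error is a multiple of the prediction error of the
Lasso plus its correlation with the errors. By the basic inequality of the Lasso both are at most a
constant times `s (Λ + lam) ^ 2 / κ`, where `Λ` bounds the maximal correlation of the covariates with
the errors, and `κ` is a restricted eigenvalue constant at sparsity `s`
(`FactorRegression.abs_residualVariance_sub_le`). The average squared error is consistent by
Chebyshev's inequality. Two points need work.

*Restricted eigenvalues* (`FactorRegression.exists_restricted_eigenvalue`). In a direction `v` the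
covariates are `F' a + U' v`, where the loadings `a = Λ' v` may have length of order `√s`, so that
the covariates are not uniformly sub-Gaussian, while the joint covariance matrix of the factors may
be singular. The seminorm `v ↦ (n⁻¹ ∑ (U_i' v) ^ 2) ^ (1 / 2)` is bounded on sparse vectors by a
union bound over lattice points, and on the cone by cutting a vector into blocks of decreasing
entries. If the empirical length of `F a` is large, it dominates that of `U v`. Otherwise the second
moment of `F' a` is bounded, because empirical and population second moments of the factors agree up
to `E (F' a) ^ 2 / 2 + 1` for all `a` in question: this follows from Chebyshev's inequality in a
basis that whitens the covariance matrix of the factors plus `1 / s`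
(`FactorRegression.DesignCondition.measure_not_forall_second_moment_le`). For such `a` the variable
`F' a + U' v` is not concentrated near zero, since its covariance with `U' v` is `E (U' v) ^ 2`
(`FactorRegression.exists_truncation`); Chernoff's bound for a truncation of its square and a union
bound over a lattice of pairs `(a, v)` give the lower bound, with exponentially small exceptional
probabilities as soon as `s log p / n` is small.

*The noise level.* Bernstein's inequality, or the Cauchy–Schwarz inequality if `log p > n`, bounds
the maximal correlation by half the penalty with probability `1 - O(1 / p + 1 / n)`. This is
useless if `p` stays bounded. Therefore the candidate set for the error is the support of the
coefficients only when `p > n ^ (1 / 4)`. For smaller `p` it consists of all the coordinates: then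
no cone condition is needed, Chebyshev's inequality bounds the correlations by `n ^ (-1 / 4)`, and
the resulting error still tends to zero (`FactorRegression.Model.exists_candidate_set`).
-/

namespace FactorRegression

/-! ### Square-exponential moments of sub-Gaussian variables -/

section Moments

/-- `X` has a square-exponential moment at rate `q`: `E exp (q X ^ 2) ≤ 2`. Up to constants this
is sub-Gaussianity of `X`, but it does not need centring. -/
structure ExpSqMoment {Ω : Type*} [MeasurableSpace Ω] (X : Ω → ℝ) (q : ℝ) (P : Measure Ω) :
    Prop where
  aesm : AEStronglyMeasurable X P
  integrable : Integrable (fun ω => Real.exp (q * X ω ^ 2)) P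
  le_two : ∫ ω, Real.exp (q * X ω ^ 2) ∂P ≤ 2

lemma lintegral_exp_mul_sq_gaussianReal_le {b : ℝ} (hb : b ≤ 1 / 4) :
    ∫⁻ g, ENNReal.ofReal (Real.exp (b * g ^ 2)) ∂(gaussianReal 0 1) ≤ 2 := by
  have h1 : ∀ g : ℝ, ENNReal.ofReal (Real.exp (b * g ^ 2))
      ≤ ENNReal.ofReal (Real.exp (4⁻¹ * g ^ 2)) := fun g => by
    apply ENNReal.ofReal_le_ofReal
    apply Real.exp_le_exp.2
    nlinarith [sq_nonneg g]
  refine (lintegral_mono h1).trans ?_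
  rw [gaussianReal_of_var_ne_zero _ one_ne_zero,
    lintegral_withDensity_eq_lintegral_mul _ (measurable_gaussianPDF 0 1) (by fun_prop)]
  have h2 : ∀ g : ℝ, (gaussianPDF 0 1 * fun g => ENNReal.ofReal (Real.exp (4⁻¹ * g ^ 2))) g
      = ENNReal.ofReal ((√(2 * Real.pi))⁻¹ * Real.exp (-(1 / 4) * g ^ 2)) := fun g => by
    simp only [Pi.mul_apply, gaussianPDF, gaussianPDFReal, sub_zero, NNReal.coe_one, mul_one]
    rw [← ENNReal.ofReal_mul (by positivity), mul_assoc, ← Real.exp_add]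
    congr 3
    ring
  simp_rw [h2]
  rw [← ofReal_integral_eq_lintegral_ofReal
    ((integrable_exp_neg_mul_sq (by norm_num : (0 : ℝ) < 1 / 4)).const_mul _)
    (ae_of_all _ fun _ => by positivity), integral_const_mul, integral_gaussian]
  have h3 : (√(2 * Real.pi))⁻¹ * √(Real.pi / (1 / 4)) ≤ 2 := by
    rw [← Real.sqrt_inv, ← Real.sqrt_mul (by positivity)]
    rw [Real.sqrt_le_left (by norm_num)]
    have := Real.pi_pos
    field_simp
    norm_num
  calc _ ≤ ENNReal.ofReal 2 := ENNReal.ofReal_le_ofReal h3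
    _ = 2 := by simp

variable {Ω : Type*} [MeasurableSpace Ω] {P : Measure Ω}

/-- Gaussian mixing: `exp (q X ^ 2)` is the average of `exp (√(2 q) g X)` over a standard normal
`g`, so that integrating over `X` first reduces the claim to a Gaussian integral. -/
lemma HasSubgaussianMGF.expSqMoment [IsProbabilityMeasure P] {X : Ω → ℝ} {v : ℝ≥0} {q : ℝ}
    (h : HasSubgaussianMGF X v P) (hq : 0 ≤ q) (hqv : 4 * q * v ≤ 1) : ExpSqMoment X q P := by
  have hX := h.aestronglyMeasurable
  have key : ∫⁻ ω, ENNReal.ofReal (Real.exp (q * X ω ^ 2)) ∂P ≤ 2 := by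
    have h1 : ∀ ω, ENNReal.ofReal (Real.exp (q * X ω ^ 2))
        = ∫⁻ g, ENNReal.ofReal (Real.exp (√(2 * q) * X ω * g)) ∂(gaussianReal 0 1) := fun ω => by
      rw [← ofReal_integral_eq_lintegral_ofReal (integrable_exp_mul_gaussianReal _)
        (ae_of_all _ fun _ => by positivity)]
      have := congrFun (mgf_id_gaussianReal (μ := 0) (v := 1)) (√(2 * q) * X ω)
      simp only [mgf, id] at this
      rw [this]
      congr 2
      rw [mul_pow, Real.sq_sqrt (by positivity)]
      simp
      ring
    simp_rw [h1]
    rw [lintegral_lintegral_swap]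
    · refine le_trans (lintegral_mono fun g => ?_) (lintegral_exp_mul_sq_gaussianReal_le
        (b := q * v) (by linarith))
      rw [← ofReal_integral_eq_lintegral_ofReal _ (ae_of_all _ fun _ => by positivity)]
      · apply ENNReal.ofReal_le_ofReal
        have := h.mgf_le (√(2 * q) * g)
        simp only [mgf] at this
        simp_rw [show ∀ ω, √(2 * q) * X ω * g = √(2 * q) * g * X ω from fun ω => by ring]
        refine this.trans_eq ?_
        rw [mul_pow, Real.sq_sqrt (by positivity)]
        congr 1
        ring
      · have := h.integrable_exp_mul (√(2 * q) * g)
        convert this using 3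
        ring
    · have h2 : AEMeasurable (fun z : Ω × ℝ => X z.1) (P.prod (gaussianReal 0 1)) :=
        hX.aemeasurable.comp_quasiMeasurePreserving Measure.quasiMeasurePreserving_fst
      simp only [Function.uncurry_def]
      fun_prop
  have hint : Integrable (fun ω => Real.exp (q * X ω ^ 2)) P := by
    refine ⟨by fun_prop, ?_⟩
    rw [hasFiniteIntegral_iff_ofReal (ae_of_all _ fun _ => by positivity)]
    exact key.trans_lt (by simp)
  refine ⟨hX, hint, ?_⟩
  rw [integral_eq_lintegral_of_nonneg_ae (ae_of_all _ fun _ => by positivity) hint.1]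
  exact ENNReal.toReal_le_of_le_ofReal (by norm_num) (by simpa using key)

lemma HasSubgaussianMGF.mono {X : Ω → ℝ} {v w : ℝ≥0}
    (h : HasSubgaussianMGF X v P) (hvw : v ≤ w) : HasSubgaussianMGF X w P := by
  refine ⟨h.integrable_exp_mul, fun t => (h.mgf_le t).trans (Real.exp_le_exp.2 ?_)⟩
  have : (v : ℝ) ≤ w := by exact_mod_cast hvw
  gcongr

/-- Sums of dependent sub-Gaussian variables. -/
lemma HasSubgaussianMGF.sum_of_dependent [IsProbabilityMeasure P] {ι : Type*} (s : Finset ι)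
    {X : ι → Ω → ℝ} {v : ι → ℝ≥0} (h : ∀ i, HasSubgaussianMGF (X i) (v i) P) :
    HasSubgaussianMGF (fun ω => ∑ i ∈ s, X i ω) (s.card * ∑ i ∈ s, v i) P := by
  have h1 : HasSubgaussianMGF (fun ω => ∑ i ∈ s, X i ω) ((∑ i ∈ s, (v i).sqrt) ^ 2) P := by
    classical
    induction s using Finset.induction_on with
    | empty => simp
    | insert i s his ih =>
      simp only [Finset.sum_insert his]
      have := (h i).add ih
      rwa [NNReal.sqrt_sq] at this
  refine HasSubgaussianMGF.mono h1 ?_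
  have := sq_sum_le_card_mul_sum_sq (s := s) (f := fun i => ((v i).sqrt : ℝ))
  rw [← NNReal.coe_le_coe]
  push_cast
  simpa using this

namespace ExpSqMoment

variable {X Y : Ω → ℝ} {q : ℝ}

lemma integrable_pow_four (h : ExpSqMoment X q P) (hq : 0 < q) :
    Integrable (fun ω => X ω ^ 4) P := by
  refine (h.integrable.const_mul (2 / q ^ 2)).mono' (by have := h.aesm; fun_prop)
    (ae_of_all _ fun ω => ?_)
  rw [Real.norm_of_nonneg (by positivity)]
  have := Real.quadratic_le_exp_of_nonneg (x := q * X ω ^ 2) (by positivity)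
  have h2 : 0 ≤ q * X ω ^ 2 := by positivity
  rw [div_mul_eq_mul_div, le_div_iff₀ (by positivity)]
  linear_combination 2 * this + 2 * h2

lemma integrable_sq (h : ExpSqMoment X q P) (hq : 0 < q) :
    Integrable (fun ω => X ω ^ 2) P := by
  refine (h.integrable.const_mul (1 / q)).mono' (by have := h.aesm; fun_prop)
    (ae_of_all _ fun ω => ?_)
  rw [Real.norm_of_nonneg (by positivity)]
  have := Real.add_one_le_exp (q * X ω ^ 2)
  rw [div_mul_eq_mul_div, le_div_iff₀ (by positivity)]
  linarith

lemma memLp_two (h : ExpSqMoment X q P) (hq : 0 < q) : MemLp X 2 P :=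
  (memLp_two_iff_integrable_sq h.aesm).2 (h.integrable_sq hq)

lemma integral_sq_le (h : ExpSqMoment X q P) (hq : 0 < q) :
    ∫ ω, X ω ^ 2 ∂P ≤ 2 / q := by
  rw [le_div_iff₀ hq, mul_comm, ← integral_const_mul]
  refine (integral_mono ((h.integrable_sq hq).const_mul q) h.integrable fun ω => ?_).trans h.le_two
  have := Real.add_one_le_exp (q * X ω ^ 2)
  simp only
  linarith

lemma integral_pow_four_le (h : ExpSqMoment X q P) (hq : 0 < q) :
    ∫ ω, X ω ^ 4 ∂P ≤ 4 / q ^ 2 := by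
  rw [le_div_iff₀ (by positivity), mul_comm, ← integral_const_mul]
  refine (integral_mono ((h.integrable_pow_four hq).const_mul _) (h.integrable.const_mul 2)
    fun ω => ?_).trans (by rw [integral_const_mul]; linarith [h.le_two])
  have := Real.quadratic_le_exp_of_nonneg (x := q * X ω ^ 2) (by positivity)
  simp only
  nlinarith [mul_nonneg hq.le (sq_nonneg (X ω))]

/-- A fourth moment is controlled by the second moment up to a logarithmic factor. With
`T ≍ log s` this makes a variance of order `1 / s` cost only a factor `log s`. -/
lemma integral_pow_four_le_mul (h : ExpSqMoment X q P) (hq : 0 < q)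
    {T : ℝ} (hT : 0 ≤ T) :
    ∫ ω, X ω ^ 4 ∂P ≤ T * ∫ ω, X ω ^ 2 ∂P + 16 / q ^ 2 * Real.exp (-(q * T / 2)) := by
  have hpt : ∀ ω, X ω ^ 4 ≤ T * X ω ^ 2
      + 8 / q ^ 2 * Real.exp (-(q * T / 2)) * Real.exp (q * X ω ^ 2) := fun ω => by
    rcases le_total (X ω ^ 2) T with h1 | h1
    · have : X ω ^ 4 ≤ T * X ω ^ 2 := by nlinarith [sq_nonneg (X ω)]
      have : 0 ≤ 8 / q ^ 2 * Real.exp (-(q * T / 2)) * Real.exp (q * X ω ^ 2) := by positivity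
      linarith
    · have h2 := Real.quadratic_le_exp_of_nonneg (x := q / 2 * X ω ^ 2) (by positivity)
      have h3 : Real.exp (q / 2 * X ω ^ 2)
          ≤ Real.exp (-(q * T / 2)) * Real.exp (q * X ω ^ 2) := by
        rw [← Real.exp_add]
        apply Real.exp_le_exp.2
        nlinarith
      have h4 : X ω ^ 4 ≤ 8 / q ^ 2 * Real.exp (q / 2 * X ω ^ 2) := by
        rw [div_mul_eq_mul_div, le_div_iff₀ (by positivity)]
        nlinarith [mul_nonneg hq.le (sq_nonneg (X ω))]
      have h5 : 8 / q ^ 2 * Real.exp (q / 2 * X ω ^ 2)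
          ≤ 8 / q ^ 2 * (Real.exp (-(q * T / 2)) * Real.exp (q * X ω ^ 2)) := by gcongr
      have : 0 ≤ T * X ω ^ 2 := by positivity
      linarith
  refine (integral_mono (h.integrable_pow_four hq)
    (((h.integrable_sq hq).const_mul T).add (h.integrable.const_mul _)) hpt).trans ?_
  simp only [Pi.add_apply]
  rw [integral_add ((h.integrable_sq hq).const_mul T) (h.integrable.const_mul _),
    integral_const_mul, integral_const_mul]
  have h6 : 8 / q ^ 2 * Real.exp (-(q * T / 2)) * ∫ ω, Real.exp (q * X ω ^ 2) ∂P
      ≤ 8 / q ^ 2 * Real.exp (-(q * T / 2)) * 2 := by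
    gcongr
    exact h.le_two
  have h7 : 8 / q ^ 2 * Real.exp (-(q * T / 2)) * 2 = 16 / q ^ 2 * Real.exp (-(q * T / 2)) := by
    ring
  linarith

lemma integrable_mul (hX : ExpSqMoment X q P) (hY : ExpSqMoment Y q P) (hq : 0 < q) :
    Integrable (fun ω => X ω * Y ω) P :=
  (hX.memLp_two hq).integrable_mul (hY.memLp_two hq)

lemma integrable_mul_sq (hX : ExpSqMoment X q P) (hY : ExpSqMoment Y q P) (hq : 0 < q) :
    Integrable (fun ω => (X ω * Y ω) ^ 2) P := by
  refine ((hX.integrable_pow_four hq).add (hY.integrable_pow_four hq)).mono'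
    (by have := hX.aesm; have := hY.aesm; fun_prop) (ae_of_all _ fun ω => ?_)
  rw [Real.norm_of_nonneg (by positivity)]
  simp only [Pi.add_apply]
  nlinarith [sq_nonneg (X ω ^ 2 - Y ω ^ 2), sq_nonneg (X ω ^ 2), sq_nonneg (Y ω ^ 2)]

end ExpSqMoment

lemma _root_.Real.exp_le_one_add_add_sq_mul_exp_abs (x : ℝ) :
    Real.exp x ≤ 1 + x + x ^ 2 * Real.exp |x| := by
  have h1 : Real.exp x - 1 ≤ x * Real.exp x := by
    have h2 := Real.add_one_le_exp (-x)
    have h3 : Real.exp (-x) * Real.exp x = 1 := by rw [← Real.exp_add]; simp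
    nlinarith [Real.exp_pos x]
  rcases le_total 0 x with hx | hx
  · rw [abs_of_nonneg hx]
    nlinarith
  · have h4 := Real.add_one_le_exp x
    have h5 : 1 ≤ Real.exp |x| := Real.one_le_exp (abs_nonneg x)
    nlinarith [sq_nonneg x]

/-- Products of variables with square-exponential moments are sub-exponential: a centred product
has a sub-Gaussian moment generating function for `t` in a fixed neighbourhood of `0`. -/
lemma ExpSqMoment.exp_mul_mul_le {X Y : Ω → ℝ} {q : ℝ} (hX : ExpSqMoment X q P)
    (hY : ExpSqMoment Y q P) (hq : 0 < q)
    [IsProbabilityMeasure P] (h0 : ∫ ω, X ω * Y ω ∂P = 0) {t : ℝ} (ht : |t| ≤ q / 2) :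
    Integrable (fun ω => Real.exp (t * (X ω * Y ω))) P ∧
      ∫ ω, Real.exp (t * (X ω * Y ω)) ∂P ≤ Real.exp (16 * t ^ 2 / q ^ 2) := by
  have hpt : ∀ ω, Real.exp (t * (X ω * Y ω)) ≤ 1 + t * (X ω * Y ω)
      + 4 * t ^ 2 / q ^ 2 * (Real.exp (q * X ω ^ 2) + Real.exp (q * Y ω ^ 2)) := fun ω => by
    set w := X ω * Y ω
    have h1 := Real.exp_le_one_add_add_sq_mul_exp_abs (t * w)
    have h2 : w ^ 2 ≤ 8 / q ^ 2 * Real.exp (q / 2 * |w|) := by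
      have := Real.quadratic_le_exp_of_nonneg (x := q / 2 * |w|) (by positivity)
      have h3 : 0 ≤ q / 2 * |w| := by positivity
      rw [div_mul_eq_mul_div, le_div_iff₀ (by positivity), ← sq_abs w]
      linear_combination 8 * this + 8 * h3
    have h3 : Real.exp |t * w| ≤ Real.exp (q / 2 * |w|) := by
      rw [abs_mul]
      gcongr
    have h4 : Real.exp (q / 2 * |w|) * Real.exp (q / 2 * |w|)
        ≤ (Real.exp (q * X ω ^ 2) + Real.exp (q * Y ω ^ 2)) / 2 := by
      have h5 : Real.exp (q / 2 * |w|) * Real.exp (q / 2 * |w|)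
          ≤ Real.exp (q / 2 * X ω ^ 2) * Real.exp (q / 2 * Y ω ^ 2) := by
        rw [← Real.exp_add, ← Real.exp_add]
        apply Real.exp_le_exp.2
        have : |w| ≤ (X ω ^ 2 + Y ω ^ 2) / 2 := by
          rw [abs_le]; constructor <;> nlinarith [sq_nonneg (X ω + Y ω), sq_nonneg (X ω - Y ω)]
        nlinarith
      have h6 : ∀ z : ℝ, Real.exp (q * z ^ 2) = Real.exp (q / 2 * z ^ 2) ^ 2 := fun z => by
        rw [← Real.exp_nat_mul]; congr 1; push_cast; ring
      rw [h6, h6]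
      nlinarith [sq_nonneg (Real.exp (q / 2 * X ω ^ 2) - Real.exp (q / 2 * Y ω ^ 2))]
    have h7 : (t * w) ^ 2 * Real.exp |t * w|
        ≤ t ^ 2 * (8 / q ^ 2 * Real.exp (q / 2 * |w|)) * Real.exp (q / 2 * |w|) := by
      rw [mul_pow]
      gcongr
    have h8 : t ^ 2 * (8 / q ^ 2 * Real.exp (q / 2 * |w|)) * Real.exp (q / 2 * |w|)
        ≤ t ^ 2 * (8 / q ^ 2) * ((Real.exp (q * X ω ^ 2) + Real.exp (q * Y ω ^ 2)) / 2) := by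
      calc _ = t ^ 2 * (8 / q ^ 2) * (Real.exp (q / 2 * |w|) * Real.exp (q / 2 * |w|)) := by ring
        _ ≤ _ := by gcongr
    calc _ ≤ _ := h1
      _ ≤ 1 + t * w + t ^ 2 * (8 / q ^ 2) *
          ((Real.exp (q * X ω ^ 2) + Real.exp (q * Y ω ^ 2)) / 2) := by linarith
      _ = _ := by ring
  have i0 : Integrable (fun _ : Ω => (1 : ℝ)) P := integrable_const 1
  have i1 : Integrable (fun ω => t * (X ω * Y ω)) P := (hX.integrable_mul hY hq).const_mul t
  have i01 : Integrable (fun ω => 1 + t * (X ω * Y ω)) P := i0.add i1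
  have i2 : Integrable (fun ω => 4 * t ^ 2 / q ^ 2 *
      (Real.exp (q * X ω ^ 2) + Real.exp (q * Y ω ^ 2))) P :=
    (hX.integrable.add hY.integrable).const_mul (4 * t ^ 2 / q ^ 2)
  have i3 : Integrable (fun ω => 1 + t * (X ω * Y ω)
      + 4 * t ^ 2 / q ^ 2 * (Real.exp (q * X ω ^ 2) + Real.exp (q * Y ω ^ 2))) P :=
    i01.add i2
  have i4 : Integrable (fun ω => Real.exp (t * (X ω * Y ω))) P :=
    i3.mono' (by have := hX.aesm; have := hY.aesm; fun_prop) (ae_of_all _ fun ω => by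
      rw [Real.norm_of_nonneg (by positivity)]; exact hpt ω)
  refine ⟨i4, (integral_mono i4 i3 hpt).trans ?_⟩
  have e : ∫ ω, (1 + t * (X ω * Y ω)
      + 4 * t ^ 2 / q ^ 2 * (Real.exp (q * X ω ^ 2) + Real.exp (q * Y ω ^ 2))) ∂P
      = 1 + 4 * t ^ 2 / q ^ 2 *
        (∫ ω, Real.exp (q * X ω ^ 2) ∂P + ∫ ω, Real.exp (q * Y ω ^ 2) ∂P) := by
    rw [integral_add i01 i2, integral_add i0 i1,
      integral_const_mul, integral_const_mul, h0, integral_add hX.integrable hY.integrable]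
    simp
  rw [e]
  have h9 := Real.add_one_le_exp (16 * t ^ 2 / q ^ 2)
  have h10 : 4 * t ^ 2 / q ^ 2 *
      (∫ ω, Real.exp (q * X ω ^ 2) ∂P + ∫ ω, Real.exp (q * Y ω ^ 2) ∂P)
      ≤ 4 * t ^ 2 / q ^ 2 * (2 + 2) := by
    gcongr
    exacts [hX.le_two, hY.le_two]
  have h11 : 4 * t ^ 2 / q ^ 2 * (2 + 2) = 16 * t ^ 2 / q ^ 2 := by ring
  linarith

/-! ### Tail bounds for averages of independent variables -/

/-- Chernoff's bound for independent, not necessarily identically distributed, summands. -/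
lemma measure_le_sum_le_of_integral_exp_le {n : ℕ} {W : Fin n → Ω → ℝ} [IsProbabilityMeasure P]
    (hind : iIndepFun W P) (hm : ∀ i, Measurable (W i)) {a : ℝ}
    (hint : ∀ i, Integrable (fun ω => Real.exp (W i ω)) P)
    (hle : ∀ i, ∫ ω, Real.exp (W i ω) ∂P ≤ Real.exp a) (r : ℝ) :
    P {ω | n * r ≤ ∑ i, W i ω} ≤ ENNReal.ofReal (Real.exp (n * (a - r))) := by
  have hint' : Integrable (fun ω => Real.exp (1 * (∑ i, W i) ω)) P := by
    have := hind.integrable_exp_mul_sum (t := 1) hm (s := Finset.univ)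
      (fun i _ => by simpa using hint i)
    simpa using this
  have h1 := measure_ge_le_exp_mul_mgf (μ := P) (X := ∑ i, W i) (t := 1) (n * r) zero_le_one hint'
  rw [hind.mgf_sum hm] at h1
  have h2 : ∏ i, mgf (W i) P 1 ≤ Real.exp (n * a) := by
    calc ∏ i, mgf (W i) P 1 ≤ ∏ _i : Fin n, Real.exp a :=
          Finset.prod_le_prod (fun _ _ => mgf_nonneg) fun i _ => by simpa [mgf] using hle i
      _ = Real.exp (n * a) := by rw [Finset.prod_const, ← Real.exp_nat_mul]; simp
  have h3 : P.real {ω | n * r ≤ ∑ i, W i ω} ≤ Real.exp (n * (a - r)) := by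
    have : {ω | n * r ≤ ∑ i, W i ω} = {ω | n * r ≤ (∑ i, W i) ω} := by simp
    rw [this]
    refine h1.trans ?_
    calc _ ≤ Real.exp (-1 * (n * r)) * Real.exp (n * a) := by gcongr
      _ = _ := by rw [← Real.exp_add]; congr 1; ring
  rw [← ofReal_measureReal]
  exact ENNReal.ofReal_le_ofReal h3

/-- Chebyshev's inequality for the average of independent centred variables. -/
lemma measure_le_abs_average_le {n : ℕ} {W : Fin n → Ω → ℝ} [IsProbabilityMeasure P]
    (hind : iIndepFun W P) (hm : ∀ i, MemLp (W i) 2 P) {V : ℝ} (h0 : ∀ i, ∫ ω, W i ω ∂P = 0)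
    (hle : ∀ i, ∫ ω, W i ω ^ 2 ∂P ≤ V) {η : ℝ} (hη : 0 < η) :
    P {ω | η ≤ |(n : ℝ)⁻¹ * ∑ i, W i ω|} ≤ ENNReal.ofReal (V / (n * η ^ 2)) := by
  rcases Nat.eq_zero_or_pos n with rfl | hn
  · simp [hη.not_ge]
  have hn' : (0 : ℝ) < n := by exact_mod_cast hn
  have hS : MemLp (∑ i, W i) 2 P := memLp_finsetSum' _ fun i _ => hm i
  have h1 := meas_ge_le_variance_div_sq hS (c := n * η) (by positivity)
  have h2 : ∫ ω, (∑ i, W i) ω ∂P = 0 := by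
    simp only [Finset.sum_apply]
    rw [integral_finsetSum _ fun i _ => (hm i).integrable (by norm_num)]
    simp [h0]
  rw [h2] at h1
  have h3 : Var[∑ i, W i; P] ≤ n * V := by
    rw [IndepFun.variance_sum (fun i _ => hm i) fun i _ j _ hij => hind.indepFun hij]
    calc ∑ i, Var[W i; P] ≤ ∑ _i : Fin n, V := Finset.sum_le_sum fun i _ =>
          (variance_le_expectation_sq (hm i).1).trans (hle i)
      _ = _ := by simp
  refine (measure_mono fun ω hω => ?_).trans (h1.trans (ENNReal.ofReal_le_ofReal ?_))
  · simp only [Set.mem_ofPred_eq, sub_zero, Finset.sum_apply] at hω ⊢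
    rw [abs_mul, abs_of_pos (inv_pos.2 hn'), ← div_eq_inv_mul, le_div_iff₀ hn'] at hω
    linarith
  · calc _ ≤ n * V / (n * η) ^ 2 := by gcongr
      _ = _ := by field_simp

end Moments

/-! ### Norms, sparse vectors and discretization -/

section Deterministic

variable {ι : Type*} [Fintype ι]

/-- The Euclidean norm of a family of real numbers (the norm that `ι → ℝ` carries in Mathlib is
the supremum norm). -/
noncomputable def l2 (v : ι → ℝ) : ℝ := √(∑ j, v j ^ 2)

/-- The `ℓ¹` norm of a family of real numbers. -/
noncomputable def l1 (v : ι → ℝ) : ℝ := ∑ j, |v j|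

lemma l2_eq_norm (v : ι → ℝ) : l2 v = ‖WithLp.toLp 2 v‖ := by
  simp [l2, EuclideanSpace.norm_eq]

lemma l2_nonneg (v : ι → ℝ) : 0 ≤ l2 v := Real.sqrt_nonneg _

lemma l1_nonneg (v : ι → ℝ) : 0 ≤ l1 v := Finset.sum_nonneg fun _ _ => abs_nonneg _

lemma l2_sq (v : ι → ℝ) : l2 v ^ 2 = ∑ j, v j ^ 2 :=
  Real.sq_sqrt (Finset.sum_nonneg fun _ _ => sq_nonneg _)

lemma l2_add_le (v w : ι → ℝ) : l2 (v + w) ≤ l2 v + l2 w := by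
  simp only [l2_eq_norm, WithLp.toLp_add]
  exact norm_add_le _ _

lemma l2_smul (r : ℝ) (v : ι → ℝ) : l2 (r • v) = |r| * l2 v := by
  simp only [l2_eq_norm, WithLp.toLp_smul, norm_smul, Real.norm_eq_abs]

lemma l2_le_iff {v : ι → ℝ} {b : ℝ} (hb : 0 ≤ b) : l2 v ≤ b ↔ ∑ j, v j ^ 2 ≤ b ^ 2 :=
  Real.sqrt_le_left hb

lemma l2_eq_zero {v : ι → ℝ} (h : l2 v = 0) : v = 0 := by
  rw [l2_eq_norm, norm_eq_zero] at h
  exact (WithLp.toLp_eq_zero 2).1 h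

lemma l2_single_le [DecidableEq ι] (j : ι) : l2 (Pi.single j (1 : ℝ) : ι → ℝ) ≤ 1 := by
  rw [l2_le_iff zero_le_one]
  simp [Pi.single_apply]

lemma l2_mono {v w : ι → ℝ} (h : ∀ j, |v j| ≤ |w j|) : l2 v ≤ l2 w :=
  Real.sqrt_le_sqrt (Finset.sum_le_sum fun j _ => sq_le_sq.2 (h j))

lemma l1_smul (r : ℝ) (v : ι → ℝ) : l1 (r • v) = |r| * l1 v := by
  simp [l1, abs_mul, Finset.mul_sum]

lemma abs_dotProduct_le {v w : ι → ℝ} {b : ℝ} (h : ∀ j, |v j| ≤ b) : |v ⬝ᵥ w| ≤ b * l1 w := by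
  rw [dotProduct, l1, Finset.mul_sum]
  refine (Finset.abs_sum_le_sum_abs _ _).trans (Finset.sum_le_sum fun j _ => ?_)
  rw [abs_mul]
  exact mul_le_mul_of_nonneg_right (h j) (abs_nonneg _)

lemma sum_abs_le_sqrt_card_mul_l2 (S : Finset ι) (v : ι → ℝ) :
    ∑ j ∈ S, |v j| ≤ √S.card * l2 v := by
  apply le_of_sq_le_sq _ (by have := l2_nonneg v; positivity)
  rw [mul_pow, Real.sq_sqrt (by positivity), l2_sq]
  refine (sq_sum_le_card_mul_sum_sq (s := S) (f := fun j => |v j|)).trans ?_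
  gcongr
  simp only [sq_abs]
  exact Finset.sum_le_sum_of_subset_of_nonneg (Finset.subset_univ _) fun _ _ _ => sq_nonneg _

lemma exists_card_eq_forall_le (f : ι → ℝ) {t : ℕ} (ht : t ≤ Fintype.card ι) :
    ∃ T : Finset ι, T.card = t ∧ ∀ i ∈ T, ∀ j ∉ T, f j ≤ f i := by
  classical
  induction t with
  | zero => exact ⟨∅, by simp⟩
  | succ t ih =>
    obtain ⟨T, hT, h⟩ := ih (by omega)
    have hne : (Finset.univ \ T).Nonempty := by
      rw [← Finset.card_pos, Finset.card_univ_sdiff]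
      omega
    obtain ⟨k, hk, hmax⟩ := Finset.exists_max_image _ f hne
    simp only [Finset.mem_sdiff, Finset.mem_univ, true_and] at hk hmax
    refine ⟨insert k T, by rw [Finset.card_insert_of_notMem hk, hT], fun i hi j hj => ?_⟩
    rw [Finset.mem_insert, not_or] at hj
    rcases Finset.mem_insert.1 hi with rfl | hi
    · exact hmax j hj.2
    · exact h i hi j hj.2

open Classical in
/-- One step of the decomposition of a vector into blocks of decreasing entries: the `t` largest
entries form a block, and the remaining ones are at most the average of that block. -/
lemma exists_block (v : ι → ℝ) {t : ℕ} (ht : 1 ≤ t)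
    (hcard : t < (Finset.univ.filter fun j => v j ≠ 0).card) :
    ∃ x y : ι → ℝ, v = x + y ∧ (Finset.univ.filter fun j => x j ≠ 0).card ≤ t ∧
      (Finset.univ.filter fun j => y j ≠ 0).card < (Finset.univ.filter fun j => v j ≠ 0).card ∧
      (∀ j, |x j| ≤ |v j|) ∧ l1 v = l1 x + l1 y ∧ ∀ j, |y j| ≤ l1 x / t := by
  obtain ⟨T, hT, hle⟩ := exists_card_eq_forall_le (fun j => |v j|)
    (hcard.le.trans (Finset.card_le_univ _))
  refine ⟨fun j => if j ∈ T then v j else 0, fun j => if j ∈ T then 0 else v j, ?_, ?_, ?_, ?_,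
    ?_, ?_⟩
  · ext j; by_cases h : j ∈ T <;> simp [h]
  · rw [← hT]
    exact Finset.card_le_card fun j hj => by
      by_contra h
      simp [h] at hj
  · obtain ⟨j, hj, hjT⟩ := Finset.exists_mem_notMem_of_card_lt_card (hT.trans_lt hcard)
    obtain ⟨i, hi⟩ := Finset.card_pos.1 (by omega : 0 < T.card)
    have hvi : v i ≠ 0 := by
      have := hle i hi j hjT
      have h2 := abs_pos.2 (Finset.mem_filter.1 hj).2
      exact abs_pos.1 (h2.trans_le this)
    refine Finset.card_lt_card ⟨fun k hk => ?_, fun hsub => ?_⟩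
    · simp only [Finset.mem_filter, Finset.mem_univ, true_and] at hk ⊢
      by_contra h
      simp [h] at hk
    · have := hsub (Finset.mem_filter.2 ⟨Finset.mem_univ i, hvi⟩)
      simp [hi] at this
  · intro j; by_cases h : j ∈ T <;> simp [h]
  · rw [l1, l1, l1, ← Finset.sum_add_distrib]
    refine Finset.sum_congr rfl fun j _ => ?_
    by_cases h : j ∈ T <;> simp [h]
  · intro j
    have hl : l1 (fun j => if j ∈ T then v j else 0) = ∑ i ∈ T, |v i| := by
      rw [l1, ← Finset.sum_filter_add_sum_filter_not Finset.univ (· ∈ T)]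
      rw [Finset.sum_congr rfl (g := fun i => |v i|) (by simp +contextual),
        Finset.sum_eq_zero (s := Finset.univ.filter (· ∉ T)) (by simp +contextual)]
      simp
    rw [hl]
    by_cases h : j ∈ T
    · simp only [h, if_true, abs_zero]
      positivity
    · simp only [h, if_false]
      rw [le_div_iff₀ (by positivity), mul_comm, ← hT, ← nsmul_eq_mul]
      exact Finset.card_nsmul_le_sum _ _ _ fun i hi => hle i hi j h

open Classical in
lemma l2_le_sqrt_mul {v : ι → ℝ} {t : ℕ} {b : ℝ} (hb0 : 0 ≤ b)
    (hcard : (Finset.univ.filter fun j => v j ≠ 0).card ≤ t) (hb : ∀ j, |v j| ≤ b) :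
    l2 v ≤ √t * b := by
  rw [l2_le_iff (by positivity), mul_pow, Real.sq_sqrt (by positivity)]
  have h1 : ∑ j, v j ^ 2 = ∑ j ∈ Finset.univ.filter fun j => v j ≠ 0, v j ^ 2 := by
    rw [Finset.sum_filter]
    refine Finset.sum_congr rfl fun j _ => ?_
    by_cases h : v j = 0 <;> simp [h]
  rw [h1]
  calc _ ≤ ∑ j ∈ Finset.univ.filter fun j => v j ≠ 0, b ^ 2 :=
        Finset.sum_le_sum fun j _ => by rw [← sq_abs]; gcongr; exact hb j
    _ = (Finset.univ.filter fun j => v j ≠ 0).card * b ^ 2 := by simp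
    _ ≤ _ := by gcongr

variable {N : Seminorm ℝ (ι → ℝ)} {A : ℝ} {t : ℕ}

open Classical in
/-- Induction over the blocks of decreasing entries: the Euclidean norm of a block is at most `√t`
times its largest entry, which the `ℓ¹` norm of the preceding block controls. -/
lemma seminorm_le_of_sparse_aux (hA : 0 ≤ A) (ht : 1 ≤ t)
    (h : ∀ v, (Finset.univ.filter fun j => v j ≠ 0).card ≤ t → N v ≤ A * l2 v) (k : ℕ) :
    ∀ (v : ι → ℝ) (b : ℝ), (Finset.univ.filter fun j => v j ≠ 0).card ≤ k → 0 ≤ b →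
      (∀ j, |v j| ≤ b) → N v ≤ A * (√t * b + l1 v / √t) := by
  have hst : 0 < √(t : ℝ) := Real.sqrt_pos.2 (by exact_mod_cast ht)
  induction k with
  | zero =>
    intro v b hk hb0 hb
    refine (h v (by omega)).trans ?_
    gcongr
    have := l2_le_sqrt_mul hb0 (t := t) (by omega) hb
    have := div_nonneg (l1_nonneg v) hst.le
    linarith
  | succ k ih =>
    intro v b hk hb0 hb
    rcases le_or_gt (Finset.univ.filter fun j => v j ≠ 0).card t with hc | hc
    · refine (h v hc).trans ?_
      gcongr
      have := l2_le_sqrt_mul hb0 hc hb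
      have := div_nonneg (l1_nonneg v) hst.le
      linarith
    · obtain ⟨x, y, hv, hx, hy, hxv, hl, hyb⟩ := exists_block v ht hc
      have h1 := h x hx
      have h2 := ih y (l1 x / t) (by omega) (div_nonneg (l1_nonneg x) (by positivity)) hyb
      have h3 : l2 x ≤ √t * b := l2_le_sqrt_mul hb0 hx fun j => (hxv j).trans (hb j)
      have h4 : √t * (l1 x / t) = l1 x / √t := by
        field_simp
        rw [Real.sq_sqrt (by positivity), mul_comm]
      rw [h4] at h2
      calc N v ≤ N x + N y := by conv_lhs => rw [hv]
                                 exact map_add_le_add N x y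
        _ ≤ A * (√t * b) + A * (l1 x / √t + l1 y / √t) := by
            refine add_le_add (h1.trans ?_) h2
            gcongr
        _ = _ := by rw [hl]; ring

open Classical in
/-- A bound of a seminorm by the Euclidean norm on `t`-sparse vectors extends to all vectors, at
the cost of a multiple of the `ℓ¹` norm. -/
lemma seminorm_le_of_sparse (hA : 0 ≤ A) (ht : 1 ≤ t)
    (h : ∀ v, (Finset.univ.filter fun j => v j ≠ 0).card ≤ t → N v ≤ A * l2 v) (v : ι → ℝ) :
    N v ≤ A * (l2 v + l1 v / √t) := by
  have hst : 0 < √(t : ℝ) := Real.sqrt_pos.2 (by exact_mod_cast ht)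
  rcases le_or_gt (Finset.univ.filter fun j => v j ≠ 0).card t with hc | hc
  · refine (h v hc).trans ?_
    gcongr
    have := div_nonneg (l1_nonneg v) hst.le
    linarith
  · obtain ⟨x, y, hv, hx, hy, hxv, hl, hyb⟩ := exists_block v ht hc
    have h1 := h x hx
    have h2 := seminorm_le_of_sparse_aux hA ht h _ y (l1 x / t) le_rfl
      (div_nonneg (l1_nonneg x) (by positivity)) hyb
    have h4 : √t * (l1 x / t) = l1 x / √t := by
      field_simp
      rw [Real.sq_sqrt (by positivity), mul_comm]
    rw [h4] at h2
    calc N v ≤ N x + N y := by conv_lhs => rw [hv]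
                               exact map_add_le_add N x y
      _ ≤ A * l2 v + A * (l1 x / √t + l1 y / √t) := by
          refine add_le_add (h1.trans ?_) h2
          gcongr
          exact l2_mono hxv
      _ = _ := by rw [hl]; ring

open Classical in
/-- The vectors with one coordinate `±g` and the others zero, together with `0`. -/
noncomputable def gridSteps (ι : Type*) [Fintype ι] (g : ℝ) : Finset (ι → ℝ) :=
  insert 0 (Finset.univ.image fun j : ι × Bool => Pi.single j.1 (if j.2 then g else -g))

open Classical in
/-- The points of the lattice `g ℤ^ι` that are reached from `0` by `m` steps, that is those with
`ℓ¹` norm at most `m g`. -/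
noncomputable def grid (ι : Type*) [Fintype ι] (g : ℝ) : ℕ → Finset (ι → ℝ)
  | 0 => {0}
  | m + 1 => (grid ι g m ×ˢ gridSteps ι g).image fun z => z.1 + z.2

lemma card_grid_le (g : ℝ) (m : ℕ) : (grid ι g m).card ≤ (2 * Fintype.card ι + 1) ^ m := by
  classical
  have h1 : (gridSteps ι g).card ≤ 2 * Fintype.card ι + 1 := by
    refine (Finset.card_insert_le _ _).trans (Nat.add_le_add_right ?_ 1)
    refine Finset.card_image_le.trans ?_
    simp [mul_comm]
  induction m with
  | zero => simp [grid]
  | succ m ih =>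
    rw [grid, pow_succ]
    refine Finset.card_image_le.trans ?_
    rw [Finset.card_product]
    exact Nat.mul_le_mul ih h1

/-- Rounding towards zero, one coordinate and one step at a time. The bound by `|v j|` keeps the
support and makes the rounding error in `ℓ²` of order `(g |v|₁) ^ (1 / 2)`. -/
lemma exists_mem_grid {g : ℝ} (hg : 0 < g) (m : ℕ) (v : ι → ℝ) (hv : l1 v ≤ m * g) :
    ∃ z ∈ grid ι g m, ∀ j, |v j - z j| ≤ g ∧ |v j - z j| ≤ |v j| := by
  classical
  induction m generalizing v with
  | zero =>
    refine ⟨0, by simp [grid], fun j => ?_⟩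
    have : |v j| ≤ l1 v := Finset.single_le_sum (f := fun j => |v j|) (fun _ _ => abs_nonneg _)
      (Finset.mem_univ j)
    simp only [CharP.cast_eq_zero, zero_mul] at hv
    simp only [Pi.zero_apply, sub_zero, le_refl, and_true]
    linarith
  | succ m ih =>
    by_cases hall : ∀ j, |v j| ≤ g
    · have h0 : ∀ m, (0 : ι → ℝ) ∈ grid ι g m := fun m => by
        induction m with
        | zero => simp [grid]
        | succ m ih =>
          exact Finset.mem_image.2 ⟨(0, 0), by simp [ih, gridSteps], by simp⟩
      exact ⟨0, h0 _, fun j => by simp [hall j]⟩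
    · push Not at hall
      obtain ⟨k, hk⟩ := hall
      set e : ℝ := if 0 ≤ v k then g else -g with he
      have hke : |v k - e| = |v k| - g := by
        rw [he]
        split_ifs with h
        · rw [abs_of_nonneg h] at hk ⊢
          rw [abs_of_nonneg (by linarith)]
        · rw [abs_of_neg (not_le.1 h)] at hk ⊢
          rw [abs_of_neg (by linarith)]
          ring
      have hl : l1 (v - Pi.single k e) = l1 v - g := by
        rw [l1, l1, ← Finset.add_sum_erase _ _ (Finset.mem_univ k),
          ← Finset.add_sum_erase _ (fun j => |v j|) (Finset.mem_univ k)]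
        rw [Finset.sum_congr rfl (g := fun j => |v j|) fun j hj => by
          simp [Pi.single_eq_of_ne (Finset.ne_of_mem_erase hj)]]
        simp only [Pi.sub_apply, Pi.single_eq_same, hke]
        ring
      obtain ⟨z, hz, hz2⟩ := ih (v - Pi.single k e) (by
        rw [hl]; push_cast at hv; linarith)
      refine ⟨z + Pi.single k e, Finset.mem_image.2 ⟨(z, Pi.single k e), ?_, rfl⟩, fun j => ?_⟩
      · rw [Finset.mem_product]
        refine ⟨hz, Finset.mem_insert_of_mem (Finset.mem_image.2
          ⟨(k, decide (0 ≤ v k)), Finset.mem_univ _, ?_⟩)⟩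
        simp [he]
      · have h1 : v j - (z + Pi.single k e : ι → ℝ) j
            = (v - Pi.single k e : ι → ℝ) j - z j := by
          simp only [Pi.add_apply, Pi.sub_apply]; ring
        rw [h1]
        refine ⟨(hz2 j).1, (hz2 j).2.trans ?_⟩
        by_cases hj : j = k
        · subst hj
          simp only [Pi.sub_apply, Pi.single_eq_same, hke]
          linarith
        · simp [Pi.single_eq_of_ne hj]

lemma seminorm_le_const_mul_l2 (N : Seminorm ℝ (ι → ℝ)) :
    ∃ c, 0 ≤ c ∧ ∀ v, N v ≤ c * l2 v := by
  classical
  refine ⟨∑ j, N (Pi.single j 1), Finset.sum_nonneg fun _ _ => apply_nonneg _ _, fun v => ?_⟩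
  have h1 : v = ∑ j, v j • Pi.single j (1 : ℝ) := by
    ext i; simp [Finset.sum_apply, Pi.single_apply]
  calc N v = N (∑ j, v j • Pi.single j (1 : ℝ)) := by rw [← h1]
    _ ≤ ∑ j, N (v j • Pi.single j (1 : ℝ)) :=
        Finset.le_sum_of_subadditive N (map_zero N).le (map_add_le_add N) _ _
    _ ≤ ∑ j, N (Pi.single j 1) * l2 v := Finset.sum_le_sum fun j _ => by
        rw [map_smul_eq_mul, mul_comm, Real.norm_eq_abs]
        gcongr
        apply Real.abs_le_sqrt
        exact Finset.single_le_sum (f := fun j => v j ^ 2) (fun _ _ => sq_nonneg _)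
          (Finset.mem_univ j)
    _ = _ := by rw [Finset.sum_mul]

open Classical in
/-- Approximating a `t`-sparse unit vector by a lattice point leaves a `t`-sparse remainder of
norm at most `1 / 2`, so the best constant `c` satisfies `c ≤ 2 A + c / 2`. -/
lemma seminorm_le_of_grid_sparse (hA : 0 ≤ A) (ht : 1 ≤ t)
    (h : ∀ z ∈ grid ι (1 / (2 * √t)) (2 * t), N z ≤ A * l2 z) (v : ι → ℝ)
    (hv : (Finset.univ.filter fun j => v j ≠ 0).card ≤ t) : N v ≤ 4 * A * l2 v := by
  have hst : 0 < √(t : ℝ) := Real.sqrt_pos.2 (by exact_mod_cast ht)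
  have hstt : √(t : ℝ) * √t = t := Real.mul_self_sqrt (by positivity)
  have improve : ∀ c, 0 ≤ c →
      (∀ v, (Finset.univ.filter fun j => v j ≠ 0).card ≤ t → N v ≤ c * l2 v) →
      ∀ v, (Finset.univ.filter fun j => v j ≠ 0).card ≤ t → N v ≤ (2 * A + c / 2) * l2 v := by
    intro c hc hN
    have unit : ∀ v, (Finset.univ.filter fun j => v j ≠ 0).card ≤ t → l2 v = 1 →
        N v ≤ 2 * A + c / 2 := by
      intro v hv h1
      have hl1 : l1 v ≤ √t := by
        have h2 : l1 v = ∑ j ∈ Finset.univ.filter fun j => v j ≠ 0, |v j| := by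
          rw [l1, Finset.sum_filter]
          refine Finset.sum_congr rfl fun j _ => ?_
          by_cases h : v j = 0 <;> simp [h]
        rw [h2]
        refine (sum_abs_le_sqrt_card_mul_l2 _ v).trans ?_
        rw [h1, mul_one]
        gcongr
      obtain ⟨z, hz, hz2⟩ := exists_mem_grid (g := 1 / (2 * √t)) (by positivity) (2 * t) v (by
        refine hl1.trans (le_of_eq ?_)
        push_cast
        field_simp
        linarith)
      have h3 : l2 z ≤ 2 * l2 v := by
        have : l2 z ≤ l2 ((2 : ℝ) • v) := l2_mono fun j => by
          have h4 := (hz2 j).2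
          simp only [Pi.smul_apply, smul_eq_mul, abs_mul, abs_two]
          have := abs_sub_abs_le_abs_sub (z j) (v j)
          rw [abs_sub_comm] at this
          linarith
        rwa [l2_smul, abs_two] at this
      have h4 : (Finset.univ.filter fun j => (v - z) j ≠ 0).card ≤ t := by
        refine (Finset.card_le_card fun j hj => ?_).trans hv
        simp only [Finset.mem_filter, Finset.mem_univ, true_and] at hj ⊢
        intro h0
        have := (hz2 j).2
        rw [h0, abs_zero] at this
        apply hj
        simpa [h0] using this
      have h5 : l2 (v - z) ≤ 1 / 2 := by
        refine (l2_le_sqrt_mul (by positivity) h4 fun j => (hz2 j).1).trans (le_of_eq ?_)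
        field_simp
      calc N v = N (z + (v - z)) := by simp
        _ ≤ N z + N (v - z) := map_add_le_add N _ _
        _ ≤ A * (2 * l2 v) + c * (1 / 2) := by
            refine add_le_add ((h z hz).trans ?_) ((hN _ h4).trans ?_) <;> gcongr
        _ = _ := by rw [h1]; ring
    intro v hv
    rcases (l2_nonneg v).eq_or_lt with h0 | h0
    · have := l2_eq_zero h0.symm
      subst this
      simp only [map_zero]
      have := l2_nonneg (0 : ι → ℝ)
      positivity
    · have h1 := unit ((l2 v)⁻¹ • v) (by
        refine le_trans (le_of_eq ?_) hv
        congr 1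
        ext j
        simp [h0.ne']) (by rw [l2_smul, abs_of_pos (inv_pos.2 h0)]; field_simp)
      rw [map_smul_eq_mul, Real.norm_eq_abs, abs_of_pos (inv_pos.2 h0), inv_mul_le_iff₀ h0] at h1
      linarith
  -- The iteration starts from any finite bound, which exists since the space is finite-dimensional.
  obtain ⟨c, hc, hN⟩ := seminorm_le_const_mul_l2 N
  have iter : ∀ k : ℕ, ∀ v, (Finset.univ.filter fun j => v j ≠ 0).card ≤ t →
      N v ≤ (4 * A + c * (1 / 2) ^ k) * l2 v := by
    intro k
    induction k with
    | zero =>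
      intro v _
      refine (hN v).trans ?_
      have := l2_nonneg v
      gcongr
      simp
      linarith
    | succ k ih =>
      intro v hv
      have := improve _ (by positivity) ih v hv
      refine this.trans (le_of_eq ?_)
      rw [pow_succ]
      ring
  have lim : Tendsto (fun k : ℕ => (4 * A + c * (1 / 2 : ℝ) ^ k) * l2 v) atTop
      (𝓝 ((4 * A + c * 0) * l2 v)) :=
    (((tendsto_pow_atTop_nhds_zero_of_lt_one (by norm_num) (by norm_num)).const_mul c).const_add
      _).mul_const _
  have := ge_of_tendsto' lim fun k => iter k v hv
  simpa using this

/-- A bound on finitely many lattice points controls a seminorm everywhere. -/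
lemma seminorm_le_of_grid (hA : 0 ≤ A) (ht : 1 ≤ t)
    (h : ∀ z ∈ grid ι (1 / (2 * √t)) (2 * t), N z ≤ A * l2 z) (v : ι → ℝ) :
    N v ≤ 4 * A * (l2 v + l1 v / √t) :=
  seminorm_le_of_sparse (by positivity) ht (fun v hv => seminorm_le_of_grid_sparse hA ht h v hv) v

/-- The root mean square of `n` numbers. -/
noncomputable def rms {n : ℕ} (w : Fin n → ℝ) : ℝ := √((n : ℝ)⁻¹ * ∑ i, w i ^ 2)

variable {n : ℕ}

lemma rms_sq (w : Fin n → ℝ) : rms w ^ 2 = (n : ℝ)⁻¹ * ∑ i, w i ^ 2 :=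
  Real.sq_sqrt (mul_nonneg (by positivity) (Finset.sum_nonneg fun _ _ => sq_nonneg _))

lemma rms_eq (w : Fin n → ℝ) : rms w = √(n : ℝ)⁻¹ * l2 w := Real.sqrt_mul (by positivity) _

lemma rms_add_le (v w : Fin n → ℝ) : rms (v + w) ≤ rms v + rms w := by
  simp only [rms_eq, ← mul_add]
  exact mul_le_mul_of_nonneg_left (l2_add_le v w) (Real.sqrt_nonneg _)

lemma rms_smul (r : ℝ) (w : Fin n → ℝ) : rms (r • w) = |r| * rms w := by
  rw [rms_eq, rms_eq, l2_smul]; ring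

/-- The seminorm `v ↦ (n⁻¹ ∑ (x_i' v) ^ 2) ^ (1 / 2)` attached to a design `x`. -/
noncomputable def designSeminorm (x : Fin n → ι → ℝ) : Seminorm ℝ (ι → ℝ) :=
  Seminorm.of (fun v => rms fun i => x i ⬝ᵥ v)
    (fun v w => by
      simp only [dotProduct_add]
      exact rms_add_le _ _)
    (fun r v => by
      simp only [dotProduct_smul]
      exact rms_smul r _)

lemma designSeminorm_apply (x : Fin n → ι → ℝ) (v : ι → ℝ) :
    designSeminorm x v = rms fun i => x i ⬝ᵥ v := rfl

lemma designSeminorm_sq (x : Fin n → ι → ℝ) (v : ι → ℝ) :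
    designSeminorm x v ^ 2 = (n : ℝ)⁻¹ * ∑ i, (x i ⬝ᵥ v) ^ 2 := rms_sq _

end Deterministic

/-! ### Sub-Gaussian factors and idiosyncratic components -/

lemma integral_dotProduct_mul_dotProduct {ι J Ω : Type*} [Fintype ι] [Fintype J]
    [MeasurableSpace Ω] {P : Measure Ω} {X : Ω → ι → ℝ} {Y : Ω → J → ℝ}
    (hX : ∀ j, MemLp (fun ω => X ω j) 2 P) (hY : ∀ k, MemLp (fun ω => Y ω k) 2 P)
    (a : ι → ℝ) (b : J → ℝ) :
    ∫ ω, (X ω ⬝ᵥ a) * (Y ω ⬝ᵥ b) ∂P = ∑ j, ∑ k, a j * b k * ∫ ω, X ω j * Y ω k ∂P := by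
  have hint : ∀ j k, Integrable (fun ω => a j * b k * (X ω j * Y ω k)) P := fun j k =>
    ((hX j).integrable_mul (hY k)).const_mul _
  have hexp : ∀ ω, (X ω ⬝ᵥ a) * (Y ω ⬝ᵥ b) = ∑ j, ∑ k, a j * b k * (X ω j * Y ω k) := fun ω => by
    simp only [dotProduct, Finset.sum_mul_sum]
    exact Finset.sum_congr rfl fun j _ => Finset.sum_congr rfl fun k _ => by ring
  simp_rw [hexp]
  rw [integral_finsetSum _ fun j _ => integrable_finsetSum _ fun k _ => hint j k]
  refine Finset.sum_congr rfl fun j _ => ?_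
  rw [integral_finsetSum _ fun k _ => hint j k]
  exact Finset.sum_congr rfl fun k _ => integral_const_mul _ _

/-- Independent identically distributed pairs `(F_i, U_i)` of mutually uncorrelated random vectors
whose one-dimensional marginals have square-exponential moments at rate `q`, the covariance matrix
of `U_i` being bounded below by `c`. The covariance matrix of `F_i` may be singular. -/
structure DesignCondition {ι J Ω : Type*} [Fintype ι] [Fintype J] [MeasurableSpace Ω] {n : ℕ}
    (F : Fin n → Ω → ι → ℝ) (U : Fin n → Ω → J → ℝ) (P : Measure Ω) (q c : ℝ) : Prop where
  measurable_F : ∀ i, Measurable (F i)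
  measurable_U : ∀ i, Measurable (U i)
  indep : iIndepFun (fun i ω => (F i ω, U i ω)) P
  ident : ∀ i i', IdentDistrib (F i) (F i') P P
  uncorr : ∀ i a b, ∫ ω, F i ω a * U i ω b ∂P = 0
  exp_F : ∀ i a, l2 a ≤ 1 → ExpSqMoment (fun ω => F i ω ⬝ᵥ a) q P
  exp_U : ∀ i v, l2 v ≤ 1 → ExpSqMoment (fun ω => U i ω ⬝ᵥ v) q P
  lower_U : ∀ i v, c * l2 v ^ 2 ≤ ∫ ω, (U i ω ⬝ᵥ v) ^ 2 ∂P

section Design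

variable {ι J Ω : Type*} [Fintype ι] [Fintype J] [MeasurableSpace Ω] {n : ℕ}
  {F : Fin n → Ω → ι → ℝ} {U : Fin n → Ω → J → ℝ} {P : Measure Ω} {q c : ℝ}

/-- Chi-square bound for the empirical second moment of a variable with a square-exponential
moment, informative when `r > 1 / q`. -/
lemma measure_lt_average_sq_le [IsProbabilityMeasure P] {X : Fin n → Ω → ℝ} (hq : 0 ≤ q)
    (hind : iIndepFun X P) (hm : ∀ i, Measurable (X i)) (hX : ∀ i, ExpSqMoment (X i) q P)
    {r : ℝ} :
    P {ω | r < (n : ℝ)⁻¹ * ∑ i, X i ω ^ 2} ≤ ENNReal.ofReal (Real.exp (n * (1 - q * r))) := by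
  have h := measure_le_sum_le_of_integral_exp_le (P := P) (W := fun i ω => q * X i ω ^ 2)
    (hind.comp (fun _ x => q * x ^ 2) fun _ => by fun_prop) (fun i => by have := hm i; fun_prop)
    (a := 1) (fun i => (hX i).integrable)
    (fun i => (hX i).le_two.trans (by linarith [Real.add_one_le_exp 1])) (q * r)
  refine (measure_mono fun ω hω => ?_).trans h
  simp only [Set.mem_ofPred_eq] at hω ⊢
  rcases Nat.eq_zero_or_pos n with rfl | hn
  · simp
  have hn' : (0 : ℝ) < n := by exact_mod_cast hn
  rw [← div_eq_inv_mul, lt_div_iff₀ hn'] at hω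
  rw [← Finset.mul_sum]
  calc (n : ℝ) * (q * r) = q * (r * n) := by ring
    _ ≤ _ := mul_le_mul_of_nonneg_left hω.le hq

/-- The level `3 / q` gives `exp (-2 n)`, which leaves room for a union over `exp n` directions. -/
lemma measure_lt_designSeminorm_le [IsProbabilityMeasure P] (hq : 0 < q)
    (hind : iIndepFun U P) (hm : ∀ i, Measurable (U i))
    (hU : ∀ i v, l2 v ≤ 1 → ExpSqMoment (fun ω => U i ω ⬝ᵥ v) q P) (z : J → ℝ) :
    P {ω | √(3 / q) * l2 z < designSeminorm (fun i => U i ω) z}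
      ≤ ENNReal.ofReal (Real.exp (-(2 * n))) := by
  rcases (l2_nonneg z).eq_or_lt with h0 | h0
  · have : z = 0 := l2_eq_zero h0.symm
    subst this
    simp [← h0]
  set w := (l2 z)⁻¹ • z with hw
  have hzw : z = l2 z • w := by rw [hw, smul_smul, mul_inv_cancel₀ h0.ne', one_smul]
  have hw1 : l2 w ≤ 1 := by
    rw [hw, l2_smul, abs_of_pos (inv_pos.2 h0), inv_mul_cancel₀ h0.ne']
  have h1 := measure_lt_average_sq_le (P := P) (X := fun i ω => U i ω ⬝ᵥ w) (r := 3 / q) hq.le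
    (hind.comp (fun _ x => x ⬝ᵥ w) fun _ => by unfold dotProduct; fun_prop)
    (fun i => by have := hm i; unfold dotProduct; fun_prop) (fun i => hU i w hw1)
  rw [mul_div_cancel₀ _ hq.ne'] at h1
  refine (measure_mono fun ω hω => ?_).trans (h1.trans (le_of_eq ?_))
  · simp only [Set.mem_ofPred_eq] at hω ⊢
    rw [hzw, map_smul_eq_mul, Real.norm_eq_abs, ← hzw, abs_of_pos h0, mul_comm,
      mul_lt_mul_iff_right₀ h0] at hω
    rw [← designSeminorm_sq]
    calc 3 / q = √(3 / q) ^ 2 := (Real.sq_sqrt (by positivity)).symm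
      _ < _ := by gcongr
  · congr 2; ring

/-- Finite union bound for real-valued estimates. -/
lemma measure_exists_mem_le {α : Type*} (s : Finset α) {B : α → Set Ω} {b : ℝ}
    (h : ∀ a ∈ s, P (B a) ≤ ENNReal.ofReal b) :
    P {ω | ∃ a ∈ s, ω ∈ B a} ≤ ENNReal.ofReal (s.card * b) := by
  have : {ω | ∃ a ∈ s, ω ∈ B a} = ⋃ a ∈ s, B a := by ext; simp
  rw [this]
  refine (measure_biUnion_finset_le s B).trans ((Finset.sum_le_sum h).trans ?_)
  rw [Finset.sum_const, nsmul_eq_mul, ENNReal.ofReal_mul (by positivity)]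
  simp

lemma two_mul_add_one_pow_eq_exp (d m : ℕ) :
    (((2 * d + 1) ^ m : ℕ) : ℝ) = Real.exp (m * Real.log (2 * d + 1)) := by
  rw [Real.exp_nat_mul, Real.exp_log (by positivity)]
  push_cast
  rfl

/-- The design is bounded on all sparse directions, and thus on all directions up to an `ℓ¹` term,
as soon as `t log p` is small compared with `n`. -/
lemma measure_not_forall_designSeminorm_le [IsProbabilityMeasure P] (hq : 0 < q)
    (hind : iIndepFun U P) (hm : ∀ i, Measurable (U i))
    (hU : ∀ i v, l2 v ≤ 1 → ExpSqMoment (fun ω => U i ω ⬝ᵥ v) q P)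
    {t : ℕ} (ht : 1 ≤ t) (htn : 2 * t * Real.log (2 * Fintype.card J + 1) ≤ n) :
    P {ω | ¬ ∀ v, designSeminorm (fun i => U i ω) v ≤ 4 * √(3 / q) * (l2 v + l1 v / √t)}
      ≤ ENNReal.ofReal (Real.exp (-n)) := by
  have h1 := measure_exists_mem_le (P := P) (grid J (1 / (2 * √t)) (2 * t))
    fun z _ => measure_lt_designSeminorm_le hq hind hm hU z
  refine (measure_mono fun ω hω => ?_).trans (h1.trans (ENNReal.ofReal_le_ofReal ?_))
  · simp only [Set.mem_ofPred_eq] at hω ⊢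
    contrapose! hω
    exact seminorm_le_of_grid (by positivity) ht hω
  · calc _ ≤ (((2 * Fintype.card J + 1) ^ (2 * t) : ℕ) : ℝ) * Real.exp (-(2 * n)) := by
          gcongr; exact card_grid_le _ _
      _ ≤ Real.exp n * Real.exp (-(2 * n)) := by
          gcongr
          rw [two_mul_add_one_pow_eq_exp]
          push_cast
          gcongr
      _ = _ := by rw [← Real.exp_add]; congr 1; ring

/-! ### A small-ball estimate and the lower tail for one direction -/

/-- A truncation level for the sum `X + Y` of uncorrelated variables, uniform over all laws with
the given moment bounds. Since `E (X + Y) Y = E Y ^ 2`, the sum cannot be concentrated near `0`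
although `X` may be almost a function of `Y`. -/
lemma exists_truncation {c₀ C₄ G : ℝ} (hc : 0 < c₀) (hC : 0 ≤ C₄) (hG : 0 ≤ G) :
    ∃ B : ℝ, 0 < B ∧ ∀ {Ω : Type*} [MeasurableSpace Ω] {P : Measure Ω} [IsProbabilityMeasure P]
      {X Y : Ω → ℝ}, MemLp X 2 P → MemLp Y 2 P → Integrable (fun ω => Y ω ^ 4) P →
      ∫ ω, X ω * Y ω ∂P = 0 → c₀ ≤ ∫ ω, Y ω ^ 2 ∂P → ∫ ω, Y ω ^ 4 ∂P ≤ C₄ →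
      ∫ ω, (X ω + Y ω) ^ 2 ∂P ≤ G →
      c₀ / 2 ≤ ∫ ω, min ((X ω + Y ω) ^ 2) (B ^ 2) ∂P := by
  set δ := c₀ / (8 * (G + 1)) with hδ
  have hδ0 : 0 < δ := by positivity
  set D := √(4 * C₄ / (δ * c₀) + 1) with hD
  have hD0 : 0 < D := Real.sqrt_pos.2 (by positivity)
  have hD2 : D ^ 2 = 4 * C₄ / (δ * c₀) + 1 := Real.sq_sqrt (by positivity)
  set B := √(4 * D ^ 2 * G / (δ * c₀) + 1) with hB
  have hB0 : 0 < B := Real.sqrt_pos.2 (by positivity)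
  have hB2 : B ^ 2 = 4 * D ^ 2 * G / (δ * c₀) + 1 := Real.sq_sqrt (by positivity)
  have e1 : δ * G ≤ c₀ / 8 := by
    rw [hδ]
    rw [div_mul_eq_mul_div, div_le_div_iff₀ (by positivity) (by positivity)]
    nlinarith
  have e2 : 1 / (4 * δ) * (C₄ / D ^ 2) ≤ c₀ / 16 := by
    rw [div_mul_div_comm, div_le_div_iff₀ (by positivity) (by positivity), hD2]
    have : c₀ * (4 * δ * (4 * C₄ / (δ * c₀) + 1)) = 16 * C₄ + 4 * δ * c₀ := by
      field_simp
      ring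
    rw [this]
    nlinarith [mul_pos hδ0 hc]
  have e3 : 1 / (4 * δ) * (D ^ 2 * G / B ^ 2) ≤ c₀ / 16 := by
    rw [div_mul_div_comm, div_le_div_iff₀ (by positivity) (by positivity), hB2]
    have : c₀ * (4 * δ * (4 * D ^ 2 * G / (δ * c₀) + 1)) = 16 * (D ^ 2 * G) + 4 * δ * c₀ := by
      field_simp
      ring
    rw [this]
    nlinarith [mul_pos hδ0 hc]
  refine ⟨B, hB0, ?_⟩
  intro Ω _ P _ X Y hX hY hY4 hXY hc0 hC4 hZ
  have iZ : Integrable (fun ω => (X ω + Y ω) ^ 2) P := (hX.add hY).integrable_sq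
  have iY := hY.integrable_sq
  have iXY : Integrable (fun ω => X ω * Y ω) P := hX.integrable_mul hY
  have imin : Integrable (fun ω => min ((X ω + Y ω) ^ 2) (B ^ 2)) P :=
    iZ.inf (integrable_const _)
  -- With `Z = X + Y`, so that `X Y = Z Y - Y ^ 2`: if `|Z| ≤ B` this is `Z Y ≤ (Z ^ 2 + Y ^ 2) / 2`.
  -- Otherwise `Z Y ≤ δ Z ^ 2 + Y ^ 2 / (4 δ)`, where `Y ^ 2 ≤ Y ^ 4 / D ^ 2` or `Y ^ 2 ≤ D ^ 2`,
  -- the latter being at most `D ^ 2 Z ^ 2 / B ^ 2`.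
  have hpt : ∀ ω, X ω * Y ω + 1 / 2 * Y ω ^ 2 ≤ 1 / 2 * min ((X ω + Y ω) ^ 2) (B ^ 2)
      + (δ + 1 / (4 * δ) * (D ^ 2 / B ^ 2)) * (X ω + Y ω) ^ 2
      + 1 / (4 * δ) * (1 / D ^ 2) * Y ω ^ 4 := fun ω => by
    set z := X ω + Y ω
    set y := Y ω
    have hx : X ω = z - y := by simp [z, y]
    rw [hx]
    have p1 : 0 ≤ 1 / (4 * δ) * (D ^ 2 / B ^ 2) * z ^ 2 := by positivity
    have p2 : 0 ≤ 1 / (4 * δ) * (1 / D ^ 2) * y ^ 4 := by positivity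
    have p3 : 0 ≤ δ * z ^ 2 := by positivity
    rcases le_total (z ^ 2) (B ^ 2) with h | h
    · rw [min_eq_left h]
      nlinarith [sq_nonneg (z - y)]
    · rw [min_eq_right h]
      have h1 : z * y ≤ δ * z ^ 2 + 1 / (4 * δ) * y ^ 2 := by
        have h0 : 0 ≤ (2 * δ * z - y) ^ 2 / (4 * δ) := by positivity
        have : (2 * δ * z - y) ^ 2 / (4 * δ) = δ * z ^ 2 - z * y + 1 / (4 * δ) * y ^ 2 := by
          field_simp
          ring
        linarith
      have h2 : y ^ 2 ≤ 1 / D ^ 2 * y ^ 4 + D ^ 2 / B ^ 2 * z ^ 2 := by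
        have h3 : D ^ 2 ≤ D ^ 2 / B ^ 2 * z ^ 2 := by
          rw [div_mul_eq_mul_div, le_div_iff₀ (by positivity)]
          gcongr
        rcases le_total (y ^ 2) (D ^ 2) with h4 | h4
        · have : 0 ≤ 1 / D ^ 2 * y ^ 4 := by positivity
          linarith
        · have : y ^ 2 ≤ 1 / D ^ 2 * y ^ 4 := by
            rw [div_mul_eq_mul_div, le_div_iff₀ (by positivity)]
            nlinarith [sq_nonneg y]
          have : 0 ≤ D ^ 2 := by positivity
          linarith
      have h5 : 1 / (4 * δ) * y ^ 2
          ≤ 1 / (4 * δ) * (1 / D ^ 2 * y ^ 4 + D ^ 2 / B ^ 2 * z ^ 2) := by gcongr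
      nlinarith [sq_nonneg B, sq_nonneg y]
  have iL : Integrable (fun ω => X ω * Y ω + 1 / 2 * Y ω ^ 2) P := iXY.add (iY.const_mul _)
  have i1 : Integrable (fun ω => 1 / 2 * min ((X ω + Y ω) ^ 2) (B ^ 2)
      + (δ + 1 / (4 * δ) * (D ^ 2 / B ^ 2)) * (X ω + Y ω) ^ 2) P :=
    (imin.const_mul _).add (iZ.const_mul _)
  have h := integral_mono iL (i1.add (hY4.const_mul (1 / (4 * δ) * (1 / D ^ 2)))) hpt
  simp only [Pi.add_apply] at h
  rw [integral_add iXY (iY.const_mul _), integral_add i1 (hY4.const_mul _),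
    integral_add (imin.const_mul _) (iZ.const_mul _), hXY] at h
  simp only [integral_const_mul] at h
  have b1 : (δ + 1 / (4 * δ) * (D ^ 2 / B ^ 2)) * ∫ ω, (X ω + Y ω) ^ 2 ∂P
      ≤ (δ + 1 / (4 * δ) * (D ^ 2 / B ^ 2)) * G := by gcongr
  have b2 : 1 / (4 * δ) * (1 / D ^ 2) * ∫ ω, Y ω ^ 4 ∂P ≤ 1 / (4 * δ) * (1 / D ^ 2) * C₄ := by
    gcongr
  have b3 : (δ + 1 / (4 * δ) * (D ^ 2 / B ^ 2)) * G
      = δ * G + 1 / (4 * δ) * (D ^ 2 * G / B ^ 2) := by ring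
  have b4 : 1 / (4 * δ) * (1 / D ^ 2) * C₄ = 1 / (4 * δ) * (C₄ / D ^ 2) := by ring
  linarith

/-- Chernoff's bound for the lower tail of an average of squares, truncated at a level that keeps
a fixed amount of mass. -/
lemma measure_average_sq_lt_le [IsProbabilityMeasure P] {Z : Fin n → Ω → ℝ} {B m : ℝ}
    (hB : 0 < B) (hind : iIndepFun Z P) (hm : ∀ i, Measurable (Z i))
    (hmin : ∀ i, m ≤ ∫ ω, min (Z i ω ^ 2) (B ^ 2) ∂P) :
    P {ω | (n : ℝ)⁻¹ * ∑ i, Z i ω ^ 2 < m / 4}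
      ≤ ENNReal.ofReal (Real.exp (-(n * (m / (4 * B ^ 2))))) := by
  have hbd : ∀ i ω, 0 ≤ min (Z i ω ^ 2) (B ^ 2) ∧ min (Z i ω ^ 2) (B ^ 2) ≤ B ^ 2 :=
    fun i ω => ⟨le_min (sq_nonneg _) (sq_nonneg _), min_le_right _ _⟩
  have hmm : ∀ i, Measurable fun ω => min (Z i ω ^ 2) (B ^ 2) := fun i => by
    have := hm i; fun_prop
  have imin : ∀ i, Integrable (fun ω => min (Z i ω ^ 2) (B ^ 2)) P := fun i =>
    (integrable_const (B ^ 2)).mono' (hmm i).aestronglyMeasurable (ae_of_all _ fun ω => by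
      rw [Real.norm_of_nonneg (hbd i ω).1]; exact (hbd i ω).2)
  -- `exp (-y) ≤ 1 - y / 2` on `[0, 1]`.
  have hpt : ∀ i ω, Real.exp (-(min (Z i ω ^ 2) (B ^ 2) / B ^ 2))
      ≤ 1 - 1 / (2 * B ^ 2) * min (Z i ω ^ 2) (B ^ 2) := fun i ω => by
    set y := min (Z i ω ^ 2) (B ^ 2) / B ^ 2 with hy
    have hy0 : 0 ≤ y := div_nonneg (hbd i ω).1 (by positivity)
    have hy1 : y ≤ 1 := div_le_one_of_le₀ (hbd i ω).2 (by positivity)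
    have : 1 / (2 * B ^ 2) * min (Z i ω ^ 2) (B ^ 2) = y / 2 := by
      rw [hy]; field_simp
    rw [this]
    have h1 := Real.quadratic_le_exp_of_nonneg hy0
    have h2 : Real.exp (-y) * Real.exp y = 1 := by rw [← Real.exp_add]; simp
    have h3 := Real.exp_pos (-y)
    have h4 : 0 ≤ 1 - y / 2 := by linarith
    have h5 : 1 ≤ (1 - y / 2) * Real.exp y := by
      calc 1 ≤ (1 - y / 2) * (1 + y + y ^ 2 / 2) := by
            nlinarith [mul_nonneg hy0 (by linarith : 0 ≤ 1 - y), sq_nonneg y]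
        _ ≤ _ := by gcongr
    calc Real.exp (-y) = Real.exp (-y) * 1 := (mul_one _).symm
      _ ≤ Real.exp (-y) * ((1 - y / 2) * Real.exp y) := by gcongr
      _ = (1 - y / 2) * (Real.exp (-y) * Real.exp y) := by ring
      _ = _ := by rw [h2, mul_one]
  have iexp : ∀ i, Integrable (fun ω => Real.exp (-(min (Z i ω ^ 2) (B ^ 2) / B ^ 2))) P :=
    fun i => (integrable_const 1).mono' (by have := hmm i; fun_prop) (ae_of_all _ fun ω => by
      rw [Real.norm_of_nonneg (by positivity)]
      exact Real.exp_le_one_iff.2 (neg_nonpos.2 (div_nonneg (hbd i ω).1 (by positivity))))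
  have h := measure_le_sum_le_of_integral_exp_le (P := P)
    (W := fun i ω => -(min (Z i ω ^ 2) (B ^ 2) / B ^ 2))
    (hind.comp (fun _ x => -(min (x ^ 2) (B ^ 2) / B ^ 2)) fun _ => by fun_prop)
    (fun i => by have := hmm i; fun_prop) (a := -(m / (2 * B ^ 2))) iexp
    (fun i => by
      refine (integral_mono (iexp i) ((integrable_const 1).sub ((imin i).const_mul _))
        (hpt i)).trans ?_
      simp only [Pi.sub_apply]
      rw [integral_sub (integrable_const 1) ((imin i).const_mul _), integral_const_mul]
      have h1 := Real.add_one_le_exp (-(m / (2 * B ^ 2)))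
      have h2 : 1 / (2 * B ^ 2) * m ≤ 1 / (2 * B ^ 2) * ∫ ω, min (Z i ω ^ 2) (B ^ 2) ∂P := by
        gcongr
        exact hmin i
      have h3 : 1 / (2 * B ^ 2) * m = m / (2 * B ^ 2) := by ring
      have h4 : ∫ _, (1 : ℝ) ∂P = 1 := by simp
      linarith) (-(m / (4 * B ^ 2)))
  refine (measure_mono fun ω hω => ?_).trans (h.trans (le_of_eq ?_))
  · simp only [Set.mem_ofPred_eq] at hω ⊢
    rcases Nat.eq_zero_or_pos n with rfl | hn
    · simp
    have hn' : (0 : ℝ) < n := by exact_mod_cast hn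
    rw [← div_eq_inv_mul, div_lt_iff₀ hn'] at hω
    have h1 : ∑ i, min (Z i ω ^ 2) (B ^ 2) ≤ ∑ i, Z i ω ^ 2 :=
      Finset.sum_le_sum fun i _ => min_le_left _ _
    rw [Finset.sum_neg_distrib, ← Finset.sum_div, mul_neg, neg_le_neg_iff,
      div_le_iff₀ (by positivity)]
    have h2 : (n : ℝ) * (m / (4 * B ^ 2)) * B ^ 2 = m / 4 * n := by field_simp
    linarith
  · congr 2
    field_simp
    ring

/-! ### The empirical second moment matrix of the factors -/

/-- A basis that is normalized for the form `a' S a + θ |a| ^ 2` and in which this form is the sum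
of the squared coordinates. The ridge `θ` makes up for a singular `S`. -/
lemma exists_whitening (S : Matrix ι ι ℝ) (hS : S.IsHermitian) (hpsd : ∀ a, 0 ≤ a ⬝ᵥ (S *ᵥ a))
    {θ : ℝ} (hθ : 0 < θ) :
    ∃ e : ι → ι → ℝ, (∀ k, e k ⬝ᵥ (S *ᵥ e k) + θ * l2 (e k) ^ 2 = 1) ∧
      ∀ a, ∃ α : ι → ℝ, a = ∑ k, α k • e k ∧
        ∑ k, α k ^ 2 = a ⬝ᵥ (S *ᵥ a) + θ * l2 a ^ 2 := by
  classical
  set b : ι → ι → ℝ := fun k => (hS.eigenvectorBasis k).ofLp with hb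
  set μ := hS.eigenvalues with hμ
  have hSb : ∀ k, S *ᵥ b k = μ k • b k := fun k => hS.mulVec_eigenvectorBasis k
  have hbb : ∀ k l, b k ⬝ᵥ b l = if k = l then 1 else 0 := fun k l => by
    have := orthonormal_iff_ite.1 hS.eigenvectorBasis.orthonormal l k
    rw [EuclideanSpace.inner_eq_star_dotProduct] at this
    simpa [eq_comm] using this
  have hl2 : ∀ a : ι → ℝ, l2 a ^ 2 = a ⬝ᵥ a := fun a => by
    rw [l2_sq, dotProduct]; simp [sq]
  have hμ0 : ∀ k, 0 ≤ μ k := fun k => by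
    have := hpsd (b k)
    rw [hSb, dotProduct_smul, hbb] at this
    simpa using this
  have hrep : ∀ a : ι → ℝ, a = ∑ k, (a ⬝ᵥ b k) • b k := fun a => by
    have h := hS.eigenvectorBasis.sum_repr (WithLp.toLp 2 a)
    have h2 := congrArg WithLp.ofLp h
    simp only [WithLp.ofLp_sum, WithLp.ofLp_smul] at h2
    refine h2.symm.trans (Finset.sum_congr rfl fun k _ => ?_)
    congr 1
    rw [OrthonormalBasis.repr_apply_apply, EuclideanSpace.inner_eq_star_dotProduct]
    simp [hb]
  set w : ι → ℝ := fun k => √(μ k + θ) with hw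
  have hw0 : ∀ k, 0 < w k := fun k => Real.sqrt_pos.2 (by linarith [hμ0 k])
  have hw2 : ∀ k, w k ^ 2 = μ k + θ := fun k => Real.sq_sqrt (by linarith [hμ0 k])
  refine ⟨fun k => (w k)⁻¹ • b k, fun k => ?_, fun a => ?_⟩
  · have := hw2 k
    have := (hw0 k).ne'
    rw [hl2]
    simp only [Matrix.mulVec_smul, hSb, dotProduct_smul, smul_dotProduct, hbb, if_true,
      smul_eq_mul, mul_one]
    field_simp
    linarith
  · refine ⟨fun k => w k * (a ⬝ᵥ b k), ?_, ?_⟩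
    · conv_lhs => rw [hrep a]
      refine Finset.sum_congr rfl fun k _ => ?_
      have := (hw0 k).ne'
      rw [smul_smul]
      congr 1
      field_simp
    · have h1 : a ⬝ᵥ a = ∑ k, (a ⬝ᵥ b k) ^ 2 := by
        conv_lhs => rw [hrep a, ← hrep a, dotProduct_comm]
        conv_lhs => arg 1; rw [hrep a]
        rw [sum_dotProduct]
        refine Finset.sum_congr rfl fun k _ => ?_
        rw [smul_dotProduct, dotProduct_comm, smul_eq_mul, sq]
      have h2 : a ⬝ᵥ (S *ᵥ a) = ∑ k, μ k * (a ⬝ᵥ b k) ^ 2 := by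
        have : S *ᵥ a = ∑ k, (a ⬝ᵥ b k) • (μ k • b k) := by
          conv_lhs => rw [hrep a]
          rw [Matrix.mulVec_sum]
          simp only [Matrix.mulVec_smul, hSb]
        rw [this, dotProduct_sum]
        refine Finset.sum_congr rfl fun k _ => ?_
        rw [dotProduct_smul, dotProduct_smul, smul_eq_mul, smul_eq_mul]
        ring
      rw [hl2, h1, h2, Finset.mul_sum, ← Finset.sum_add_distrib]
      refine Finset.sum_congr rfl fun k _ => ?_
      rw [mul_pow, hw2]
      ring

namespace DesignCondition

lemma memLp_F (hD : DesignCondition F U P q c) (hq : 0 < q) (i : Fin n) (a : ι → ℝ) :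
    MemLp (fun ω => F i ω ⬝ᵥ a) 2 P := by
  rcases (l2_nonneg a).eq_or_lt with h0 | h0
  · rw [l2_eq_zero h0.symm]
    simp
  · have h := ((hD.exp_F i ((l2 a)⁻¹ • a) (by
      rw [l2_smul, abs_of_pos (inv_pos.2 h0), inv_mul_cancel₀ h0.ne'])).memLp_two hq).const_mul
      (l2 a)
    refine h.congr_norm ?_ (ae_of_all _ fun ω => ?_)
    · have := hD.measurable_F i
      unfold dotProduct
      fun_prop
    · rw [dotProduct_smul, smul_eq_mul, mul_inv_cancel_left₀ h0.ne']

lemma integral_sq_F_le (hD : DesignCondition F U P q c) (hq : 0 < q) (i : Fin n) (a : ι → ℝ) :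
    ∫ ω, (F i ω ⬝ᵥ a) ^ 2 ∂P ≤ 2 / q * l2 a ^ 2 := by
  rcases (l2_nonneg a).eq_or_lt with h0 | h0
  · rw [l2_eq_zero h0.symm]
    simp [l2]
  · have h := (hD.exp_F i ((l2 a)⁻¹ • a) (by
      rw [l2_smul, abs_of_pos (inv_pos.2 h0), inv_mul_cancel₀ h0.ne'])).integral_sq_le hq
    simp only [dotProduct_smul, smul_eq_mul, mul_pow] at h
    rw [integral_const_mul, inv_pow, inv_mul_le_iff₀ (by positivity)] at h
    linarith

lemma integral_sq_eq (hD : DesignCondition F U P q c) (i i' : Fin n) (a : ι → ℝ) :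
    ∫ ω, (F i ω ⬝ᵥ a) ^ 2 ∂P = ∫ ω, (F i' ω ⬝ᵥ a) ^ 2 ∂P :=
  ((hD.ident i i').comp (u := fun x => (x ⬝ᵥ a) ^ 2)
    (by unfold dotProduct; fun_prop)).integral_eq

lemma integral_mul_eq (hD : DesignCondition F U P q c) (i i' : Fin n) (a b : ι → ℝ) :
    ∫ ω, (F i ω ⬝ᵥ a) * (F i ω ⬝ᵥ b) ∂P = ∫ ω, (F i' ω ⬝ᵥ a) * (F i' ω ⬝ᵥ b) ∂P :=
  ((hD.ident i i').comp (u := fun x => (x ⬝ᵥ a) * (x ⬝ᵥ b))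
    (by unfold dotProduct; fun_prop)).integral_eq

/-- The fourth moment along a direction `e` with `|e| ^ 2 ≤ s` and `E (F' e) ^ 2 ≤ 1` is at most
`s ℓ` up to a constant, instead of the `s ^ 2` that the square-exponential moment alone gives. -/
lemma integral_pow_four_F_le (hD : DesignCondition F U P q c) (hq : 0 < q) (i : Fin n)
    {s : ℕ} (hs : 1 ≤ s) {ℓ : ℝ} (hℓ : 1 ≤ ℓ) (hsℓ : (s : ℝ) ≤ Real.exp ℓ) {e : ι → ℝ}
    (he : l2 e ^ 2 ≤ s) (he1 : ∫ ω, (F i ω ⬝ᵥ e) ^ 2 ∂P ≤ 1) :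
    Integrable (fun ω => (F i ω ⬝ᵥ e) ^ 4) P ∧
      ∫ ω, (F i ω ⬝ᵥ e) ^ 4 ∂P ≤ (2 / q + 16 / q ^ 2) * (s * ℓ) := by
  have hs' : (1 : ℝ) ≤ s := by exact_mod_cast hs
  have hs0 : √(s : ℝ) ≠ 0 := (Real.sqrt_pos.2 (by linarith)).ne'
  have hX := hD.exp_F i ((√s)⁻¹ • e) (by
    rw [l2_smul, abs_of_nonneg (by positivity), inv_mul_le_iff₀ (by positivity), mul_one]
    exact Real.le_sqrt_of_sq_le he)
  have e4 : ∀ ω, (F i ω ⬝ᵥ e) ^ 4 = s ^ 2 * (F i ω ⬝ᵥ ((√s)⁻¹ • e)) ^ 4 := fun ω => by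
    rw [dotProduct_smul, smul_eq_mul, mul_pow, inv_pow,
      show √(s : ℝ) ^ 4 = (√(s : ℝ) ^ 2) ^ 2 by ring, Real.sq_sqrt (by positivity)]
    field_simp
  have e2 : ∀ ω, (F i ω ⬝ᵥ ((√s)⁻¹ • e)) ^ 2 = (s : ℝ)⁻¹ * (F i ω ⬝ᵥ e) ^ 2 := fun ω => by
    rw [dotProduct_smul, smul_eq_mul, mul_pow, inv_pow, Real.sq_sqrt (by positivity)]
  refine ⟨?_, ?_⟩
  · simp_rw [e4]
    exact (hX.integrable_pow_four hq).const_mul _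
  · simp_rw [e4]
    rw [integral_const_mul]
    -- This level makes the exponential remainder equal to `exp (-ℓ) ≤ 1 / s`.
    have h := hX.integral_pow_four_le_mul hq (T := 2 * ℓ / q) (by positivity)
    simp_rw [e2] at h
    rw [integral_const_mul] at h
    have h1 : Real.exp (-(q * (2 * ℓ / q) / 2)) ≤ (s : ℝ)⁻¹ := by
      rw [show q * (2 * ℓ / q) / 2 = ℓ by field_simp, Real.exp_neg]
      exact inv_anti₀ (by linarith) hsℓ
    have h2 : (s : ℝ)⁻¹ * ∫ ω, (F i ω ⬝ᵥ e) ^ 2 ∂P ≤ (s : ℝ)⁻¹ * 1 := by gcongr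
    calc _ ≤ (s : ℝ) ^ 2 * (2 * ℓ / q * ((s : ℝ)⁻¹ * 1) + 16 / q ^ 2 * (s : ℝ)⁻¹) := by
          gcongr
          refine h.trans ?_
          gcongr
      _ = s * (2 * ℓ / q + 16 / q ^ 2 * 1) := by field_simp
      _ ≤ s * (2 * ℓ / q + 16 / q ^ 2 * ℓ) := by gcongr
      _ = _ := by ring

/-- Relative accuracy of the empirical second moments of the factors. The comparison with
`E (F' a) ^ 2 + |a| ^ 2 / s` rather than with `|a| ^ 2` makes it useful for loadings `a` of length
of order `√s`, however ill-conditioned the covariance matrix of the factors is. -/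
lemma measure_not_forall_second_moment_le [IsProbabilityMeasure P]
    (hD : DesignCondition F U P q c) (hq : 0 < q)
    (i₀ : Fin n) {s : ℕ} (hs : 1 ≤ s) {ℓ : ℝ} (hℓ : 1 ≤ ℓ) (hsℓ : (s : ℝ) ≤ Real.exp ℓ)
    {η : ℝ} (hη : 0 < η) :
    P {ω | ¬ ∀ a, |(n : ℝ)⁻¹ * ∑ i, (F i ω ⬝ᵥ a) ^ 2 - ∫ ω, (F i₀ ω ⬝ᵥ a) ^ 2 ∂P|
        ≤ η * Fintype.card ι * (∫ ω, (F i₀ ω ⬝ᵥ a) ^ 2 ∂P + l2 a ^ 2 / s)}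
      ≤ ENNReal.ofReal ((Fintype.card ι : ℝ) ^ 2 *
          ((2 / q + 16 / q ^ 2) * (s * ℓ) / (n * η ^ 2))) := by
  classical
  have hn : (n : ℝ) ≠ 0 := by
    have := i₀.pos
    positivity
  have hs' : (1 : ℝ) ≤ s := by exact_mod_cast hs
  set S : Matrix ι ι ℝ := Matrix.of fun a b => ∫ ω, F i₀ ω a * F i₀ ω b ∂P with hS
  have hcoord : ∀ a, MemLp (fun ω => F i₀ ω a) 2 P := fun a => by
    simpa using hD.memLp_F hq i₀ (Pi.single a 1)
  have hform : ∀ a b : ι → ℝ, a ⬝ᵥ (S *ᵥ b) = ∫ ω, (F i₀ ω ⬝ᵥ a) * (F i₀ ω ⬝ᵥ b) ∂P := by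
    intro a b
    rw [integral_dotProduct_mul_dotProduct hcoord hcoord]
    simp only [dotProduct, Matrix.mulVec, Finset.mul_sum, hS, Matrix.of_apply]
    exact Finset.sum_congr rfl fun j _ => Finset.sum_congr rfl fun k _ => by ring
  have hform2 : ∀ a : ι → ℝ, a ⬝ᵥ (S *ᵥ a) = ∫ ω, (F i₀ ω ⬝ᵥ a) ^ 2 ∂P := fun a => by
    rw [hform]; simp only [sq]
  obtain ⟨e, he1, hrep⟩ := exists_whitening S (by
      ext a b
      simp only [hS, Matrix.conjTranspose_apply, Matrix.of_apply, star_trivial]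
      congr 1
      ext ω
      ring) (fun a => by rw [hform2]; positivity) (θ := (s : ℝ)⁻¹) (by positivity)
  simp only [hform2] at he1 hrep
  have hel : ∀ k, l2 (e k) ^ 2 ≤ s := fun k => by
    have h1 := he1 k
    have h2 : 0 ≤ ∫ ω, (F i₀ ω ⬝ᵥ e k) ^ 2 ∂P := integral_nonneg fun _ => sq_nonneg _
    have : (s : ℝ)⁻¹ * l2 (e k) ^ 2 ≤ 1 := by linarith
    rwa [inv_mul_le_iff₀ (by positivity), mul_one] at this
  have hem : ∀ k i, ∫ ω, (F i ω ⬝ᵥ e k) ^ 2 ∂P ≤ 1 := fun k i => by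
    rw [hD.integral_sq_eq i i₀]
    have h1 := he1 k
    have : 0 ≤ (s : ℝ)⁻¹ * l2 (e k) ^ 2 := by positivity
    linarith
  set Q := (2 / q + 16 / q ^ 2) * (s * ℓ) with hQ
  set m : ι → ι → ℝ := fun k l => ∫ ω, (F i₀ ω ⬝ᵥ e k) * (F i₀ ω ⬝ᵥ e l) ∂P with hm
  have hdev : ∀ z ∈ (Finset.univ : Finset (ι × ι)),
      P {ω | η ≤ |(n : ℝ)⁻¹ * ∑ i, ((F i ω ⬝ᵥ e z.1) * (F i ω ⬝ᵥ e z.2) - m z.1 z.2)|}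
        ≤ ENNReal.ofReal (Q / (n * η ^ 2)) := by
    rintro ⟨k, l⟩ -
    have h4 := fun k i => hD.integral_pow_four_F_le hq i hs hℓ hsℓ (hel k) (hem k i)
    have hmeas : ∀ k i, Measurable fun ω => F i ω ⬝ᵥ e k := fun k i => by
      have := hD.measurable_F i
      unfold dotProduct
      fun_prop
    have hprod : ∀ i, MemLp (fun ω => (F i ω ⬝ᵥ e k) * (F i ω ⬝ᵥ e l)) 2 P := fun i => by
      rw [memLp_two_iff_integrable_sq (by have := hmeas k i; have := hmeas l i; fun_prop)]
      refine ((h4 k i).1.add (h4 l i).1).mono'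
        (by have := hmeas k i; have := hmeas l i; fun_prop) (ae_of_all _ fun ω => ?_)
      rw [Real.norm_of_nonneg (by positivity)]
      simp only [Pi.add_apply]
      nlinarith [sq_nonneg ((F i ω ⬝ᵥ e k) ^ 2 - (F i ω ⬝ᵥ e l) ^ 2),
        sq_nonneg ((F i ω ⬝ᵥ e k) ^ 2), sq_nonneg ((F i ω ⬝ᵥ e l) ^ 2)]
    have hmean : ∀ i, ∫ ω, (F i ω ⬝ᵥ e k) * (F i ω ⬝ᵥ e l) ∂P = m k l :=
      fun i => hD.integral_mul_eq i i₀ _ _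
    refine measure_le_abs_average_le (W := fun i ω => (F i ω ⬝ᵥ e k) * (F i ω ⬝ᵥ e l) - m k l)
      (hD.indep.comp (fun _ x => (x.1 ⬝ᵥ e k) * (x.1 ⬝ᵥ e l) - m k l) fun _ => by
        unfold dotProduct; fun_prop)
      (fun i => (hprod i).sub (memLp_const _)) (fun i => ?_) (fun i => ?_) hη
    · rw [integral_sub ((hprod i).integrable (by norm_num)) (integrable_const _), hmean]
      simp
    · have hv := variance_eq_integral (μ := P)
        (X := fun ω => (F i ω ⬝ᵥ e k) * (F i ω ⬝ᵥ e l)) (hprod i).aemeasurable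
      rw [hmean] at hv
      rw [← hv]
      refine (variance_le_expectation_sq (hprod i).1).trans ?_
      have hpt : ∀ ω, ((fun ω => (F i ω ⬝ᵥ e k) * (F i ω ⬝ᵥ e l)) ^ 2) ω
          ≤ 1 / 2 * ((F i ω ⬝ᵥ e k) ^ 4 + (F i ω ⬝ᵥ e l) ^ 4) := fun ω => by
        simp only [Pi.pow_apply]
        nlinarith [sq_nonneg ((F i ω ⬝ᵥ e k) ^ 2 - (F i ω ⬝ᵥ e l) ^ 2)]
      refine (integral_mono (hprod i).integrable_sq
        (((h4 k i).1.add (h4 l i).1).const_mul (1 / 2)) hpt).trans ?_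
      rw [integral_const_mul]
      simp only [Pi.add_apply]
      rw [integral_add (h4 k i).1 (h4 l i).1]
      linarith [(h4 k i).2, (h4 l i).2]
  have hunion := measure_exists_mem_le (P := P) Finset.univ hdev
  refine (measure_mono fun ω hω => ?_).trans (hunion.trans (le_of_eq ?_))
  · simp only [Set.mem_ofPred_eq, Finset.mem_univ, true_and] at hω ⊢
    contrapose! hω
    intro a
    obtain ⟨α, ha, hα⟩ := hrep a
    have hdot : ∀ x : ι → ℝ, x ⬝ᵥ a = ∑ k, α k * (x ⬝ᵥ e k) := fun x => by
      conv_lhs => rw [ha]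
      rw [dotProduct_sum]
      simp only [dotProduct_smul, smul_eq_mul]
    have hexp : ∀ x : ι → ℝ, (x ⬝ᵥ a) ^ 2
        = ∑ k, ∑ l, α k * α l * ((x ⬝ᵥ e k) * (x ⬝ᵥ e l)) := fun x => by
      rw [hdot, sq, Finset.sum_mul_sum]
      refine Finset.sum_congr rfl fun k _ => Finset.sum_congr rfl fun l _ => by ring
    have hE : ∫ ω, (F i₀ ω ⬝ᵥ a) ^ 2 ∂P = ∑ k, ∑ l, α k * α l * m k l := by
      have hint : ∀ k l, Integrable
          (fun ω => α k * α l * ((F i₀ ω ⬝ᵥ e k) * (F i₀ ω ⬝ᵥ e l))) P := fun k l =>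
        ((hD.memLp_F hq i₀ _).integrable_mul (hD.memLp_F hq i₀ _)).const_mul _
      simp_rw [hexp]
      rw [integral_finsetSum _ fun k _ => integrable_finsetSum _ fun l _ => hint k l]
      refine Finset.sum_congr rfl fun k _ => ?_
      rw [integral_finsetSum _ fun l _ => hint k l]
      refine Finset.sum_congr rfl fun l _ => ?_
      rw [integral_const_mul]
    have hemp : (n : ℝ)⁻¹ * ∑ i, (F i ω ⬝ᵥ a) ^ 2 - ∫ ω, (F i₀ ω ⬝ᵥ a) ^ 2 ∂P
        = ∑ k, ∑ l, α k * α l *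
          ((n : ℝ)⁻¹ * ∑ i, ((F i ω ⬝ᵥ e k) * (F i ω ⬝ᵥ e l) - m k l)) := by
      rw [hE]
      simp_rw [hexp]
      rw [Finset.sum_comm, Finset.mul_sum, ← Finset.sum_sub_distrib]
      refine Finset.sum_congr rfl fun k _ => ?_
      rw [Finset.sum_comm, Finset.mul_sum, ← Finset.sum_sub_distrib]
      refine Finset.sum_congr rfl fun l _ => ?_
      rw [Finset.sum_sub_distrib, ← Finset.mul_sum]
      simp only [Finset.sum_const, Finset.card_univ, Fintype.card_fin, nsmul_eq_mul]
      field_simp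
    rw [hemp]
    have hsum : ∑ k, ∑ l, |α k| * |α l| * η = η * (∑ k, |α k|) ^ 2 := by
      rw [sq, Finset.sum_mul_sum, Finset.mul_sum]
      refine Finset.sum_congr rfl fun k _ => ?_
      rw [Finset.mul_sum]
      exact Finset.sum_congr rfl fun l _ => by ring
    calc _ ≤ ∑ k, ∑ l, |α k| * |α l| * η := by
          refine (Finset.abs_sum_le_sum_abs _ _).trans (Finset.sum_le_sum fun k _ => ?_)
          refine (Finset.abs_sum_le_sum_abs _ _).trans (Finset.sum_le_sum fun l _ => ?_)
          rw [abs_mul, abs_mul]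
          gcongr
          exact (hω (k, l)).le
      _ = η * (∑ k, |α k|) ^ 2 := hsum
      _ ≤ η * (Fintype.card ι * ∑ k, α k ^ 2) := by
          gcongr
          have := sq_sum_le_card_mul_sum_sq (s := Finset.univ) (f := fun k => |α k|)
          simpa using this
      _ = _ := by rw [hα]; ring
  · rw [Finset.card_univ, Fintype.card_prod]
    push_cast
    congr 1
    ring

end DesignCondition

/-! ### The restricted eigenvalue condition -/

/-- The deterministic part of the restricted eigenvalue bound. If `F a` is long, it dominates `U v`
by the triangle inequality. Otherwise `a` has a bounded population second moment `E a`, and `(a, v)`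
can be rounded to a lattice point at which the lower bound `κ₀` is available. -/
lemma le_rms_add_of_grid {F : Fin n → ι → ℝ} {U : Fin n → J → ℝ} {E : (ι → ℝ) → ℝ}
    {A Q L κ₀ : ℝ} {N R s : ℕ} (hA : 0 < A) (hQ : 0 ≤ Q) (hs : 1 ≤ s) (hN : 2 ≤ N)
    (hNκ : 2 * A * (Fintype.card ι + 5) ≤ N * √κ₀)
    (hU : ∀ v, designSeminorm U v ≤ A * (l2 v + l1 v / √((N ^ 2 * s : ℕ) : ℝ)))
    (hFc : ∀ j, ∀ r : ℝ, rms (fun i => F i j * r) ≤ A * |r|)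
    (hF : ∀ a, (∀ j, |a j| ≤ R * √s) → E a / 2 - 1 ≤ designSeminorm F a ^ 2)
    (hE : ∀ a b, E b ≤ 2 * E a + 2 * (Q * l2 (b - a) ^ 2))
    (hL : 144 * A ^ 2 + 4 + 2 * Q * Fintype.card ι ≤ L)
    (hgrid : ∀ b ∈ grid ι (1 / N) (Fintype.card ι * R * N * s),
      ∀ z ∈ grid J (1 / (4 * √s * N ^ 2)) (16 * s * N ^ 2), E b ≤ L → 1 / 2 ≤ l2 z → l2 z ≤ 2 →
        κ₀ ≤ (n : ℝ)⁻¹ * ∑ i, (F i ⬝ᵥ b + U i ⬝ᵥ z) ^ 2)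
    {a : ι → ℝ} {v : J → ℝ} (hv2 : l2 v = 1) (hv1 : l1 v ≤ 4 * √s) (ha : ∀ j, |a j| ≤ R * √s) :
    min A (√κ₀ / 2) ≤ rms fun i => F i ⬝ᵥ a + U i ⬝ᵥ v := by
  have hs' : (1 : ℝ) ≤ s := by exact_mod_cast hs
  have hN' : (2 : ℝ) ≤ N := by exact_mod_cast hN
  have hss : 1 ≤ √(s : ℝ) := Real.one_le_sqrt.2 hs'
  have hss2 : √(s : ℝ) * √s = s := Real.mul_self_sqrt (by positivity)
  have hsN : √((N ^ 2 * s : ℕ) : ℝ) = N * √s := by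
    push_cast
    rw [Real.sqrt_mul (by positivity), Real.sqrt_sq (by positivity)]
  rw [hsN] at hU
  have hl1 : ∀ w : J → ℝ, l1 w ≤ 4 * √s → l1 w / (N * √s) ≤ 4 / N := fun w hw => by
    rw [div_le_div_iff₀ (by positivity) (by positivity)]
    nlinarith
  have hN2 : 4 / (N : ℝ) ≤ 2 := by
    rw [div_le_iff₀ (by positivity)]; linarith
  have hUv : designSeminorm U v ≤ 5 * A := by
    refine (hU v).trans ?_
    have := hl1 v hv1
    rw [hv2]
    nlinarith
  have htri : designSeminorm F a ≤ (rms fun i => F i ⬝ᵥ a + U i ⬝ᵥ v) + designSeminorm U v := by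
    rw [designSeminorm_apply, designSeminorm_apply]
    have h1 : (fun i => F i ⬝ᵥ a) = (fun i => F i ⬝ᵥ a + U i ⬝ᵥ v) + fun i => U i ⬝ᵥ (-v) := by
      ext i; simp
    have h2 : rms (fun i => U i ⬝ᵥ (-v)) = rms fun i => U i ⬝ᵥ v := by
      simp [rms]
    rw [h1]
    refine (rms_add_le _ _).trans ?_
    rw [h2]
  rcases le_or_gt (6 * A) (designSeminorm F a) with hlong | hshort
  · exact (min_le_left _ _).trans (by linarith)
  refine (min_le_right _ _).trans ?_
  have hEa : E a ≤ 2 * (36 * A ^ 2 + 1) := by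
    have h1 := hF a ha
    have h2 : designSeminorm F a ^ 2 ≤ (6 * A) ^ 2 :=
      pow_le_pow_left₀ (apply_nonneg _ _) hshort.le 2
    nlinarith
  obtain ⟨b, hb, hba⟩ := exists_mem_grid (g := 1 / (N : ℝ)) (by positivity)
    (Fintype.card ι * R * N * s) a (by
      calc l1 a ≤ ∑ _j : ι, R * √s := Finset.sum_le_sum fun j _ => ha j
        _ = Fintype.card ι * (R * √s) := by simp
        _ ≤ Fintype.card ι * (R * s) := by gcongr; nlinarith
        _ = _ := by push_cast; field_simp)
  obtain ⟨z, hz, hzv⟩ := exists_mem_grid (g := 1 / (4 * √s * (N : ℝ) ^ 2)) (by positivity)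
    (16 * s * N ^ 2) v (by
      refine hv1.trans (le_of_eq ?_)
      push_cast
      field_simp
      linarith)
  have hrz : l2 (v - z) ≤ 1 / N := by
    rw [l2_le_iff (by positivity)]
    calc ∑ j, (v - z) j ^ 2 ≤ ∑ j, 1 / (4 * √s * (N : ℝ) ^ 2) * |v j| :=
          Finset.sum_le_sum fun j _ => by
            rw [Pi.sub_apply, ← sq_abs, sq]
            exact mul_le_mul (hzv j).1 (hzv j).2 (abs_nonneg _) (by positivity)
      _ = 1 / (4 * √s * (N : ℝ) ^ 2) * l1 v := by rw [l1, Finset.mul_sum]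
      _ ≤ 1 / (4 * √s * (N : ℝ) ^ 2) * (4 * √s) := by gcongr
      _ = _ := by field_simp
  have hrz1 : l1 (v - z) ≤ 4 * √s :=
    (Finset.sum_le_sum fun j _ => (hzv j).2).trans hv1
  have h1N : 1 / (N : ℝ) ≤ 1 / 2 := by gcongr
  have hrb : l2 (b - a) ^ 2 ≤ Fintype.card ι := by
    rw [l2_sq]
    calc ∑ j, (b - a) j ^ 2 ≤ ∑ _j : ι, (1 : ℝ) := Finset.sum_le_sum fun j _ => by
          have := (hba j).1
          rw [Pi.sub_apply, sq_le_one_iff_abs_le_one, abs_sub_comm]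
          linarith
      _ = _ := by simp
  have hEb : E b ≤ L := by
    have h1 := hE a b
    have h2 : Q * l2 (b - a) ^ 2 ≤ Q * Fintype.card ι := by gcongr
    nlinarith
  have hz1 : 1 / 2 ≤ l2 z := by
    have := l2_add_le (v - z) z
    rw [sub_add_cancel, hv2] at this
    linarith
  have hz2 : l2 z ≤ 2 := by
    have h1 := l2_add_le v (z - v)
    have h2 : l2 (z - v) = l2 (v - z) := by
      rw [← neg_sub, ← neg_one_smul ℝ, l2_smul]; simp
    rw [add_sub_cancel, hv2, h2] at h1
    linarith
  have hgr : √κ₀ ≤ rms fun i => F i ⬝ᵥ b + U i ⬝ᵥ z :=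
    Real.sqrt_le_sqrt (hgrid b hb z hz hEb hz1 hz2)
  have hFba : rms (fun i => F i ⬝ᵥ (b - a)) ≤ Fintype.card ι * (A * (1 / N)) := by
    have h1 : (fun i => F i ⬝ᵥ (b - a)) = ∑ j, fun i => F i j * (b - a) j := by
      ext i; simp [dotProduct, Finset.sum_apply]
    rw [h1]
    refine (Finset.le_sum_of_subadditive rms (by simp [rms]) rms_add_le _ _).trans ?_
    calc _ ≤ ∑ _j : ι, A * (1 / N) := Finset.sum_le_sum fun j _ => by
          refine (hFc j _).trans ?_
          gcongr
          rw [Pi.sub_apply, abs_sub_comm]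
          exact (hba j).1
      _ = _ := by simp
  have hUvz : designSeminorm U (v - z) ≤ A * (5 / N) := by
    refine (hU _).trans ?_
    gcongr
    calc _ ≤ 1 / (N : ℝ) + 4 / N := add_le_add hrz (hl1 _ hrz1)
      _ = _ := by ring
  have hUzv : rms (fun i => U i ⬝ᵥ (z - v)) ≤ A * (5 / N) := by
    refine le_trans (le_of_eq ?_) hUvz
    rw [designSeminorm_apply, rms, rms]
    congr 2
    refine Finset.sum_congr rfl fun i _ => ?_
    rw [dotProduct_sub, dotProduct_sub]
    ring
  have htri2 : rms (fun i => F i ⬝ᵥ b + U i ⬝ᵥ z) ≤ (rms fun i => F i ⬝ᵥ a + U i ⬝ᵥ v)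
      + (rms (fun i => F i ⬝ᵥ (b - a)) + rms (fun i => U i ⬝ᵥ (z - v))) := by
    have h1 : (fun i => F i ⬝ᵥ b + U i ⬝ᵥ z) = (fun i => F i ⬝ᵥ a + U i ⬝ᵥ v)
        + ((fun i => F i ⬝ᵥ (b - a)) + fun i => U i ⬝ᵥ (z - v)) := by
      ext i
      simp only [Pi.add_apply, dotProduct_sub]
      ring
    rw [h1]
    exact (rms_add_le _ _).trans (add_le_add le_rfl (rms_add_le _ _))
  have hfin : Fintype.card ι * (A * (1 / N)) + A * (5 / N) ≤ √κ₀ / 2 := by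
    have h1 : Fintype.card ι * (A * (1 / N)) + A * (5 / N) = A * (Fintype.card ι + 5) / N := by
      field_simp
    rw [h1, div_le_iff₀ (by positivity)]
    linarith
  linarith

/-- The lower bound at a single lattice point `(b, z)`. The moment bounds for `U' z` come from
`U' (z / 2)`, since `l2 z ≤ 2`; the truncation level `B` is the one of `exists_truncation`. -/
lemma DesignCondition.measure_grid_le [IsProbabilityMeasure P] (hD : DesignCondition F U P q c)
    (hq : 0 < q) {B L : ℝ} (hB : 0 < B)
    (htrunc : ∀ {X Y : Ω → ℝ}, MemLp X 2 P → MemLp Y 2 P → Integrable (fun ω => Y ω ^ 4) P →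
      ∫ ω, X ω * Y ω ∂P = 0 → c / 4 ≤ ∫ ω, Y ω ^ 2 ∂P → ∫ ω, Y ω ^ 4 ∂P ≤ 64 / q ^ 2 →
      ∫ ω, (X ω + Y ω) ^ 2 ∂P ≤ 2 * L + 16 / q →
      c / 4 / 2 ≤ ∫ ω, min ((X ω + Y ω) ^ 2) (B ^ 2) ∂P) (hc : 0 ≤ c)
    {b : ι → ℝ} {z : J → ℝ} (hb : ∀ i, ∫ ω, (F i ω ⬝ᵥ b) ^ 2 ∂P ≤ L) (hz1 : 1 / 2 ≤ l2 z)
    (hz2 : l2 z ≤ 2) :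
    P {ω | (n : ℝ)⁻¹ * ∑ i, (F i ω ⬝ᵥ b + U i ω ⬝ᵥ z) ^ 2 < c / 32}
      ≤ ENNReal.ofReal (Real.exp (-(n * (c / (32 * B ^ 2))))) := by
  have h := measure_average_sq_lt_le (P := P) (Z := fun i ω => F i ω ⬝ᵥ b + U i ω ⬝ᵥ z) hB
    (m := c / 4 / 2)
    (hD.indep.comp (fun _ x => x.1 ⬝ᵥ b + x.2 ⬝ᵥ z) fun _ => by unfold dotProduct; fun_prop)
    (fun i => by
      have := hD.measurable_F i
      have := hD.measurable_U i
      unfold dotProduct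
      fun_prop) (fun i => ?_)
  · refine le_trans (le_of_eq ?_) (h.trans (le_of_eq ?_))
    · congr 3; ext; rw [show c / 4 / 2 / 4 = c / 32 by ring]
    · congr 4; field_simp; ring
  · have hY := hD.exp_U i ((1 / 2 : ℝ) • z) (by
      rw [l2_smul, abs_of_pos (by norm_num)]; linarith)
    have hY2 : ∀ ω, U i ω ⬝ᵥ z = 2 * (U i ω ⬝ᵥ ((1 / 2 : ℝ) • z)) := fun ω => by
      rw [dotProduct_smul, smul_eq_mul]; ring
    have hXL := hD.memLp_F hq i b
    have hYL : MemLp (fun ω => U i ω ⬝ᵥ z) 2 P := by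
      simp_rw [hY2]
      exact (hY.memLp_two hq).const_mul 2
    have hUcoord : ∀ j, MemLp (fun ω => U i ω j) 2 P := fun j => by
      classical
      simpa using (hD.exp_U i (Pi.single j 1) (l2_single_le j)).memLp_two hq
    have hFcoord : ∀ j, MemLp (fun ω => F i ω j) 2 P := fun j => by
      classical
      simpa using hD.memLp_F hq i (Pi.single j 1)
    have hcross : ∫ ω, (F i ω ⬝ᵥ b) * (U i ω ⬝ᵥ z) ∂P = 0 := by
      rw [integral_dotProduct_mul_dotProduct hFcoord hUcoord]
      simp [hD.uncorr]
    have hYsq : ∫ ω, (U i ω ⬝ᵥ z) ^ 2 ∂P ≤ 8 / q := by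
      simp_rw [hY2, mul_pow]
      rw [integral_const_mul]
      have := hY.integral_sq_le hq
      calc _ ≤ 2 ^ 2 * (2 / q) := by gcongr
        _ = _ := by ring
    refine htrunc hXL hYL ?_ hcross ?_ ?_ ?_
    · simp_rw [hY2, mul_pow]
      exact (hY.integrable_pow_four hq).const_mul _
    · refine le_trans ?_ (hD.lower_U i z)
      calc c / 4 = c * (1 / 2) ^ 2 := by ring
        _ ≤ _ := by gcongr
    · simp_rw [hY2, mul_pow]
      rw [integral_const_mul]
      have := hY.integral_pow_four_le hq
      calc _ ≤ 2 ^ 4 * (4 / q ^ 2) := by gcongr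
        _ = _ := by ring
    · have hpt : ∀ ω, (F i ω ⬝ᵥ b + U i ω ⬝ᵥ z) ^ 2
          ≤ 2 * (F i ω ⬝ᵥ b) ^ 2 + 2 * (U i ω ⬝ᵥ z) ^ 2 := fun ω => by
        nlinarith [sq_nonneg (F i ω ⬝ᵥ b - U i ω ⬝ᵥ z)]
      refine (integral_mono (hXL.add hYL).integrable_sq
        ((hXL.integrable_sq.const_mul 2).add (hYL.integrable_sq.const_mul 2)) hpt).trans ?_
      simp only [Pi.add_apply]
      rw [integral_add (hXL.integrable_sq.const_mul 2) (hYL.integrable_sq.const_mul 2),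
        integral_const_mul, integral_const_mul]
      have := hb i
      have : (16 : ℝ) / q = 2 * (8 / q) := by ring
      linarith

lemma exp_neg_le_inv {x : ℝ} (hx : 0 < x) : Real.exp (-x) ≤ 1 / x := by
  rw [Real.exp_neg, one_div]
  exact inv_anti₀ hx (by linarith [Real.add_one_le_exp x])

lemma exists_pos_mul_le (k R : ℕ) :
    ∃ η : ℝ, 0 < η ∧ η * k ≤ 1 / 2 ∧ η * k * (k * R ^ 2) ≤ 1 := by
  refine ⟨1 / (2 * (k + 1) * (k * R ^ 2 + 1)), by positivity, ?_, ?_⟩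
  · rw [div_mul_eq_mul_div, div_le_div_iff₀ (by positivity) (by positivity)]
    have : 0 ≤ (k : ℝ) * (k * R ^ 2) + k * R ^ 2 := by positivity
    linear_combination 2 * this
  · rw [div_mul_eq_mul_div, div_mul_eq_mul_div, div_le_one (by positivity)]
    have : 0 ≤ (k : ℝ) * (k * R ^ 2) + 2 * (k * R ^ 2) + 2 * k + 1 := by positivity
    linear_combination this

set_option maxHeartbeats 1000000 in
/-- **Restricted eigenvalue condition.** The covariates are `F_i' (T v) + U_i' v` in the
direction `v`, where the loadings satisfy `|T v| ≤ R |v|₁`. The exceptional probability is at most a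
constant multiple of `s log (2 p + 1) / n`. -/
theorem exists_restricted_eigenvalue (k R : ℕ) {q c : ℝ} (hq : 0 < q) (hc : 0 < c) :
    ∃ κ D ρ : ℝ, 0 < κ ∧ 0 ≤ D ∧ 0 < ρ ∧
      ∀ {ι J : Type} {Ω : Type*} [Fintype ι] [Fintype J] [MeasurableSpace Ω] {n : ℕ}
        {F : Fin n → Ω → ι → ℝ} {U : Fin n → Ω → J → ℝ} {P : Measure Ω} [IsProbabilityMeasure P],
        DesignCondition F U P q c → Fintype.card ι = k →
        ∀ {s : ℕ}, 1 ≤ s → s ≤ Fintype.card J →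
        s * Real.log (2 * Fintype.card J + 1) ≤ ρ * n →
        ∀ {T : (J → ℝ) → ι → ℝ}, (∀ (r : ℝ) v, T (r • v) = r • T v) →
        (∀ v j, 4 * |T v j| ≤ R * l1 v) →
        P {ω | ¬ ∀ v, l1 v ≤ 4 * √s * l2 v →
            κ * l2 v ^ 2 ≤ (n : ℝ)⁻¹ * ∑ i, (F i ω ⬝ᵥ T v + U i ω ⬝ᵥ v) ^ 2}
          ≤ ENNReal.ofReal (D * (s * Real.log (2 * Fintype.card J + 1) / n)) := by
  set A := 4 * √(3 / q) with hA
  have hA0 : 0 < A := by positivity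
  set Q := 2 / q with hQ
  set L := 144 * A ^ 2 + 4 + 2 * Q * k with hL
  obtain ⟨B, hB, htrunc⟩ := exists_truncation (c₀ := c / 4) (C₄ := 64 / q ^ 2)
    (G := 2 * L + 16 / q) (by positivity) (by positivity) (by positivity)
  set κ₀ := c / 32 with hκ₀
  have hκ0 : 0 < κ₀ := by positivity
  have hsκ : 0 < √κ₀ := Real.sqrt_pos.2 hκ0
  set a₀ := c / (32 * B ^ 2) with ha₀
  have ha0 : 0 < a₀ := by positivity
  set N : ℕ := max 2 ⌈2 * A * (k + 5) / √κ₀⌉₊ with hN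
  have hN2 : 2 ≤ N := le_max_left _ _
  have hNκ : 2 * A * (k + 5) ≤ N * √κ₀ := by
    rw [← div_le_iff₀ hsκ]
    exact (Nat.le_ceil _).trans (Nat.cast_le.2 (le_max_right _ _))
  obtain ⟨η, hη0, hη1, hη2⟩ := exists_pos_mul_le k R
  -- The lattice has at most `exp (E₁ s log (2 p + 1))` points.
  set E₁ : ℝ := k * R * N * Real.log (2 * k + 1) + 16 * N ^ 2 with hE₁
  have hlogk : 0 ≤ Real.log (2 * (k : ℝ) + 1) := Real.log_nonneg (by
    have : (0 : ℝ) ≤ k := by positivity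
    linarith)
  have hE0 : 0 < E₁ := by
    have : (0 : ℝ) < N := by exact_mod_cast (by omega : 0 < N)
    positivity
  set κ := min A (√κ₀ / 2) ^ 2 with hκ
  set D : ℝ := 1 + k + k ^ 2 * ((2 / q + 16 / q ^ 2) / η ^ 2) + 2 / a₀ with hDdef
  refine ⟨κ, D, min (1 / (2 * N ^ 2)) (a₀ / (2 * E₁)), by positivity, by positivity,
    by positivity, ?_⟩
  intro ι J Ω _ _ _ n F U P _ hD hk s hs hsJ hρ T hTs hT
  classical
  set p := Fintype.card J with hp
  set ℓ := Real.log (2 * (p : ℝ) + 1) with hℓdef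
  have hs' : (1 : ℝ) ≤ s := by exact_mod_cast hs
  have hsp : (s : ℝ) ≤ p := by exact_mod_cast hsJ
  have hℓ : 1 ≤ ℓ := by
    rw [hℓdef, Real.le_log_iff_exp_le (by positivity)]
    linarith [Real.exp_one_lt_d9]
  have hexpℓ : Real.exp ℓ = 2 * p + 1 := Real.exp_log (by positivity)
  have hsℓ1 : 1 ≤ s * ℓ := one_le_mul_of_one_le_of_one_le hs' hℓ
  have hn0 : (0 : ℝ) < n := by
    by_contra h
    have : (n : ℝ) = 0 := le_antisymm (not_lt.1 h) (by positivity)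
    rw [this, mul_zero] at hρ
    linarith
  have hn : 0 < n := by exact_mod_cast hn0
  set i₀ : Fin n := ⟨0, hn⟩
  have hρ1 : 2 * N ^ 2 * (s * ℓ) ≤ n := by
    have h1 : s * ℓ ≤ 1 / (2 * N ^ 2) * n :=
      hρ.trans (by gcongr; exact min_le_left _ _)
    rwa [div_mul_eq_mul_div, one_mul, le_div_iff₀' (by positivity)] at h1
  have hρ2 : E₁ * (s * ℓ) ≤ n * a₀ / 2 := by
    have h1 : s * ℓ ≤ a₀ / (2 * E₁) * n :=
      hρ.trans (by gcongr; exact min_le_right _ _)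
    rw [div_mul_eq_mul_div, le_div_iff₀' (by positivity)] at h1
    linarith
  have hindF : iIndepFun F P := hD.indep.comp (fun _ x => x.1) fun _ => measurable_fst
  have hindU : iIndepFun U P := hD.indep.comp (fun _ x => x.2) fun _ => measurable_snd
  set Ef : (ι → ℝ) → ℝ := fun a => ∫ ω, (F i₀ ω ⬝ᵥ a) ^ 2 ∂P with hEf
  set GR := (grid ι (1 / (N : ℝ)) (k * R * N * s) ×ˢ
    grid J (1 / (4 * √s * (N : ℝ) ^ 2)) (16 * s * N ^ 2)).filter
      fun y => Ef y.1 ≤ L ∧ 1 / 2 ≤ l2 y.2 ∧ l2 y.2 ≤ 2 with hGR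
  -- The exceptional events: `U` is too large on sparse vectors, a coordinate of `F` is too large,
  -- the second moments of `F` are inaccurate, the lower bound fails at a lattice point.
  set b₁ : Set Ω := {ω | ¬ ∀ v, designSeminorm (fun i => U i ω) v
    ≤ A * (l2 v + l1 v / √((N ^ 2 * s : ℕ) : ℝ))} with hb₁
  set b₂ : Set Ω := {ω | ∃ j ∈ (Finset.univ : Finset ι), ω ∈ {ω |
    √(3 / q) * l2 (Pi.single j (1 : ℝ))
      < designSeminorm (fun i => F i ω) (Pi.single j 1)}} with hb₂
  set b₃ : Set Ω := {ω | ¬ ∀ a, |(n : ℝ)⁻¹ * ∑ i, (F i ω ⬝ᵥ a) ^ 2 - Ef a|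
        ≤ η * k * (Ef a + l2 a ^ 2 / s)} with hb₃
  set b₄ : Set Ω := {ω | ∃ y ∈ GR,
    ω ∈ {ω | (n : ℝ)⁻¹ * ∑ i, (F i ω ⬝ᵥ y.1 + U i ω ⬝ᵥ y.2) ^ 2 < c / 32}} with hb₄
  have p₁ : P b₁ ≤ ENNReal.ofReal (Real.exp (-n)) :=
    measure_not_forall_designSeminorm_le hq hindU hD.measurable_U hD.exp_U
      (Nat.mul_pos (by positivity) hs) (by
        push_cast
        calc _ = 2 * N ^ 2 * (s * ℓ) := by ring
          _ ≤ _ := hρ1)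
  have p₂ : P b₂ ≤ ENNReal.ofReal (k * Real.exp (-(2 * n))) := by
    have := measure_exists_mem_le (P := P) (Finset.univ : Finset ι) fun j _ =>
      measure_lt_designSeminorm_le hq hindF hD.measurable_F hD.exp_F (Pi.single j 1)
    rwa [Finset.card_univ, hk] at this
  have p₃ : P b₃ ≤ ENNReal.ofReal ((k : ℝ) ^ 2 *
      ((2 / q + 16 / q ^ 2) * (s * ℓ) / (n * η ^ 2))) := by
    have := hD.measure_not_forall_second_moment_le hq i₀ hs hℓ
      (by rw [hexpℓ]; linarith) hη0
    rwa [hk] at this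
  have p₄ : P b₄ ≤ ENNReal.ofReal (Real.exp (-(n * a₀ / 2))) := by
    have := measure_exists_mem_le (P := P) GR fun y hy =>
      hD.measure_grid_le hq hB htrunc hc.le (b := y.1) (z := y.2)
        (fun i => (hD.integral_sq_eq i i₀ _).trans_le (Finset.mem_filter.1 hy).2.1)
        (Finset.mem_filter.1 hy).2.2.1 (Finset.mem_filter.1 hy).2.2.2
    refine this.trans (ENNReal.ofReal_le_ofReal ?_)
    have hcard : (GR.card : ℝ) ≤ Real.exp (n * a₀ / 2) := by
      have h1 : GR.card ≤ (2 * k + 1) ^ (k * R * N * s) * (2 * p + 1) ^ (16 * s * N ^ 2) := by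
        refine (Finset.card_filter_le _ _).trans ?_
        rw [Finset.card_product]
        refine Nat.mul_le_mul ?_ (card_grid_le _ _)
        rw [← hk]
        exact card_grid_le _ _
      calc (GR.card : ℝ) ≤ (((2 * k + 1) ^ (k * R * N * s) : ℕ) : ℝ)
            * (((2 * p + 1) ^ (16 * s * N ^ 2) : ℕ) : ℝ) := by exact_mod_cast h1
        _ = Real.exp (k * R * N * Real.log (2 * k + 1) * (s * 1) + 16 * N ^ 2 * (s * ℓ)) := by
            rw [two_mul_add_one_pow_eq_exp, two_mul_add_one_pow_eq_exp, ← Real.exp_add]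
            congr 1
            push_cast
            ring
        _ ≤ Real.exp (k * R * N * Real.log (2 * k + 1) * (s * ℓ) + 16 * N ^ 2 * (s * ℓ)) := by
            gcongr
        _ ≤ _ := by
            apply Real.exp_le_exp.2
            rw [← add_mul]
            exact hρ2
    calc _ ≤ Real.exp (n * a₀ / 2) * Real.exp (-(n * a₀)) := by gcongr
      _ = _ := by rw [← Real.exp_add]; congr 1; ring
  have hincl : {ω | ¬ ∀ v, l1 v ≤ 4 * √s * l2 v →
      κ * l2 v ^ 2 ≤ (n : ℝ)⁻¹ * ∑ i, (F i ω ⬝ᵥ T v + U i ω ⬝ᵥ v) ^ 2}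
      ⊆ (b₁ ∪ b₂) ∪ (b₃ ∪ b₄) := by
    intro ω hω
    by_contra hgood
    simp only [Set.mem_union, not_or] at hgood
    obtain ⟨⟨g₁, g₂⟩, g₃, g₄⟩ := hgood
    simp only [hb₁, hb₂, hb₃, hb₄, Set.mem_ofPred_eq, not_not, not_exists, not_and, not_lt,
      Finset.mem_univ, true_implies] at g₁ g₂ g₃ g₄
    apply hω
    have hunit : ∀ v, l2 v = 1 → l1 v ≤ 4 * √s →
        κ ≤ (n : ℝ)⁻¹ * ∑ i, (F i ω ⬝ᵥ T v + U i ω ⬝ᵥ v) ^ 2 := by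
      intro v hv2 hv1
      rw [← rms_sq]
      refine pow_le_pow_left₀ (by positivity) ?_ 2
      refine le_rms_add_of_grid (E := Ef) (Q := Q) (L := L) (N := N) (R := R) (s := s)
        hA0 (by positivity) hs hN2 (by rw [hk]; exact hNκ) g₁ (fun j r => ?_) (fun a ha => ?_)
        (fun a b => ?_) (by rw [hk]) (fun b hb z hz hbL hz1 hz2 => ?_) hv2 hv1 (fun j => ?_)
      · have h1 := g₂ j
        have h2 : l2 (Pi.single j (1 : ℝ) : ι → ℝ) = 1 := by
          simp [l2, Pi.single_apply]
        rw [h2, mul_one, designSeminorm_apply] at h1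
        simp only [dotProduct_single, mul_one] at h1
        have h3 : (fun i => F i ω j * r) = r • fun i => F i ω j := by
          ext i; simp [mul_comm]
        rw [h3, rms_smul, mul_comm]
        gcongr
        exact h1.trans (by rw [hA]; linarith [Real.sqrt_nonneg (3 / q)])
      · have h1 := g₃ a
        have h2 : l2 a ^ 2 / s ≤ k * R ^ 2 := by
          rw [div_le_iff₀ (by positivity), l2_sq]
          calc ∑ j, a j ^ 2 ≤ ∑ _j : ι, (R * √s) ^ 2 := Finset.sum_le_sum fun j _ => by
                rw [← sq_abs]; gcongr; exact ha j
            _ = k * (R * √s) ^ 2 := by simp [hk]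
            _ = _ := by rw [mul_pow, Real.sq_sqrt (by positivity)]; ring
        have h5 : 0 ≤ Ef a := integral_nonneg fun _ => sq_nonneg _
        rw [designSeminorm_sq]
        have h6 : η * k * (Ef a + l2 a ^ 2 / s) ≤ 1 / 2 * Ef a + 1 := by
          rw [mul_add]
          refine add_le_add (mul_le_mul_of_nonneg_right hη1 h5)
            ((mul_le_mul_of_nonneg_left h2 (by positivity)).trans hη2)
        have h7 := (abs_le.1 (h1.trans h6)).1
        linarith
      · have hb : ∀ ω, (F i₀ ω ⬝ᵥ b) ^ 2
            ≤ 2 * (F i₀ ω ⬝ᵥ a) ^ 2 + 2 * (F i₀ ω ⬝ᵥ (b - a)) ^ 2 := fun ω => by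
          rw [dotProduct_sub]
          nlinarith [sq_nonneg (F i₀ ω ⬝ᵥ a - (F i₀ ω ⬝ᵥ b - F i₀ ω ⬝ᵥ a))]
        have i1 := (hD.memLp_F hq i₀ a).integrable_sq.const_mul 2
        have i2 := (hD.memLp_F hq i₀ (b - a)).integrable_sq.const_mul 2
        refine (integral_mono (hD.memLp_F hq i₀ b).integrable_sq (i1.add i2) hb).trans ?_
        simp only [Pi.add_apply]
        rw [integral_add i1 i2, integral_const_mul, integral_const_mul]
        have := hD.integral_sq_F_le hq i₀ (b - a)
        linarith
      · rw [hk] at hb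
        exact g₄ (b, z) (Finset.mem_filter.2
          ⟨Finset.mem_product.2 ⟨hb, hz⟩, hbL, hz1, hz2⟩)
      · have := hT v j
        have h1 : (R : ℝ) * l1 v ≤ R * (4 * √s) := by gcongr
        linarith
    intro v hv
    rcases (l2_nonneg v).eq_or_lt with h0 | h0
    · rw [← h0]
      have : 0 ≤ (n : ℝ)⁻¹ * ∑ i, (F i ω ⬝ᵥ T v + U i ω ⬝ᵥ v) ^ 2 := by positivity
      simpa using this
    · have h1 := hunit ((l2 v)⁻¹ • v)
        (by rw [l2_smul, abs_of_pos (inv_pos.2 h0), inv_mul_cancel₀ h0.ne'])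
        (by rw [l1_smul, abs_of_pos (inv_pos.2 h0), inv_mul_le_iff₀ h0]; linarith)
      have h2 : ∀ i, (F i ω ⬝ᵥ T ((l2 v)⁻¹ • v) + U i ω ⬝ᵥ ((l2 v)⁻¹ • v)) ^ 2
          = (l2 v ^ 2)⁻¹ * (F i ω ⬝ᵥ T v + U i ω ⬝ᵥ v) ^ 2 := fun i => by
        rw [hTs, dotProduct_smul, dotProduct_smul, smul_eq_mul, smul_eq_mul, ← mul_add, mul_pow,
          inv_pow]
      simp_rw [h2] at h1
      rw [← Finset.mul_sum, mul_left_comm, le_inv_mul_iff₀ (by positivity)] at h1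
      linarith
  refine (measure_mono hincl).trans ?_
  refine (measure_union_le _ _).trans ((add_le_add (measure_union_le _ _)
    (measure_union_le _ _)).trans ?_)
  refine (add_le_add (add_le_add p₁ p₂) (add_le_add p₃ p₄)).trans ?_
  rw [← ENNReal.ofReal_add (by positivity) (by positivity),
    ← ENNReal.ofReal_add (by positivity) (by positivity),
    ← ENNReal.ofReal_add (by positivity) (by positivity)]
  apply ENNReal.ofReal_le_ofReal
  have hinv : 1 / (n : ℝ) ≤ s * ℓ / n := by gcongr
  have e1 : Real.exp (-n) ≤ s * ℓ / n := (exp_neg_le_inv hn0).trans hinv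
  have e2 : k * Real.exp (-(2 * n)) ≤ k * (s * ℓ / n) := by
    gcongr
    refine le_trans ?_ e1
    apply Real.exp_le_exp.2
    linarith
  have e4 : Real.exp (-(n * a₀ / 2)) ≤ 2 / a₀ * (s * ℓ / n) := by
    refine (exp_neg_le_inv (by positivity)).trans ?_
    calc 1 / (n * a₀ / 2) = 2 / a₀ * (1 / n) := by field_simp
      _ ≤ _ := by gcongr
  have e3 : (k : ℝ) ^ 2 * ((2 / q + 16 / q ^ 2) * (s * ℓ) / (n * η ^ 2))
      = k ^ 2 * ((2 / q + 16 / q ^ 2) / η ^ 2) * (s * ℓ / n) := by field_simp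
  rw [e3, hDdef]
  linarith

end Design

/-! ### The Lasso under a restricted eigenvalue condition -/

section Lasso

variable {ι : Type*} [Fintype ι] {n : ℕ}

/-- The basic inequality of the Lasso and its consequence for the residual variance. Either the
penalty dominates the noise, which confines the error to a cone, or `S` is the set of all
coordinates and nothing has to be shown. -/
lemma abs_residualVariance_sub_le {x : Fin n → ι → ℝ} {ε : Fin n → ℝ} {β b : ι → ℝ}
    {lam Λ κ : ℝ} {S : Finset ι} (hlam : 0 ≤ lam) (hΛ : 0 ≤ Λ) (hκ : 0 < κ)
    (hS : ∀ j ∉ S, β j = 0) (hnoise : ∀ j, |(n : ℝ)⁻¹ * ∑ i, x i j * ε i| ≤ Λ)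
    (hcase : S = Finset.univ ∨ (2 * Λ ≤ lam ∧ 0 < lam))
    (hRE : ∀ v, l1 v ≤ 4 * √S.card * l2 v → κ * l2 v ^ 2 ≤ (n : ℝ)⁻¹ * ∑ i, (x i ⬝ᵥ v) ^ 2)
    (hb : IsLasso x (fun i => x i ⬝ᵥ β + ε i) lam b) :
    |residualVariance x (fun i => x i ⬝ᵥ β + ε i) b - (n : ℝ)⁻¹ * ∑ i, ε i ^ 2|
      ≤ 128 / κ * (S.card * (Λ + lam) ^ 2) := by
  classical
  set v := b - β with hv
  set G := (n : ℝ)⁻¹ * ∑ i, (x i ⬝ᵥ v) ^ 2 with hG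
  set H := (n : ℝ)⁻¹ * ∑ i, ε i * (x i ⬝ᵥ v) with hH
  have hG0 : 0 ≤ G := by positivity
  have hres : ∀ i, x i ⬝ᵥ β + ε i - x i ⬝ᵥ b = ε i - x i ⬝ᵥ v := fun i => by
    rw [hv, dotProduct_sub]; ring
  have hRV : residualVariance x (fun i => x i ⬝ᵥ β + ε i) b
      = (n : ℝ)⁻¹ * ∑ i, ε i ^ 2 - 2 * H + G := by
    have h1 : ∑ i, (x i ⬝ᵥ β + ε i - x i ⬝ᵥ b) ^ 2
        = ∑ i, ε i ^ 2 - 2 * ∑ i, ε i * (x i ⬝ᵥ v) + ∑ i, (x i ⬝ᵥ v) ^ 2 := by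
      rw [Finset.mul_sum, ← Finset.sum_sub_distrib, ← Finset.sum_add_distrib]
      refine Finset.sum_congr rfl fun i _ => ?_
      rw [hres]
      ring
    rw [residualVariance, h1, hH, hG]
    ring
  have hbasic : G / 2 - H + lam * (l1 b - l1 β) ≤ 0 := by
    have h1 := hb β
    have h2 : lassoObjective x (fun i => x i ⬝ᵥ β + ε i) lam b
        = residualVariance x (fun i => x i ⬝ᵥ β + ε i) b / 2 + lam * l1 b := by
      rw [lassoObjective, residualVariance, l1, mul_inv]
      ring
    have h3 : lassoObjective x (fun i => x i ⬝ᵥ β + ε i) lam β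
        = ((n : ℝ)⁻¹ * ∑ i, ε i ^ 2) / 2 + lam * l1 β := by
      rw [lassoObjective, l1, mul_inv]
      simp only [add_sub_cancel_left]
      ring
    rw [h2, h3, hRV] at h1
    linarith
  have hHle : |H| ≤ Λ * l1 v := by
    have h1 : H = (fun j => (n : ℝ)⁻¹ * ∑ i, x i j * ε i) ⬝ᵥ v := by
      simp only [hH, dotProduct, Finset.mul_sum, Finset.sum_mul]
      rw [Finset.sum_comm]
      exact Finset.sum_congr rfl fun j _ => Finset.sum_congr rfl fun i _ => by ring
    rw [h1]
    exact abs_dotProduct_le hnoise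
  have hl1 : l1 β - l1 b ≤ l1 v := by
    rw [l1, l1, l1, ← Finset.sum_sub_distrib]
    refine Finset.sum_le_sum fun j _ => ?_
    rw [hv, Pi.sub_apply, abs_sub_comm]
    exact abs_sub_abs_le_abs_sub _ _
  have hG1 : G ≤ 2 * (Λ + lam) * l1 v := by
    have h1 := le_abs_self H
    have h2 : lam * (l1 β - l1 b) ≤ lam * l1 v := by gcongr
    linarith
  have hcone : l1 v ≤ 4 * √S.card * l2 v := by
    rcases hcase with rfl | ⟨h2Λ, hlam0⟩
    · have h1 := sum_abs_le_sqrt_card_mul_l2 Finset.univ v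
      have h2 : 0 ≤ √((Finset.univ : Finset ι).card : ℝ) * l2 v :=
        mul_nonneg (Real.sqrt_nonneg _) (l2_nonneg v)
      rw [l1]
      linarith
    · set p := ∑ j ∈ S, |v j| with hp
      set d := ∑ j ∈ Sᶜ, |v j| with hd
      have hpd : l1 v = p + d := (Finset.sum_add_sum_compl S _).symm
      have h1 : l1 β - l1 b ≤ p - d := by
        rw [l1, l1, ← Finset.sum_sub_distrib, ← Finset.sum_add_sum_compl S, sub_eq_add_neg,
          ← Finset.sum_neg_distrib]
        refine add_le_add (Finset.sum_le_sum fun j _ => ?_) (Finset.sum_le_sum fun j hj => ?_)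
        · rw [hv, Pi.sub_apply, abs_sub_comm]
          exact abs_sub_abs_le_abs_sub _ _
        · rw [hv, Pi.sub_apply, hS j (Finset.mem_compl.1 hj)]
          simp
      have h2 : lam * (l1 β - l1 b) ≤ lam * (p - d) := by gcongr
      have h3 : Λ * l1 v ≤ lam / 2 * (p + d) := by
        rw [← hpd]
        exact mul_le_mul_of_nonneg_right (by linarith) (l1_nonneg v)
      have h4 := le_abs_self H
      have h5 : 0 ≤ lam * (3 * p - d) := by linarith
      have h6 : d ≤ 3 * p := by
        have := nonneg_of_mul_nonneg_right h5 hlam0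
        linarith
      have h7 := sum_abs_le_sqrt_card_mul_l2 S v
      rw [hpd]
      linarith
  have hre := hRE v hcone
  set r := Λ + lam with hr
  have hr0 : 0 ≤ r := add_nonneg hΛ hlam
  have hss : √(S.card : ℝ) * √(S.card : ℝ) = S.card := Real.mul_self_sqrt (by positivity)
  have hl2 : κ * l2 v ≤ 8 * r * √S.card := by
    rcases (l2_nonneg v).eq_or_lt with h0 | h0
    · rw [← h0, mul_zero]; positivity
    · refine le_of_mul_le_mul_right ?_ h0
      calc κ * l2 v * l2 v = κ * l2 v ^ 2 := by ring
        _ ≤ 2 * r * l1 v := hre.trans hG1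
        _ ≤ 2 * r * (4 * √S.card * l2 v) := by gcongr
        _ = _ := by ring
  have hl1v : κ * l1 v ≤ 32 * (r * S.card) := by
    calc κ * l1 v ≤ κ * (4 * √S.card * l2 v) := by gcongr
      _ = 4 * √S.card * (κ * l2 v) := by ring
      _ ≤ 4 * √S.card * (8 * r * √S.card) := by gcongr
      _ = 32 * (r * (√S.card * √S.card)) := by ring
      _ = _ := by rw [hss]
  have hfin : |residualVariance x (fun i => x i ⬝ᵥ β + ε i) b - (n : ℝ)⁻¹ * ∑ i, ε i ^ 2|
      ≤ 4 * r * l1 v := by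
    rw [hRV]
    have h1 : (n : ℝ)⁻¹ * ∑ i, ε i ^ 2 - 2 * H + G - (n : ℝ)⁻¹ * ∑ i, ε i ^ 2 = G - 2 * H := by
      ring
    rw [h1]
    have h2 : Λ * l1 v ≤ r * l1 v := mul_le_mul_of_nonneg_right (by linarith) (l1_nonneg v)
    have h3 := abs_le.1 hHle
    rw [abs_le]
    constructor <;> linarith
  refine hfin.trans ?_
  rw [div_mul_eq_mul_div, le_div_iff₀ hκ]
  calc 4 * r * l1 v * κ = 4 * r * (κ * l1 v) := by ring
    _ ≤ 4 * r * (32 * (r * S.card)) := by gcongr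
    _ = _ := by ring

end Lasso

/-! ### Correlation of the covariates with the errors -/

section Noise

variable {ι Ω : Type*} [Fintype ι] [MeasurableSpace Ω] {n : ℕ} {P : Measure Ω}
  [IsProbabilityMeasure P] {X : Fin n → Ω → ι → ℝ} {ε : Fin n → Ω → ℝ} {q : ℝ}

/-- Chebyshev bound for the maximal correlation, useful for few covariates. -/
lemma measure_exists_le_abs_average_mul_le (hq : 0 < q)
    (hind : iIndepFun (fun i ω => (X i ω, ε i ω)) P)
    (hX : ∀ i j, ExpSqMoment (fun ω => X i ω j) q P) (hε : ∀ i, ExpSqMoment (ε i) q P)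
    (h0 : ∀ i j, ∫ ω, X i ω j * ε i ω ∂P = 0) {η : ℝ} (hη : 0 < η) :
    P {ω | ¬ ∀ j, |(n : ℝ)⁻¹ * ∑ i, X i ω j * ε i ω| ≤ η}
      ≤ ENNReal.ofReal (Fintype.card ι * (4 / q ^ 2 / (n * η ^ 2))) := by
  have h := measure_exists_mem_le (P := P) (Finset.univ : Finset ι)
    (B := fun j => {ω | η ≤ |(n : ℝ)⁻¹ * ∑ i, X i ω j * ε i ω|}) (b := 4 / q ^ 2 / (n * η ^ 2))
    fun j _ => measure_le_abs_average_le (W := fun i ω => X i ω j * ε i ω)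
      (hind.comp (fun _ z => z.1 j * z.2) fun _ => by fun_prop)
      (fun i => (memLp_two_iff_integrable_sq (by
        have := (hX i j).aesm; have := (hε i).aesm; fun_prop)).2
          ((hX i j).integrable_mul_sq (hε i) hq)) (fun i => h0 i j) (fun i => by
        have i1 := (hX i j).integrable_pow_four hq
        have i2 := (hε i).integrable_pow_four hq
        have hpt : ∀ ω, (X i ω j * ε i ω) ^ 2 ≤ 1 / 2 * (X i ω j ^ 4 + ε i ω ^ 4) := fun ω => by
          nlinarith [sq_nonneg (X i ω j ^ 2 - ε i ω ^ 2)]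
        refine (integral_mono ((hX i j).integrable_mul_sq (hε i) hq)
          ((i1.add i2).const_mul (1 / 2)) hpt).trans ?_
        rw [integral_const_mul]
        simp only [Pi.add_apply]
        rw [integral_add i1 i2]
        linarith [(hX i j).integral_pow_four_le hq, (hε i).integral_pow_four_le hq]) hη
  refine (measure_mono fun ω hω => ?_).trans h
  simp only [Set.mem_ofPred_eq, not_forall, not_le, Finset.mem_univ, true_and] at hω ⊢
  obtain ⟨j, hj⟩ := hω
  exact ⟨j, hj.le⟩

/-- Bernstein bound for the maximal correlation when `log p ≤ n`. -/
lemma measure_noise_le_of_log_le (hq : 0 < q) (hn : 0 < n) (hp : 0 < Fintype.card ι)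
    (hlog : Real.log (Fintype.card ι) ≤ n) (hind : iIndepFun (fun i ω => (X i ω, ε i ω)) P)
    (hXm : ∀ i, Measurable (X i)) (hεm : ∀ i, Measurable (ε i))
    (hX : ∀ i j, ExpSqMoment (fun ω => X i ω j) q P) (hε : ∀ i, ExpSqMoment (ε i) q P)
    (h0 : ∀ i j, ∫ ω, X i ω j * ε i ω ∂P = 0) :
    P {ω | ¬ ∀ j, |(n : ℝ)⁻¹ * ∑ i, X i ω j * ε i ω|
        ≤ 12 / q * √(Real.log (Fintype.card ι) / n)}
      ≤ ENNReal.ofReal (2 / Fintype.card ι) := by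
  set p := Fintype.card ι
  have hp' : (1 : ℝ) ≤ p := by exact_mod_cast hp
  have hn' : (0 : ℝ) < n := by exact_mod_cast hn
  have hlog0 : 0 ≤ Real.log p := Real.log_nonneg hp'
  set τ := √(Real.log p / n) with hτ
  have hτ2 : n * τ ^ 2 = Real.log p := by
    rw [hτ, Real.sq_sqrt (by positivity)]; field_simp
  have hτ1 : τ ≤ 1 := Real.sqrt_le_one.2 (by rwa [div_le_one hn'])
  have hτ0 : 0 ≤ τ := Real.sqrt_nonneg _
  have key : ∀ (σ : ℝ), |σ| = 1 → ∀ j,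
      P {ω | n * (6 * τ ^ 2) ≤ ∑ i, σ * (q / 2 * τ) * (X i ω j * ε i ω)}
        ≤ ENNReal.ofReal (Real.exp (-(2 * Real.log p))) := by
    intro σ hσ j
    have hexp := fun i => (hX i j).exp_mul_mul_le (hε i) hq (h0 i j) (t := σ * (q / 2 * τ)) (by
      rw [abs_mul, hσ, one_mul, abs_of_nonneg (by positivity)]
      nlinarith)
    have hσ2 : σ ^ 2 = 1 := by rw [← sq_abs, hσ, one_pow]
    have e : 16 * (σ * (q / 2 * τ)) ^ 2 / q ^ 2 = 4 * τ ^ 2 := by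
      rw [mul_pow, hσ2]; field_simp; ring
    rw [e] at hexp
    refine (measure_le_sum_le_of_integral_exp_le
      (W := fun i ω => σ * (q / 2 * τ) * (X i ω j * ε i ω))
      (hind.comp (fun _ z => σ * (q / 2 * τ) * (z.1 j * z.2)) fun _ => by fun_prop)
      (fun i => by have := hXm i; have := hεm i; fun_prop) (fun i => (hexp i).1)
      (fun i => (hexp i).2) (6 * τ ^ 2)).trans (le_of_eq ?_)
    congr 2
    rw [← hτ2]
    ring
  have hu := fun σ hσ => measure_exists_mem_le (P := P) (Finset.univ : Finset ι)
    fun j _ => key σ hσ j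
  refine (measure_mono (t := _ ∪ _) fun ω hω => ?_).trans ((measure_union_le _ _).trans
    ((add_le_add (hu 1 (by simp)) (hu (-1) (by simp))).trans ?_))
  · simp only [Set.mem_ofPred_eq, not_forall, not_le, Set.mem_union, Finset.mem_univ,
      true_and] at hω ⊢
    obtain ⟨j, hj⟩ := hω
    simp only [← Finset.mul_sum]
    set m := ∑ i, X i ω j * ε i ω
    rw [abs_mul, abs_of_pos (inv_pos.2 hn'), lt_inv_mul_iff₀ hn'] at hj
    have h1 : n * (6 * τ ^ 2) ≤ q / 2 * τ * |m| := by
      calc n * (6 * τ ^ 2) = q / 2 * τ * (n * (12 / q * τ)) := by field_simp; ring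
        _ ≤ _ := by gcongr
    rcases abs_choice m with h | h <;> rw [h] at h1
    · exact Or.inl ⟨j, by linarith⟩
    · exact Or.inr ⟨j, by linarith⟩
  · rw [← ENNReal.ofReal_add (by positivity) (by positivity)]
    apply ENNReal.ofReal_le_ofReal
    have h2 : Real.exp (-(2 * Real.log p)) = 1 / (p : ℝ) ^ 2 := by
      rw [Real.exp_neg, show 2 * Real.log p = ((2 : ℕ) : ℝ) * Real.log p by norm_num,
        Real.exp_nat_mul, Real.exp_log (by linarith), one_div]
    rw [h2, Finset.card_univ]
    refine le_of_eq ?_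
    field_simp
    ring

/-- For `n < log p` the Cauchy–Schwarz inequality suffices, because the empirical second moments of
the covariates are then of order `log p / n`. -/
lemma measure_noise_le_of_lt_log (hq : 0 < q) (hn : 0 < n) (hp : 0 < Fintype.card ι)
    (hlog : n < Real.log (Fintype.card ι)) (hind : iIndepFun (fun i ω => (X i ω, ε i ω)) P)
    (hXm : ∀ i, Measurable (X i)) (hεm : ∀ i, Measurable (ε i))
    (hX : ∀ i j, ExpSqMoment (fun ω => X i ω j) q P) (hε : ∀ i, ExpSqMoment (ε i) q P) :
    P {ω | ¬ ∀ j, |(n : ℝ)⁻¹ * ∑ i, X i ω j * ε i ω|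
        ≤ 12 / q * √(Real.log (Fintype.card ι) / n)}
      ≤ ENNReal.ofReal (1 / Fintype.card ι + 1 / n) := by
  set p := Fintype.card ι
  have hp' : (1 : ℝ) ≤ p := by exact_mod_cast hp
  have hn' : (0 : ℝ) < n := by exact_mod_cast hn
  have hlog0 : 0 ≤ Real.log p := Real.log_nonneg hp'
  set τ := √(Real.log p / n) with hτ
  have hτ2 : τ ^ 2 = Real.log p / n := Real.sq_sqrt (by positivity)
  have hτ0 : 0 ≤ τ := Real.sqrt_nonneg _
  have p1 := measure_exists_mem_le (P := P) (Finset.univ : Finset ι)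
    (B := fun j => {ω | 3 / q * τ ^ 2 < (n : ℝ)⁻¹ * ∑ i, X i ω j ^ 2})
    (b := 1 / (p : ℝ) ^ 2) fun j _ => by
      refine (measure_lt_average_sq_le hq.le (hind.comp (fun _ z => z.1 j) fun _ => by fun_prop)
        (fun i => by have := hXm i; fun_prop) (fun i => hX i j)).trans
        (ENNReal.ofReal_le_ofReal ?_)
      have h2 : 1 / (p : ℝ) ^ 2 = Real.exp (-(2 * Real.log p)) := by
        rw [Real.exp_neg, show 2 * Real.log p = ((2 : ℕ) : ℝ) * Real.log p by norm_num,
          Real.exp_nat_mul, Real.exp_log (by linarith), one_div]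
      rw [h2]
      apply Real.exp_le_exp.2
      have : n * (1 - q * (3 / q * τ ^ 2)) = n - 3 * Real.log p := by
        rw [hτ2]; field_simp
      linarith
  have p2 := measure_lt_average_sq_le (r := 3 / q) hq.le
    (hind.comp (fun _ z => z.2) fun _ => measurable_snd) hεm hε
  refine (measure_mono (t := _ ∪ _) fun ω hω => ?_).trans ((measure_union_le _ _).trans
    ((add_le_add p1 p2).trans ?_))
  · simp only [Set.mem_ofPred_eq, Set.mem_union, Finset.mem_univ, true_and] at hω ⊢
    contrapose! hω
    obtain ⟨h1, h2⟩ := hω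
    intro j
    have h1j := h1 j
    set a := ∑ i, X i ω j ^ 2
    set b := ∑ i, ε i ω ^ 2
    have ha : 0 ≤ a := Finset.sum_nonneg fun _ _ => sq_nonneg _
    have hb : 0 ≤ b := Finset.sum_nonneg fun _ _ => sq_nonneg _
    have hb' : (n : ℝ)⁻¹ * b ≤ 3 / q := h2
    have hcs : (∑ i, X i ω j * ε i ω) ^ 2 ≤ a * b := Finset.sum_mul_sq_le_sq_mul_sq _ _ _
    have h3 : |(n : ℝ)⁻¹ * ∑ i, X i ω j * ε i ω| ≤ 3 / q * τ := by
      apply abs_le_of_sq_le_sq _ (by positivity)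
      calc ((n : ℝ)⁻¹ * ∑ i, X i ω j * ε i ω) ^ 2 = (n : ℝ)⁻¹ ^ 2 * (∑ i, X i ω j * ε i ω) ^ 2 :=
            by ring
        _ ≤ (n : ℝ)⁻¹ ^ 2 * (a * b) := by gcongr
        _ = ((n : ℝ)⁻¹ * a) * ((n : ℝ)⁻¹ * b) := by ring
        _ ≤ (3 / q * τ ^ 2) * (3 / q) := by gcongr
        _ = _ := by ring
    refine h3.trans ?_
    gcongr
    norm_num
  · rw [← ENNReal.ofReal_add (by positivity) (by positivity)]
    apply ENNReal.ofReal_le_ofReal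
    rw [Finset.card_univ]
    have h2 : Real.exp (n * (1 - q * (3 / q))) ≤ 1 / n := by
      refine le_trans ?_ (exp_neg_le_inv hn')
      apply Real.exp_le_exp.2
      rw [mul_div_cancel₀ _ hq.ne']
      linarith
    refine add_le_add (le_of_eq ?_) h2
    field_simp
    rfl

/-- The maximal correlation with the errors is of order `√(log p / n)`, without any restriction on
the size of `p`, with a probability that is close to `1` if `p` and `n` are large. -/
lemma measure_noise_le (hq : 0 < q) (hn : 0 < n) (hp : 0 < Fintype.card ι)
    (hind : iIndepFun (fun i ω => (X i ω, ε i ω)) P)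
    (hXm : ∀ i, Measurable (X i)) (hεm : ∀ i, Measurable (ε i))
    (hX : ∀ i j, ExpSqMoment (fun ω => X i ω j) q P) (hε : ∀ i, ExpSqMoment (ε i) q P)
    (h0 : ∀ i j, ∫ ω, X i ω j * ε i ω ∂P = 0) :
    P {ω | ¬ ∀ j, |(n : ℝ)⁻¹ * ∑ i, X i ω j * ε i ω|
        ≤ 12 / q * √(Real.log (Fintype.card ι) / n)}
      ≤ ENNReal.ofReal (2 / Fintype.card ι + 1 / n) := by
  rcases le_or_gt (Real.log (Fintype.card ι)) n with h | h
  · refine (measure_noise_le_of_log_le hq hn hp h hind hXm hεm hX hε h0).trans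
      (ENNReal.ofReal_le_ofReal ?_)
    have : 0 ≤ 1 / (n : ℝ) := by positivity
    linarith
  · refine (measure_noise_le_of_lt_log hq hn hp h hind hXm hεm hX hε).trans
      (ENNReal.ofReal_le_ofReal ?_)
    gcongr
    norm_num

/-- Chebyshev bound for the average of the squared errors. -/
lemma measure_average_sq_sub_le (hq : 0 < q) (hind : iIndepFun ε P)
    (hε : ∀ i, ExpSqMoment (ε i) q P) {σ2 : ℝ}
    (hσ : ∀ i, ∫ ω, ε i ω ^ 2 ∂P = σ2) {δ : ℝ} (hδ : 0 < δ) (hn : 0 < n) :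
    P {ω | δ ≤ |(n : ℝ)⁻¹ * ∑ i, ε i ω ^ 2 - σ2|}
      ≤ ENNReal.ofReal (4 / q ^ 2 / (n * δ ^ 2)) := by
  have hn' : (n : ℝ) ≠ 0 := by positivity
  have hL : ∀ i, MemLp (fun ω => ε i ω ^ 2) 2 P := fun i =>
    (memLp_two_iff_integrable_sq (by have := (hε i).aesm; fun_prop)).2 (by
      simp_rw [← pow_mul]
      exact (hε i).integrable_pow_four hq)
  have h := measure_le_abs_average_le (P := P) (W := fun i ω => ε i ω ^ 2 - σ2)
    (V := 4 / q ^ 2) (hind.comp (fun _ z => z ^ 2 - σ2) fun _ => by fun_prop)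
    (fun i => (hL i).sub (memLp_const _)) (fun i => by
      rw [integral_sub ((hε i).integrable_sq hq) (integrable_const _), hσ]
      simp) (fun i => by
      have hv := variance_eq_integral (μ := P) (X := fun ω => ε i ω ^ 2) (hL i).aemeasurable
      rw [hσ] at hv
      rw [← hv]
      refine (variance_le_expectation_sq (hL i).1).trans ?_
      refine le_trans (le_of_eq ?_) ((hε i).integral_pow_four_le hq)
      congr 1
      ext ω
      simp only [Pi.pow_apply]
      ring) hδ
  refine le_trans (le_of_eq ?_) h
  congr 2
  ext ω
  rw [Finset.sum_sub_distrib, mul_sub]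
  simp only [Finset.sum_const, Finset.card_univ, Fintype.card_fin, nsmul_eq_mul]
  rw [inv_mul_cancel_left₀ hn']

end Noise

/-! ### The factor regression model -/

namespace Model

variable {M n : ℕ} {p K : Fin M → ℕ} {Ω : Type*}

/-- The loadings of all modalities, applied to a vector of coefficients. -/
def loadingsApply (D : Model p K n Ω) (v : Coord p → ℝ) : Coord K → ℝ :=
  fun a => ∑ j, D.Λ a.1 j a.2 * v ⟨a.1, j⟩

lemma x_dotProduct (D : Model p K n Ω) (i : Fin n) (ω : Ω) (v : Coord p → ℝ) :
    D.x i ω ⬝ᵥ v = D.f i ω ⬝ᵥ D.loadingsApply v + D.u i ω ⬝ᵥ v := by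
  simp only [dotProduct, x, loadingsApply, add_mul, Finset.sum_add_distrib, Finset.sum_mul,
    Finset.mul_sum]
  congr 1
  rw [Fintype.sum_sigma, Fintype.sum_sigma]
  refine Finset.sum_congr rfl fun m _ => ?_
  have hcomm := Finset.sum_comm (s := (Finset.univ : Finset (Fin (p m)))) (t := Finset.univ)
    (f := fun j k => D.Λ m j k * D.f i ω ⟨m, k⟩ * v ⟨m, j⟩)
  refine hcomm.trans ?_
  exact Finset.sum_congr rfl fun k _ => Finset.sum_congr rfl fun j _ => by ring

lemma abs_loadingsApply_le (D : Model p K n Ω) {C : ℝ} (hC : 0 ≤ C)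
    (h : ∀ m j k, |D.Λ m j k| ≤ C) (v : Coord p → ℝ) (a : Coord K) :
    |D.loadingsApply v a| ≤ C * l1 v := by
  calc |D.loadingsApply v a| ≤ ∑ j, C * |v ⟨a.1, j⟩| :=
        (Finset.abs_sum_le_sum_abs _ _).trans (Finset.sum_le_sum fun j _ => by
          rw [abs_mul]; gcongr; exact h _ _ _)
    _ ≤ ∑ m, ∑ j, C * |v ⟨m, j⟩| :=
        Finset.single_le_sum (f := fun m => ∑ j, C * |v ⟨m, j⟩|)
          (fun m _ => Finset.sum_nonneg fun j _ => by positivity) (Finset.mem_univ a.1)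
    _ = C * l1 v := by rw [l1, Fintype.sum_sigma, Finset.mul_sum]; simp_rw [Finset.mul_sum]

variable [MeasurableSpace Ω]

/-- Stacking modalities: if each block of a random vector is sub-Gaussian, so is the whole vector,
whatever the dependence between the blocks. -/
lemma expSqMoment_dotProduct {d : Fin M → ℕ} {P : Measure Ω} [IsProbabilityMeasure P]
    {X : Ω → Coord d → ℝ} {C : ℝ≥0} {q : ℝ} (hq : 0 ≤ q) (hqC : 4 * q * (M * C) ≤ 1)
    (h : ∀ m (α : Fin (d m) → ℝ), HasSubgaussianMGF (fun ω => ∑ j, α j * X ω ⟨m, j⟩)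
      (C * ∑ j, ‖α j‖₊ ^ 2) P) {a : Coord d → ℝ} (ha : l2 a ≤ 1) :
    ExpSqMoment (fun ω => X ω ⬝ᵥ a) q P := by
  have h1 := HasSubgaussianMGF.sum_of_dependent (P := P) Finset.univ
    fun m => h m fun j => a ⟨m, j⟩
  have h2 : (fun ω => ∑ m, ∑ j, a ⟨m, j⟩ * X ω ⟨m, j⟩) = fun ω => X ω ⬝ᵥ a := by
    ext ω
    rw [dotProduct, Fintype.sum_sigma]
    simp only [mul_comm]
  rw [h2] at h1
  refine HasSubgaussianMGF.expSqMoment h1 hq ?_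
  have h3 : ∑ m, ∑ j, a ⟨m, j⟩ ^ 2 = l2 a ^ 2 := by rw [l2_sq, Fintype.sum_sigma]
  have h4 : l2 a ^ 2 ≤ 1 := pow_le_one₀ (l2_nonneg a) ha
  rw [← Finset.mul_sum]
  push_cast
  simp only [Real.norm_eq_abs, sq_abs, Finset.card_univ, Fintype.card_fin, h3]
  calc 4 * q * (M * (C * l2 a ^ 2)) = 4 * q * (M * C) * l2 a ^ 2 := by ring
    _ ≤ 1 * 1 := by gcongr
    _ = 1 := by norm_num

/-- A rate at which all the variables of the model have square-exponential moments. -/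
noncomputable def rate (M k : ℕ) (C : ℝ≥0) : ℝ :=
  1 / (4 * (M * C + 2 * (C * (k * C ^ 2) + C) + C + 1))

lemma rate_pos (M k : ℕ) (C : ℝ≥0) : 0 < rate M k C := by
  unfold rate; positivity

lemma four_mul_rate_mul_le {M k : ℕ} {C : ℝ≥0} {v : ℝ}
    (hv : v ≤ M * C + 2 * (C * (k * C ^ 2) + C) + C + 1) : 4 * rate M k C * v ≤ 1 := by
  unfold rate
  rw [mul_one_div, div_mul_eq_mul_div, div_le_one (by positivity)]
  linarith

variable {D : Model p K n Ω} {P : Measure Ω} {σ2 c : ℝ} {C : ℝ≥0}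

lemma measurable_x (h : D.IsFactorRegression P σ2) (i : Fin n) : Measurable (D.x i) := by
  have h1 := h.measurable_f i
  have h2 := h.measurable_u i
  refine measurable_pi_lambda _ fun j => ?_
  unfold x
  fun_prop

lemma integral_ε_sq (h : D.IsFactorRegression P σ2) (i : Fin n) :
    ∫ ω, D.ε i ω ^ 2 ∂P = σ2 := by
  rw [← h.var_ε i, variance_eq_integral (h.measurable_ε i).aemeasurable, h.mean_ε]
  simp

variable [IsProbabilityMeasure P]

lemma SubGaussianCondition.expSqMoment_f (h : D.SubGaussianCondition P C) (k : ℕ) (i : Fin n)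
    {a : Coord K → ℝ} (ha : l2 a ≤ 1) :
    ExpSqMoment (fun ω => D.f i ω ⬝ᵥ a) (rate M k C) P :=
  expSqMoment_dotProduct (rate_pos M k C).le (four_mul_rate_mul_le (by
    have : (0 : ℝ) ≤ 2 * (C * (k * C ^ 2) + C) + C + 1 := by positivity
    linarith)) (h.subG_f i) ha

lemma SubGaussianCondition.expSqMoment_u (h : D.SubGaussianCondition P C) (k : ℕ) (i : Fin n)
    {a : Coord p → ℝ} (ha : l2 a ≤ 1) :
    ExpSqMoment (fun ω => D.u i ω ⬝ᵥ a) (rate M k C) P :=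
  expSqMoment_dotProduct (rate_pos M k C).le (four_mul_rate_mul_le (by
    have : (0 : ℝ) ≤ 2 * (C * (k * C ^ 2) + C) + C + 1 := by positivity
    linarith)) (h.subG_u i) ha

lemma SubGaussianCondition.expSqMoment_ε (h : D.SubGaussianCondition P C) (k : ℕ) (i : Fin n) :
    ExpSqMoment (D.ε i) (rate M k C) P :=
  HasSubgaussianMGF.expSqMoment (h.subG_ε i) (rate_pos M k C).le (four_mul_rate_mul_le (by
    have : (0 : ℝ) ≤ M * C + 2 * (C * (k * C ^ 2) + C) + 1 := by positivity
    linarith))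

lemma SubGaussianCondition.memLp_f (h : D.SubGaussianCondition P C) (i : Fin n) (a : Coord K) :
    MemLp (fun ω => D.f i ω a) 2 P := by
  simpa using (h.expSqMoment_f 0 i (l2_single_le a)).memLp_two (rate_pos M 0 C)

lemma SubGaussianCondition.memLp_u (h : D.SubGaussianCondition P C) (i : Fin n) (a : Coord p) :
    MemLp (fun ω => D.u i ω a) 2 P := by
  simpa using (h.expSqMoment_u 0 i (l2_single_le a)).memLp_two (rate_pos M 0 C)

/-- Single covariates are sub-Gaussian uniformly in the dimension, since the loadings are bounded
and the number of factors is fixed. -/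
lemma SubGaussianCondition.expSqMoment_x (h : D.SubGaussianCondition P C)
    (hΛ : ∀ m j k, |D.Λ m j k| ≤ C) (i : Fin n) (j : Coord p) :
    ExpSqMoment (fun ω => D.x i ω j) (rate M (∑ m, K m) C) P := by
  have h1 := h.subG_f i j.1 fun k => D.Λ j.1 j.2 k
  have h2 := h.subG_u i j.1 (Pi.single j.2 1)
  have h3 := h1.add h2
  have e : (fun ω => ∑ k, D.Λ j.1 j.2 k * D.f i ω ⟨j.1, k⟩
      + ∑ l, (Pi.single j.2 (1 : ℝ) : Fin (p j.1) → ℝ) l * D.u i ω ⟨j.1, l⟩)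
      = fun ω => D.x i ω j := by
    ext ω
    simp [x, Pi.single_apply]
  rw [e] at h3
  refine HasSubgaussianMGF.expSqMoment h3 (rate_pos M _ C).le (four_mul_rate_mul_le ?_)
  have b1 : ∑ k, ‖D.Λ j.1 j.2 k‖₊ ^ 2 ≤ ((∑ m, K m : ℕ) : ℝ≥0) * C ^ 2 := by
    calc ∑ k, ‖D.Λ j.1 j.2 k‖₊ ^ 2 ≤ ∑ _k : Fin (K j.1), C ^ 2 :=
          Finset.sum_le_sum fun k _ => by
            gcongr
            rw [← NNReal.coe_le_coe]
            simpa using hΛ j.1 j.2 k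
      _ = (K j.1 : ℝ≥0) * C ^ 2 := by simp
      _ ≤ _ := by
          gcongr
          exact Finset.single_le_sum (f := K) (fun _ _ => Nat.zero_le _) (Finset.mem_univ j.1)
  have b2 : ∑ l, ‖(Pi.single j.2 (1 : ℝ) : Fin (p j.1) → ℝ) l‖₊ ^ 2 = 1 := by
    rw [Finset.sum_eq_single j.2 (by simp +contextual) (by simp)]
    simp
  rw [b2, mul_one]
  have b3 : ∀ x y : ℝ≥0, (x.sqrt + y.sqrt) ^ 2 ≤ 2 * (x + y) := fun x y => by
    have := add_sq_le (a := x.sqrt) (b := y.sqrt)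
    simpa using this
  have b4 := b3 (C * ∑ k, ‖D.Λ j.1 j.2 k‖₊ ^ 2) C
  have b5 : 2 * (C * ∑ k, ‖D.Λ j.1 j.2 k‖₊ ^ 2 + C)
      ≤ 2 * (C * (((∑ m, K m : ℕ) : ℝ≥0) * C ^ 2) + C) := by gcongr
  have b6 := b4.trans b5
  rw [← NNReal.coe_le_coe] at b6
  have b7 : (0 : ℝ) ≤ M * C + C + 1 := by positivity
  push_cast at b6 ⊢
  linarith

lemma integral_x_mul_ε (h : D.IsFactorRegression P σ2) (hs : D.SubGaussianCondition P C)
    (i : Fin n) (j : Coord p) : ∫ ω, D.x i ω j * D.ε i ω ∂P = 0 := by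
  have hε : MemLp (D.ε i) 2 P := (hs.expSqMoment_ε 0 i).memLp_two (rate_pos M 0 C)
  have hf : ∀ a, ∫ ω, D.f i ω a * D.ε i ω ∂P = 0 := fun a => by
    have := h.uncorr_ε_f i a
    simp only [covariance, h.mean_ε, hs.mean_f, sub_zero] at this
    simpa only [mul_comm] using this
  have hu : ∫ ω, D.u i ω j * D.ε i ω ∂P = 0 := by
    have := h.uncorr_ε_u i j
    simp only [covariance, h.mean_ε, hs.mean_u, sub_zero] at this
    simpa only [mul_comm] using this
  have e : ∀ ω, D.x i ω j * D.ε i ω = ∑ k, D.Λ j.1 j.2 k * (D.f i ω ⟨j.1, k⟩ * D.ε i ω)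
      + D.u i ω j * D.ε i ω := fun ω => by
    rw [x, add_mul, Finset.sum_mul]
    congr 1
    exact Finset.sum_congr rfl fun k _ => by ring
  have i1 : ∀ k, Integrable (fun ω => D.Λ j.1 j.2 k * (D.f i ω ⟨j.1, k⟩ * D.ε i ω)) P := fun k =>
    ((hs.memLp_f i _).integrable_mul hε).const_mul _
  have i2 : Integrable (fun ω => D.u i ω j * D.ε i ω) P := (hs.memLp_u i j).integrable_mul hε
  simp_rw [e]
  rw [integral_add (integrable_finsetSum _ fun k _ => i1 k) i2,
    integral_finsetSum _ fun k _ => i1 k, hu]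
  simp [integral_const_mul, hf]

lemma designCondition (h : D.IsFactorRegression P σ2) (hs : D.SubGaussianCondition P C)
    (hl : D.LoadingCondition P c C) :
    DesignCondition D.f D.u P (rate M (∑ m, K m) C) c where
  measurable_F := h.measurable_f
  measurable_U := h.measurable_u
  indep := h.indep.comp (fun _ z => (z.1, z.2.1)) fun _ => by fun_prop
  ident i i' := (h.ident i i').comp measurable_fst
  uncorr i a b := by
    have := h.uncorr_f_u i a b
    simpa only [covariance, hs.mean_f, hs.mean_u, sub_zero] using this
  exp_F i _ ha := hs.expSqMoment_f _ i ha
  exp_U i _ ha := hs.expSqMoment_u _ i ha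
  lower_U i v := by
    have h1 := hl.minEigenvalue i v
    have h2 : v ⬝ᵥ v = l2 v ^ 2 := by rw [l2_sq, dotProduct]; simp only [sq]
    have h3 : v ⬝ᵥ (D.covU P i *ᵥ v) = ∫ ω, (D.u i ω ⬝ᵥ v) ^ 2 ∂P := by
      simp only [sq (_ ⬝ᵥ _)]
      rw [integral_dotProduct_mul_dotProduct (hs.memLp_u i) (hs.memLp_u i)]
      simp only [dotProduct, Matrix.mulVec, Finset.mul_sum, covU, Matrix.of_apply, covariance,
        hs.mean_u, sub_zero]
      exact Finset.sum_congr rfl fun j _ => Finset.sum_congr rfl fun k _ => by ring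
    rwa [h2, h3] at h1

end Model

/-! ### Consistency of the residual variance -/

/-- The event on which the covariates fail the restricted eigenvalue condition at sparsity `s`. -/
def restrictedEigenvalueFails {ι Ω : Type*} [Fintype ι] {n : ℕ} (x : Fin n → Ω → ι → ℝ) (κ : ℝ)
    (s : ℕ) : Set Ω :=
  {ω | ¬ ∀ v, l1 v ≤ 4 * √s * l2 v → κ * l2 v ^ 2 ≤ (n : ℝ)⁻¹ * ∑ i, (x i ω ⬝ᵥ v) ^ 2}

lemma card_coord {M : ℕ} (d : Fin M → ℕ) : Fintype.card (Coord d) = ∑ m, d m := by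
  simp [Coord]

/-- The restricted eigenvalue condition for the factor model, including the degenerate sparsity
`s = 0`, where it is void. -/
lemma Model.exists_measure_restrictedEigenvalueFails_le (M : ℕ) (K : Fin M → ℕ) {c : ℝ}
    (hc : 0 < c) (C : ℝ≥0) :
    ∃ κ A ρ : ℝ, 0 < κ ∧ 0 ≤ A ∧ 0 < ρ ∧
      ∀ {n : ℕ} {p : Fin M → ℕ} {Ω : Type*} [MeasurableSpace Ω] {P : Measure Ω}
        [IsProbabilityMeasure P] {D : Model p K n Ω} {σ2 : ℝ}, D.IsFactorRegression P σ2 →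
        D.SubGaussianCondition P C → D.LoadingCondition P c C →
        ∀ {s : ℕ}, s ≤ ∑ m, p m → s * Real.log (2 * (∑ m, p m : ℕ) + 1) ≤ ρ * n →
        P (restrictedEigenvalueFails D.x κ s)
          ≤ ENNReal.ofReal (A * (s * Real.log (2 * (∑ m, p m : ℕ) + 1) / n)) := by
  obtain ⟨κ, A, ρ, hκ, hA, hρ, h⟩ := exists_restricted_eigenvalue (∑ m, K m) ⌈4 * (C : ℝ)⌉₊
    (Model.rate_pos M (∑ m, K m) C) hc
  refine ⟨κ, A, ρ, hκ, hA, hρ, ?_⟩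
  intro n p Ω _ P _ D σ2 hM hS hL s hsp hs
  rcases Nat.eq_zero_or_pos s with rfl | hs0
  · have : restrictedEigenvalueFails D.x κ 0 = ∅ := by
      ext ω
      simp only [restrictedEigenvalueFails, Set.mem_ofPred_eq, Set.mem_empty_iff_false,
        iff_false, not_not]
      intro v hv
      have h1 : l2 v = 0 := by
        simp only [CharP.cast_eq_zero, Real.sqrt_zero, mul_zero, zero_mul] at hv
        have h0 := le_antisymm hv (l1_nonneg v)
        have : v = 0 := by
          ext j
          have := (Finset.sum_eq_zero_iff_of_nonneg fun j _ => abs_nonneg (v j)).1 h0 j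
            (Finset.mem_univ j)
          simpa using this
        rw [this]
        simp [l2]
      rw [h1]
      have : 0 ≤ (n : ℝ)⁻¹ * ∑ i, (D.x i ω ⬝ᵥ v) ^ 2 := by positivity
      simpa using this
    rw [this]
    simp
  · have h1 := h (Model.designCondition hM hS hL) (card_coord K) hs0
      (by rwa [card_coord]) (by rwa [card_coord]) (T := D.loadingsApply)
      (fun r v => by
        ext a
        simp only [Model.loadingsApply, Pi.smul_apply, smul_eq_mul, Finset.mul_sum]
        exact Finset.sum_congr rfl fun j _ => by ring)
      (fun v a => by
        have h2 := D.abs_loadingsApply_le C.2 hL.loading_le v a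
        have h3 : 4 * (C : ℝ) * l1 v ≤ ⌈4 * (C : ℝ)⌉₊ * l1 v :=
          mul_le_mul_of_nonneg_right (Nat.le_ceil _) (l1_nonneg v)
        simp only [NNReal.val_eq_coe] at h2
        linarith)
    rw [card_coord] at h1
    simp only [restrictedEigenvalueFails, Model.x_dotProduct]
    exact h1

/-- Choice of a candidate set for the error of the Lasso and of a bound for the noise. If there are
more than `n ^ (1 / 4)` covariates, the support of `β` and half the penalty will do. Otherwise the
maximal correlation with the noise need not be below the penalty with high probability, but then
all the coordinates may be taken as the candidate set, with the larger bound `n ^ (-1 / 4)`. -/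
lemma Model.exists_candidate_set {M : ℕ} {p K : Fin M → ℕ} {n : ℕ} {Ω : Type*}
    [MeasurableSpace Ω] {P : Measure Ω} [IsProbabilityMeasure P] {D : Model p K n Ω}
    {σ2 c θ q Clam : ℝ} {C : ℝ≥0} (hq : q = rate M (∑ m, K m) C)
    (hM : D.IsFactorRegression P σ2) (hS : D.SubGaussianCondition P C)
    (hL : D.LoadingCondition P c C) (hn : 0 < n) (hClam : 24 / q ≤ Clam)
    (hθ : θ = 1 / √√(n : ℝ) + D.sparsity * Real.log (∑ m, p m : ℕ) / n) :
    ∃ (S : Finset (Coord p)) (Λ : ℝ), 0 ≤ Λ ∧ (∀ j ∉ S, D.β j = 0) ∧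
      (S = Finset.univ ∨ (2 * Λ ≤ Clam * √(Real.log (∑ m, p m : ℕ) / n) ∧
        0 < Clam * √(Real.log (∑ m, p m : ℕ) / n))) ∧
      S.card * Real.log (2 * (∑ m, p m : ℕ) + 1) / n ≤ 3 * θ ∧
      S.card * (Λ + Clam * √(Real.log (∑ m, p m : ℕ) / n)) ^ 2
        ≤ (2 + 2 * Clam ^ 2 + (12 / q + Clam) ^ 2) * θ ∧
      P {ω | ¬ ∀ j, |(n : ℝ)⁻¹ * ∑ i, D.x i ω j * D.ε i ω| ≤ Λ}
        ≤ ENNReal.ofReal ((4 / q ^ 2 + 3) * θ) := by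
  classical
  have hq0 : 0 < q := hq ▸ rate_pos M _ C
  have hcard := card_coord p
  set pn := ∑ m, p m with hpn
  have hn1 : (1 : ℝ) ≤ n := by exact_mod_cast hn
  set r := √√(n : ℝ) with hr
  have hr1 : 1 ≤ r := Real.one_le_sqrt.2 (Real.one_le_sqrt.2 hn1)
  have hr4 : (n : ℝ) = r ^ 4 := by
    rw [show r ^ 4 = (r ^ 2) ^ 2 by ring, hr, Real.sq_sqrt (Real.sqrt_nonneg _),
      Real.sq_sqrt (by positivity)]
  have hClam0 : 0 < Clam := lt_of_lt_of_le (by positivity) hClam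
  have hlog0 : 0 ≤ Real.log pn := Real.log_natCast_nonneg pn
  set τ := √(Real.log pn / n) with hτ
  have hτ0 : 0 ≤ τ := Real.sqrt_nonneg _
  have hτ2 : τ ^ 2 = Real.log pn / n := Real.sq_sqrt (by positivity)
  have hσ0 : 0 ≤ D.sparsity * Real.log pn / n := by positivity
  have hθr : 1 / r ≤ θ := by rw [hθ]; linarith
  have hθσ : D.sparsity * Real.log pn / n ≤ θ := by
    have : 0 ≤ 1 / r := by positivity
    rw [hθ]; linarith
  have hθ0 : 0 ≤ θ := (by positivity : 0 ≤ 1 / r).trans hθr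
  have hind : iIndepFun (fun i ω => (D.x i ω, D.ε i ω)) P := by
    have := hM.indep.comp (fun _ z => ((fun j : Coord p =>
      ∑ k : Fin (K j.1), D.Λ j.1 j.2 k * z.1 ⟨j.1, k⟩ + z.2.1 j), z.2.2)) fun _ => by fun_prop
    exact this
  have hX : ∀ i j, ExpSqMoment (fun ω => D.x i ω j) q P := fun i j =>
    hq ▸ hS.expSqMoment_x hL.loading_le i j
  have hε : ∀ i, ExpSqMoment (D.ε i) q P := fun i => hq ▸ hS.expSqMoment_ε _ i
  have h0 := Model.integral_x_mul_ε hM hS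
  rcases le_or_gt (pn : ℝ) r with hsmall | hlarge
  · refine ⟨Finset.univ, 1 / r, by positivity, by simp, Or.inl rfl, ?_, ?_, ?_⟩
    · rw [Finset.card_univ, hcard]
      have h1 : Real.log (2 * (pn : ℝ) + 1) ≤ 2 * pn := by
        have := Real.log_le_sub_one_of_pos (by positivity : 0 < 2 * (pn : ℝ) + 1)
        linarith
      have h2 : Real.log (2 * (pn : ℝ) + 1) ≤ 2 * r := by linarith
      calc pn * Real.log (2 * (pn : ℝ) + 1) / n ≤ r * (2 * r) / n := by
            have h3 : 0 ≤ Real.log (2 * (pn : ℝ) + 1) :=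
              Real.log_nonneg (by linarith [Nat.cast_nonneg (α := ℝ) pn])
            gcongr
        _ = 2 * (1 / r) * (1 / r) := by rw [hr4]; field_simp
        _ ≤ 2 * (1 / r) * 1 := by
            gcongr
            exact (div_le_one (by positivity)).2 hr1
        _ ≤ _ := by linarith
    · rw [Finset.card_univ, hcard]
      have h1 : pn * (1 / r) ^ 2 ≤ 1 / r := by
        calc pn * (1 / r) ^ 2 ≤ r * (1 / r) ^ 2 := by gcongr
          _ = _ := by field_simp
      have h2 : pn * τ ^ 2 ≤ 1 / r := by
        rw [hτ2]
        have h3 : Real.log pn ≤ pn := Real.log_le_self (by positivity)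
        calc pn * (Real.log pn / n) ≤ r * (r / n) := by
              gcongr
              exact h3.trans hsmall
          _ = 1 / r * (1 / r) := by rw [hr4]; field_simp
          _ ≤ 1 / r * 1 := by
              gcongr
              exact (div_le_one (by positivity)).2 hr1
          _ = _ := mul_one _
      calc pn * (1 / r + Clam * τ) ^ 2 ≤ pn * (2 * ((1 / r) ^ 2 + (Clam * τ) ^ 2)) := by
            gcongr; exact add_sq_le
        _ = 2 * (pn * (1 / r) ^ 2) + 2 * Clam ^ 2 * (pn * τ ^ 2) := by ring
        _ ≤ 2 * θ + 2 * Clam ^ 2 * θ := by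
            gcongr
            · exact h1.trans hθr
            · exact h2.trans hθr
        _ ≤ _ := by
            have : 0 ≤ (12 / q + Clam) ^ 2 * θ := by positivity
            linarith
    · refine (measure_exists_le_abs_average_mul_le hq0 hind hX hε h0
        (by positivity : 0 < 1 / r)).trans (ENNReal.ofReal_le_ofReal ?_)
      rw [hcard]
      calc pn * (4 / q ^ 2 / (n * (1 / r) ^ 2)) ≤ r * (4 / q ^ 2 / (n * (1 / r) ^ 2)) := by
            gcongr
        _ = 4 / q ^ 2 * (1 / r) := by rw [hr4]; field_simp
        _ ≤ 4 / q ^ 2 * θ := by gcongr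
        _ ≤ _ := by linarith
  · have hpn1 : (1 : ℝ) < pn := lt_of_le_of_lt hr1 hlarge
    have hpn2 : (2 : ℝ) ≤ pn := by
      have : 1 < pn := by exact_mod_cast hpn1
      exact_mod_cast this
    have hlogpos : 0 < Real.log pn := Real.log_pos hpn1
    have hτpos : 0 < τ := Real.sqrt_pos.2 (by positivity)
    have hsp : ((Finset.univ.filter fun j => D.β j ≠ 0).card : ℝ) = D.sparsity := by
      rw [Model.sparsity]
    refine ⟨Finset.univ.filter fun j => D.β j ≠ 0, 12 / q * τ, by positivity, by simp,
      Or.inr ⟨?_, by positivity⟩, ?_, ?_, ?_⟩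
    · calc 2 * (12 / q * τ) = 24 / q * τ := by ring
        _ ≤ _ := by gcongr
    · rw [hsp]
      have h1 : Real.log (2 * (pn : ℝ) + 1) ≤ 3 * Real.log pn := by
        rw [show 3 * Real.log pn = ((3 : ℕ) : ℝ) * Real.log pn by norm_num, ← Real.log_pow]
        apply Real.log_le_log (by positivity)
        nlinarith [mul_le_mul hpn2 hpn2 (by norm_num) (by linarith)]
      calc D.sparsity * Real.log (2 * (pn : ℝ) + 1) / n
          ≤ D.sparsity * (3 * Real.log pn) / n := by gcongr
        _ = 3 * (D.sparsity * Real.log pn / n) := by ring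
        _ ≤ _ := by gcongr
    · rw [hsp]
      calc D.sparsity * (12 / q * τ + Clam * τ) ^ 2
          = (12 / q + Clam) ^ 2 * (D.sparsity * τ ^ 2) := by ring
        _ = (12 / q + Clam) ^ 2 * (D.sparsity * Real.log pn / n) := by rw [hτ2]; ring
        _ ≤ (12 / q + Clam) ^ 2 * θ := by gcongr
        _ ≤ _ := by
            have : 0 ≤ (2 + 2 * Clam ^ 2) * θ := by positivity
            linarith
    · have h1 := measure_noise_le (X := D.x) (ε := D.ε) hq0 hn
        (by rw [hcard]; exact_mod_cast (by linarith : (0 : ℝ) < pn)) hind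
        (Model.measurable_x hM) hM.measurable_ε hX hε h0
      rw [hcard] at h1
      refine h1.trans (ENNReal.ofReal_le_ofReal ?_)
      have h2 : 2 / (pn : ℝ) ≤ 2 * (1 / r) := by
        rw [mul_one_div]
        gcongr
      have h3 : 1 / (n : ℝ) ≤ 1 / r := by
        gcongr
        rw [hr4]
        exact le_self_pow₀ hr1 (by norm_num)
      have h4 : 0 ≤ 4 / q ^ 2 * θ := by positivity
      linarith

/-- Non-asymptotic form of the consistency of the residual variance. -/
theorem Model.exists_measure_le_abs_residualVariance_sub_le (M : ℕ) (K : Fin M → ℕ) {c : ℝ}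
    (hc : 0 < c) (C : ℝ≥0) :
    ∃ C₀ : ℝ, 0 < C₀ ∧ ∀ Clam : ℝ, C₀ ≤ Clam → ∃ A ρ : ℝ, 0 < ρ ∧
      ∀ {n : ℕ} {p : Fin M → ℕ} {Ω : Type*} [MeasurableSpace Ω] {P : Measure Ω}
        [IsProbabilityMeasure P] {D : Model p K n Ω} {σ2 : ℝ}, D.IsFactorRegression P σ2 →
        D.SubGaussianCondition P C → D.LoadingCondition P c C → 0 < n →
        ∀ {b : Ω → Coord p → ℝ},
        (∀ ω, IsLasso (fun i => D.x i ω) (fun i => D.y i ω)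
          (Clam * √(Real.log (∑ m, p m : ℕ) / (n : ℝ))) (b ω)) →
        ∀ {θ : ℝ}, θ = 1 / √√(n : ℝ) + D.sparsity * Real.log (∑ m, p m : ℕ) / n → θ ≤ ρ →
        ∀ {δ : ℝ}, 0 < δ → A * θ < δ / 2 →
          P {ω | δ ≤ |residualVariance (fun i => D.x i ω) (fun i => D.y i ω) (b ω) - σ2|}
            ≤ ENNReal.ofReal (A * θ + A / (n * δ ^ 2)) := by
  obtain ⟨κ, A₁, ρ, hκ, hA₁, hρ, hRE⟩ :=
    Model.exists_measure_restrictedEigenvalueFails_le M K hc C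
  set q := rate M (∑ m, K m) C with hq
  have hq0 : 0 < q := rate_pos M _ C
  refine ⟨24 / q, by positivity, fun Clam hClam => ?_⟩
  set A₂ := 2 + 2 * Clam ^ 2 + (12 / q + Clam) ^ 2 with hA₂
  refine ⟨3 * A₁ + (4 / q ^ 2 + 3) + 128 / κ * A₂ + 16 / q ^ 2, ρ / 3, by positivity, ?_⟩
  intro n p Ω _ P _ D σ2 hM hS hL hn b hb θ hθ hθρ δ hδ hAδ
  obtain ⟨S, Λ, hΛ, hSβ, hcase, hS1, hS2, hnoise⟩ :=
    Model.exists_candidate_set hq hM hS hL hn hClam hθ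
  have hn0 : (0 : ℝ) < n := by exact_mod_cast hn
  have hθ0 : 0 ≤ θ := by
    have : 0 ≤ Real.log (∑ m, p m : ℕ) := Real.log_natCast_nonneg _
    rw [hθ]; positivity
  have hClam0 : 0 < Clam := lt_of_lt_of_le (by positivity) hClam
  -- Three events are excluded: failure of the restricted eigenvalue condition, a large correlation
  -- with the errors, and a large deviation of the average squared error.
  have pRE := hRE hM hS hL (s := S.card) (by rw [← card_coord p]; exact Finset.card_le_univ S) (by
    rw [div_le_iff₀ hn0] at hS1
    refine hS1.trans ?_
    gcongr
    linarith)
  have hind : iIndepFun D.ε P := hM.indep.comp (fun _ z => z.2.2) fun _ => by fun_prop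
  have pε := measure_average_sq_sub_le hq0 hind
    (fun i => hS.expSqMoment_ε (∑ m, K m) i) (Model.integral_ε_sq hM) (half_pos hδ) hn
  refine (measure_mono (t := (restrictedEigenvalueFails D.x κ S.card ∪ _) ∪ _)
    fun ω hω => ?_).trans ((measure_union_le _ _).trans ((add_le_add ((measure_union_le _ _).trans
      (add_le_add pRE hnoise)) pε).trans ?_))
  · by_contra hgood
    simp only [Set.mem_union, not_or] at hgood
    obtain ⟨⟨g₁, g₂⟩, g₃⟩ := hgood
    simp only [restrictedEigenvalueFails, Set.mem_ofPred_eq, not_not, not_le] at g₁ g₂ g₃ hω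
    have h1 := abs_residualVariance_sub_le (lam := Clam * √(Real.log (∑ m, p m : ℕ) / (n : ℝ)))
      (by positivity) hΛ hκ hSβ g₂ hcase g₁ (hb ω)
    have h2 : 128 / κ * (S.card * (Λ + Clam * √(Real.log (∑ m, p m : ℕ) / (n : ℝ))) ^ 2)
        ≤ 128 / κ * (A₂ * θ) := by gcongr
    have h3 : 128 / κ * (A₂ * θ) < δ / 2 := by
      refine lt_of_le_of_lt ?_ hAδ
      rw [← mul_assoc]
      refine mul_le_mul_of_nonneg_right ?_ hθ0
      have : 0 ≤ 3 * A₁ + (4 / q ^ 2 + 3) + 16 / q ^ 2 := by positivity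
      linarith
    have h4 := (abs_add_le _ _).trans_lt (add_lt_add (h1.trans_lt (h2.trans_lt h3)) g₃)
    rw [sub_add_sub_cancel, add_halves] at h4
    exact absurd hω (not_le.2 h4)
  · rw [← ENNReal.ofReal_add _ (by positivity), ← ENNReal.ofReal_add _ (by positivity)]
    · apply ENNReal.ofReal_le_ofReal
      have e1 : A₁ * (S.card * Real.log (2 * (∑ m, p m : ℕ) + 1) / n) ≤ A₁ * (3 * θ) := by gcongr
      have e2 : 4 / q ^ 2 / (n * (δ / 2) ^ 2) = 16 / q ^ 2 / (n * δ ^ 2) := by field_simp; norm_num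
      have e3 : 16 / q ^ 2 / (n * δ ^ 2)
          ≤ (3 * A₁ + (4 / q ^ 2 + 3) + 128 / κ * A₂ + 16 / q ^ 2) / (n * δ ^ 2) := by
        gcongr
        have : 0 ≤ 3 * A₁ + (4 / q ^ 2 + 3) + 128 / κ * A₂ := by positivity
        linarith
      have e4 : 0 ≤ (128 / κ * A₂ + 16 / q ^ 2) * θ := by positivity
      rw [e2]
      linarith
    · have : 0 ≤ Real.log (2 * ((∑ m, p m : ℕ) : ℝ) + 1) :=
        Real.log_nonneg (by linarith [Nat.cast_nonneg (α := ℝ) (∑ m, p m)])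
      positivity
    · have : 0 ≤ Real.log (2 * ((∑ m, p m : ℕ) : ℝ) + 1) :=
        Real.log_nonneg (by linarith [Nat.cast_nonneg (α := ℝ) (∑ m, p m)])
      positivity

end FactorRegression

theorem proposition2 (M : ℕ) (K : Fin M → ℕ) (c : ℝ) (hc : 0 < c) (C : ℝ≥0) :
    ∃ C₀ : ℝ, 0 < C₀ ∧
      ∀ (Clam : ℝ), C₀ ≤ Clam →
      ∀ (p : ℕ → Fin M → ℕ) (Ω : ℕ → Type*) [∀ n, MeasurableSpace (Ω n)]
        (P : ∀ n, Measure (Ω n)) [∀ n, IsProbabilityMeasure (P n)]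
        (D : ∀ n, FactorRegression.Model (p n) K n (Ω n)) (σ2 : ℕ → ℝ)
        (_hModel : ∀ n, (D n).IsFactorRegression (P n) (σ2 n))
        (_hSubG : ∀ n, (D n).SubGaussianCondition (P n) C)
        (_hLoad : ∀ n, (D n).LoadingCondition (P n) c C)
        (_hSparse : Tendsto
          (fun n : ℕ => ((D n).sparsity : ℝ) * Real.log (∑ m, p n m : ℕ) / (n : ℝ)) atTop (𝓝 0))
        (betaTilde : ∀ n, Ω n → FactorRegression.Coord (p n) → ℝ)
        (_hLasso : ∀ n ω, FactorRegression.IsLasso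
          (fun i => (D n).x i ω) (fun i => (D n).y i ω)
          (Clam * √(Real.log (∑ m, p n m : ℕ) / (n : ℝ))) (betaTilde n ω)),
        ∀ δ : ℝ, 0 < δ →
          Tendsto (fun n : ℕ => P n {ω | δ ≤ |FactorRegression.residualVariance
            (fun i => (D n).x i ω) (fun i => (D n).y i ω) (betaTilde n ω) - σ2 n|})
            atTop (𝓝 0) := by
  obtain ⟨C₀, hC₀, h⟩ :=
    FactorRegression.Model.exists_measure_le_abs_residualVariance_sub_le M K hc C
  refine ⟨C₀, hC₀, fun Clam hClam => ?_⟩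
  obtain ⟨A, ρ, hρ, h⟩ := h Clam hClam
  intro p Ω _ P _ D σ2 hM hS hL hsparse b hb δ hδ
  set θ : ℕ → ℝ := fun n => 1 / √√(n : ℝ)
    + (D n).sparsity * Real.log (∑ m, p n m : ℕ) / n with hθ
  have hθ0 : Tendsto θ atTop (𝓝 0) := by
    have h1 : Tendsto (fun n : ℕ => 1 / √√(n : ℝ)) atTop (𝓝 0) :=
      tendsto_const_nhds.div_atTop (Real.tendsto_sqrt_atTop.comp
        (Real.tendsto_sqrt_atTop.comp tendsto_natCast_atTop_atTop))
    have h2 := h1.add hsparse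
    rw [add_zero] at h2
    exact h2
  have hAθ : Tendsto (fun n => A * θ n) atTop (𝓝 0) := by simpa using hθ0.const_mul A
  have hlim : Tendsto (fun n : ℕ => ENNReal.ofReal (A * θ n + A / (n * δ ^ 2))) atTop (𝓝 0) := by
    have h2 : Tendsto (fun n : ℕ => A / ((n : ℝ) * δ ^ 2)) atTop (𝓝 0) :=
      tendsto_const_nhds.div_atTop
        (tendsto_natCast_atTop_atTop.atTop_mul_const (by positivity))
    have h3 := hAθ.add h2
    rw [add_zero] at h3
    simpa using ENNReal.tendsto_ofReal h3
  refine tendsto_of_tendsto_of_tendsto_of_le_of_le' tendsto_const_nhds hlim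
    (Eventually.of_forall fun _ => zero_le) ?_
  filter_upwards [hθ0.eventually (ge_mem_nhds hρ),
    hAθ.eventually (gt_mem_nhds (half_pos hδ)), eventually_gt_atTop 0] with n h1 h2 h3
  exact h (hM n) (hS n) (hL n) h3 (hb n) rfl h1 hδ h2
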